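/- **Theorem.** Let $\mathbb H=\{z=x+iy: y>0\}$ be the hyperbolic plane, on which $PSL(2,\mathbb R)$ acts by linear fractional transformations. Let $\Gamma$ be a finitely generated discrete subgroup of $PSL(2,\mathbb R)$, and let $P\subset\mathbb H$ be a closed finite-sided hyperbolically convex polygon (a finite intersection of closed hyperbolic half-planes with nonempty interior; ideal vertices are allowed) of finite hyperbolic area, which is a fundamental domain for $\Gamma$: the tiles $gP$, $g\in\Gamma$, cover $\mathbb H$, form a locally finite family, and $\mathrm{int}\,P\cap \mathrm{int}\,gP=\emptyset$ for $1\ne g\in\Gamma$. The alphabet $N_\Gamma(P)$ is the set of those $g\in\Gamma$, $g\neq 1$, for which $gP$ shares a side of positive length with $P$, the side being $P\cap gP$. The vertices of $P$ are the points lying on two different sides $P\cap gP$ and $P\cap g'P$ ($g\ne g'$ in $N_\Gamma(P)$) and the points of $P$ fixed by an element of $N_\Gamma(P)$. A general position geodesic is an oriented geodesic $\gamma$ of $\mathbb H$ which meets the interior of $P$, contains no vertex and no segment of positive length of a side of any tile $hP$ ($h\in\Gamma$), and has no endpoint at infinity in common with an ideal vertex of any tile. Such a $\gamma$ runs in order through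 tiles $h_iP$ ($i\in\mathbb Z$), with $h_i\in\Gamma$ and $h_0=1$; its cutting sequence is $(g_i)_{i\in\mathbb Z}$ with $g_i=h_{i-1}^{-1}h_i\in N_\Gamma(P)$. The cutting sequence shift $\Sigma_{P,\Gamma}\subset N_\Gamma(P)^{\mathbb Z}$ is the closure, in the product topology for the discrete alphabet, of the set of cutting sequences of all general position geodesics. Let $\mathcal F=\{z\in\mathbb H: |z|\ge 1,\ |\mathrm{Re}\,z|\le \tfrac12\}$ be the standard fundamental domain of $PSL(2,\mathbb Z)$. Suppose that there is a bijection $e:N_\Gamma(P)\to N_{PSL(2,\mathbb Z)}(\mathcal F)$ such that applying $e$ to each symbol carries $\Sigma_{P,\Gamma}$ onto $\Sigma_{\mathcal F,PSL(2,\mathbb Z)}$. Then there is a $g\in PSL(2,\mathbb R)$ with $$\mathcal F=gP\qquad\text{and}\qquad PSL(2,\mathbb Z)=g\,\Gamma\,g^{-1}.$$ -/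

import Mathlib

open scoped Pointwise MatrixGroups UpperHalfPlane

noncomputable section

/-- The action of `PSL(2, ℝ)` on the upper half-plane by linear fractional transformations,
obtained from Mathlib's action of `PGL(2, ℝ)`. -/
instance pslAction : MulAction PSL(2, ℝ) ℍ :=
  MulAction.compHom ℍ (Matrix.ProjectiveSpecialLinearGroup.toPGL (n := Fin 2) (R := ℝ))

/-- A class in `PSL(2, ℝ)` acts as any of its representatives in `SL(2, ℝ)`. -/
theorem psl_mk_smul (g : SL(2, ℝ)) (z : ℍ) : (QuotientGroup.mk g : PSL(2, ℝ)) • z = g • z := rfl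

/-- The modular group `PSL(2, ℤ)`, as a subgroup of `PSL(2, ℝ)`: the image of `SL(2, ℤ)`. -/
def modularGroup : Subgroup PSL(2, ℝ) :=
  ((QuotientGroup.mk' (Subgroup.center SL(2, ℝ))).comp
    (Matrix.SpecialLinearGroup.map (Int.castRingHom ℝ))).range

/-- A (closed) finite-sided convex hyperbolic polygon: a finite intersection of closed hyperbolic
half-planes with nonempty interior. The equation `a * |z| ^ 2 + b * Re z + c = 0`, with positive
discriminant, describes a geodesic line (a semicircle centred on the real axis if `a ≠ 0`, a
vertical line if `a = 0`), and every geodesic line has such an equation. Ideal vertices are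
allowed. -/
def IsConvexPolygon (P : Set ℍ) : Prop :=
  (∃ S : Finset (ℝ × ℝ × ℝ), (∀ q ∈ S, 0 < q.2.1 ^ 2 - 4 * q.1 * q.2.2) ∧
    P = {z : ℍ | ∀ q ∈ S, 0 ≤ q.1 * Complex.normSq (z : ℂ) + q.2.1 * z.re + q.2.2}) ∧
  (interior P).Nonempty

/-- `P` is a fundamental domain for `Γ`: the translates of `P` tessellate the upper half-plane,
and distinct elements of `Γ` give distinct tiles. (No element of `Γ` except the identity
preserves a `P` with nonempty interior, by `disjoint_interior`.) -/
structure IsFundamentalTile (Γ : Subgroup PSL(2, ℝ)) (P : Set ℍ) : Prop where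
  cover : ∀ z : ℍ, ∃ g ∈ Γ, z ∈ g • P
  disjoint_interior : ∀ g ∈ Γ, g ≠ 1 → Disjoint (interior P) (interior (g • P))
  locallyFinite : LocallyFinite fun g : Γ => (g : PSL(2, ℝ)) • P

/-- The neighborhood set `N_Γ(P)`: the elements `g ≠ 1` of `Γ` for which the tile `g • P` shares
with `P` a side of positive length. For convex `P` the intersection `P ∩ g • P` is convex,
so that it contains a segment of positive length as soon as it has two points. These `g` are the
side-pairing elements: `g` maps the side `P ∩ g⁻¹ • P` onto the side `P ∩ g • P`. -/
def neighborhoodSet (Γ : Subgroup PSL(2, ℝ)) (P : Set ℍ) : Set PSL(2, ℝ) :=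
  {g | g ∈ Γ ∧ g ≠ 1 ∧ (P ∩ g • P).Nontrivial}

/-- The vertices of `P` as a fundamental domain for `Γ`: the points common to two different sides,
and the elliptic vertices, which are the points of `P` fixed by a side-pairing element. -/
def vertexSet (Γ : Subgroup PSL(2, ℝ)) (P : Set ℍ) : Set ℍ :=
  {z | z ∈ P ∧ ((∃ g ∈ neighborhoodSet Γ P, ∃ g' ∈ neighborhoodSet Γ P,
      g ≠ g' ∧ z ∈ g • P ∧ z ∈ g' • P) ∨ ∃ g ∈ neighborhoodSet Γ P, g • z = z)}

/-- The inclusion of the upper half-plane in the Riemann sphere. -/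
def toSphere (z : ℍ) : OnePoint ℂ := ((z : ℂ) : OnePoint ℂ)

/-- The points at infinity of a closed subset of the upper half-plane. For a geodesic these are its
two endpoints, for a convex polygon of finite area its ideal vertices. -/
def idealPoints (X : Set ℍ) : Set (OnePoint ℂ) :=
  closure (toSphere '' X) \ Set.range toSphere

/-- The oriented geodesic, with unit speed, which is the image under `u` of the geodesic
`t ↦ i * exp t` from `0` to `∞`. Every oriented geodesic is of this form. -/
def geodesic (u : PSL(2, ℝ)) (t : ℝ) : ℍ :=
  u • (⟨⟨0, Real.exp t⟩, Real.exp_pos t⟩ : ℍ)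

/-- General position geodesics: they meet the interior of `P`, contain no vertex and no part of
positive length of a side of any translate of `P`, and have no endpoint in common with the
ideal vertices of any translate of `P`. -/
structure IsGeneralPosition (Γ : Subgroup PSL(2, ℝ)) (P : Set ℍ) (γ : ℝ → ℍ) : Prop where
  meets_interior : (Set.range γ ∩ interior P).Nonempty
  no_vertex : ∀ h ∈ Γ, Disjoint (Set.range γ) (h • vertexSet Γ P)
  no_side : ∀ h ∈ Γ, ∀ g ∈ neighborhoodSet Γ P,
    (Set.range γ ∩ h • (P ∩ g • P)).Subsingleton
  no_ideal_vertex : ∀ h ∈ Γ, Disjoint (idealPoints (Set.range γ)) (idealPoints (h • P))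

/-- `c` is the cutting sequence of `γ`: the geodesic visits in order the tiles `h i • P`, where
`h 0 = 1`, being in the interior of `h i • P` in the time between `t i` and `t (i + 1)`.
At the crossing from `h (i - 1) • P` to `h i • P` the symbol is the label of the side by which
`γ` enters `h i • P`, written inside `h i • P`; the side `P ∩ g⁻¹ • P` of `P` has label `g` on its
inside, so the symbol is the `c i` with `h i = h (i - 1) * c i`. -/
def IsCuttingSequence (Γ : Subgroup PSL(2, ℝ)) (P : Set ℍ) (γ : ℝ → ℍ)
    (c : ℤ → neighborhoodSet Γ P) : Prop :=
  ∃ (h : ℤ → PSL(2, ℝ)) (t : ℤ → ℝ), h 0 = 1 ∧ (∀ i, h i ∈ Γ) ∧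
    (∀ i, h i = h (i - 1) * (c i : PSL(2, ℝ))) ∧
    StrictMono t ∧ Filter.Tendsto t Filter.atTop Filter.atTop ∧
    Filter.Tendsto t Filter.atBot Filter.atBot ∧
    ∀ i, ∀ s ∈ Set.Ioo (t i) (t (i + 1)), γ s ∈ interior (h i • P)

/-- The set of all cutting sequences of general position geodesics. -/
def cuttingSequences (Γ : Subgroup PSL(2, ℝ)) (P : Set ℍ) : Set (ℤ → neighborhoodSet Γ P) :=
  {c | ∃ u : PSL(2, ℝ), IsGeneralPosition Γ P (geodesic u) ∧
    IsCuttingSequence Γ P (geodesic u) c}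

/-- The cutting sequence shift `Σ_{P, Γ}`: the closure of the set of cutting sequences in the
symbol topology, which is the product topology for the discrete topology on the alphabet. -/
def cuttingShift (Γ : Subgroup PSL(2, ℝ)) (P : Set ℍ) : Set (ℤ → neighborhoodSet Γ P) :=
  letI : TopologicalSpace (neighborhoodSet Γ P) := ⊥
  closure (cuttingSequences Γ P)

end

noncomputable section

/-! ### Quadratic forms as affine functions in the parabola model -/

/-! The map `klein`, z ↦ (Re z, |z|²), carries ℍ onto the region above a parabola. There geodesics
are straight segments, half-planes are given by affine functions, and `PSL(2, ℝ)` acts projectively.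
Separation of tiles, the fact that a geodesic never re-enters a tile, and the order in which it
crosses lines thus become plane affine geometry, computed with binary quadratic forms.

The conjugacy of shifts is used only through words: a finite word occurs in one shift exactly when
its relabelling occurs in the other (`occurs_transfer`). Existence of words rests on
`exists_countable_exceptions`: in a family of parallel lines all but countably many are in general
position and have an itinerary. A geodesic with prescribed open behaviour can therefore always be
moved slightly to one with a cutting sequence.

The modular alphabet is {T, T⁻¹, S}, and all powers of T and of T⁻¹ occur (`occurs_trans_zpow`). A
cutting sequence never visits a tile twice, so the two corresponding letters of P have infinite
order (`not_isOfFinOrder_of_occurs`). Since the alphabet of P is closed under inversion, these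
letters are g and g⁻¹, and the third letter is an involution s (`inv_eq_of_three`).

Consequently P is cut out by three half-planes (`exists_triangleTile`), and finite area forbids an
interval of ideal points. An element of infinite order has no fixed point in ℍ. A comparison of the
two sides paired by g then shows that they share an ideal point fixed by g
(`TriangleTile.offDiag_eq_zero`), and local finiteness makes g parabolic (`sq_eq_one_of_cusp`).
After conjugation g is T or T⁻¹, and P is the part of the strip |Re z| ≤ 1/2 above the circle |z| =
r, with s reversing that circle (`TriangleTile.exists_stripTile`).

It remains to find r. The horoball argument applied to (sT)³ leaves only r = 1, the modular tile, or
r² ≤ 1/2 (`StripTile.eq_one_or_le`). In the second case the angle at the vertex is so small that a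
geodesic passes around it reading T s T s (`StripTile.exists_word`). In the modular tessellation
such a word is impossible: one geodesic has the middle tile on one side and the two extreme tiles on
the other (`not_occurs_fd`). So r = 1, and P and Γ are conjugate to the modular tile and group. -/

/-- The value `a |z|² + b Re z + c` of a real form `(a, b, c)` at a point of `ℍ`. -/
def formEval (q : ℝ × ℝ × ℝ) (z : ℍ) : ℝ := q.1 * Complex.normSq (z : ℂ) + q.2.1 * z.re + q.2.2

/-- The value of the binary form `a x² + b x y + c y²` at a boundary vector. -/
def formBdry (q : ℝ × ℝ × ℝ) (x y : ℝ) : ℝ := q.1 * x ^ 2 + q.2.1 * x * y + q.2.2 * y ^ 2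

/-- The discriminant of a binary form. -/
def formDisc (q : ℝ × ℝ × ℝ) : ℝ := q.2.1 ^ 2 - 4 * q.1 * q.2.2

/-- The right action of `SL(2, ℝ)` on binary forms by substitution. -/
def formAct (q : ℝ × ℝ × ℝ) (g : SL(2, ℝ)) : ℝ × ℝ × ℝ :=
  (q.1 * g 0 0 ^ 2 + q.2.1 * g 0 0 * g 1 0 + q.2.2 * g 1 0 ^ 2,
    2 * q.1 * g 0 0 * g 0 1 + q.2.1 * (g 0 0 * g 1 1 + g 0 1 * g 1 0) + 2 * q.2.2 * g 1 0 * g 1 1,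
    q.1 * g 0 1 ^ 2 + q.2.1 * g 0 1 * g 1 1 + q.2.2 * g 1 1 ^ 2)

/-- The squared modulus of the automorphy factor `c z + d`. -/
def autFactor (g : SL(2, ℝ)) (z : ℍ) : ℝ :=
  g 1 0 ^ 2 * Complex.normSq (z : ℂ) + 2 * g 1 0 * g 1 1 * z.re + g 1 1 ^ 2

theorem normSq_eq (z : ℍ) : Complex.normSq (z : ℂ) = z.re ^ 2 + z.im ^ 2 := by
  rw [Complex.normSq_apply, UpperHalfPlane.coe_re, UpperHalfPlane.coe_im]; ring

theorem re_sq_lt_normSq (z : ℍ) : z.re ^ 2 < Complex.normSq (z : ℂ) := by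
  rw [normSq_eq]; nlinarith [z.im_pos]

theorem sl_det (g : SL(2, ℝ)) : g 0 0 * g 1 1 - g 0 1 * g 1 0 = 1 := by
  rw [← Matrix.det_fin_two]; exact g.2

theorem autFactor_pos (g : SL(2, ℝ)) (z : ℍ) : 0 < autFactor g z := by
  have h := sl_det g
  have hz := z.im_pos
  have e : autFactor g z = (g 1 0 * z.re + g 1 1) ^ 2 + (g 1 0 * z.im) ^ 2 := by
    unfold autFactor; rw [normSq_eq]; ring
  rw [e]
  by_cases hc : g 1 0 = 0
  · have : g 1 1 ≠ 0 := fun h1 => by simp [hc, h1] at h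
    simp only [hc, zero_mul, zero_add]; positivity
  · have := mul_ne_zero hc hz.ne'
    positivity

theorem autFactor_eq (g : SL(2, ℝ)) (z : ℍ) :
    autFactor g z = Complex.normSq ((g 1 0 : ℂ) * z + g 1 1) := by
  simp only [autFactor, Complex.normSq_apply, Complex.add_re, Complex.mul_re, Complex.ofReal_re,
    Complex.ofReal_im, Complex.add_im, Complex.mul_im, UpperHalfPlane.coe_re,
    UpperHalfPlane.coe_im]
  ring

theorem sl_coe_smul (g : SL(2, ℝ)) (z : ℍ) :
    ((g • z : ℍ) : ℂ) = ((g 0 0 : ℂ) * z + g 0 1) / ((g 1 0 : ℂ) * z + g 1 1) := by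
  rw [UpperHalfPlane.coe_specialLinearGroup_apply]; rfl

theorem re_smul_mul (g : SL(2, ℝ)) (z : ℍ) :
    (g • z).re * autFactor g z = g 0 0 * g 1 0 * Complex.normSq (z : ℂ) +
      (g 0 0 * g 1 1 + g 0 1 * g 1 0) * z.re + g 0 1 * g 1 1 := by
  have h0 := (autFactor_pos g z).ne'
  rw [← UpperHalfPlane.coe_re, sl_coe_smul, Complex.div_re, ← autFactor_eq, ← add_div,
    div_mul_cancel₀ _ h0]
  simp only [Complex.normSq_apply, Complex.add_re, Complex.mul_re, Complex.ofReal_re,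
    Complex.ofReal_im, Complex.add_im, Complex.mul_im, UpperHalfPlane.coe_re,
    UpperHalfPlane.coe_im]
  ring

theorem im_smul_mul (g : SL(2, ℝ)) (z : ℍ) : (g • z).im * autFactor g z = z.im := by
  have h0 := (autFactor_pos g z).ne'
  rw [← UpperHalfPlane.coe_im, sl_coe_smul, Complex.div_im, ← autFactor_eq, ← sub_div,
    div_mul_cancel₀ _ h0]
  simp only [Complex.add_re, Complex.mul_re, Complex.ofReal_re,
    Complex.ofReal_im, Complex.add_im, Complex.mul_im, UpperHalfPlane.coe_re,
    UpperHalfPlane.coe_im]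
  linear_combination z.im * sl_det g

theorem normSq_smul_mul (g : SL(2, ℝ)) (z : ℍ) :
    Complex.normSq ((g • z : ℍ) : ℂ) * autFactor g z = g 0 0 ^ 2 * Complex.normSq (z : ℂ) +
      2 * g 0 0 * g 0 1 * z.re + g 0 1 ^ 2 := by
  have h0 := (autFactor_pos g z).ne'
  rw [sl_coe_smul, Complex.normSq_div, ← autFactor_eq, div_mul_cancel₀ _ h0]
  simp only [Complex.normSq_apply, Complex.add_re, Complex.mul_re, Complex.ofReal_re,
    Complex.ofReal_im, Complex.add_im, Complex.mul_im, UpperHalfPlane.coe_re,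
    UpperHalfPlane.coe_im]
  ring

/-- Clearing the denominator |cz + d|², which is positive, turns the pullback of a half-plane into
substitution on coefficients. All sign comparisons under the group pass through this identity. -/
theorem formEval_smul_mul (q : ℝ × ℝ × ℝ) (g : SL(2, ℝ)) (z : ℍ) :
    formEval q (g • z) * autFactor g z = formEval (formAct q g) z := by
  have h1 := re_smul_mul g z
  have h2 := normSq_smul_mul g z
  have h3 : autFactor g z = g 1 0 ^ 2 * Complex.normSq (z : ℂ) + 2 * g 1 0 * g 1 1 * z.re +
    g 1 1 ^ 2 := rfl
  simp only [formEval, formAct]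
  linear_combination q.1 * h2 + q.2.1 * h1 + q.2.2 * h3

theorem formEval_smul_nonneg (q : ℝ × ℝ × ℝ) (g : SL(2, ℝ)) (z : ℍ) :
    0 ≤ formEval q (g • z) ↔ 0 ≤ formEval (formAct q g) z := by
  rw [← formEval_smul_mul, mul_nonneg_iff_of_pos_right (autFactor_pos g z)]

theorem formEval_smul_pos (q : ℝ × ℝ × ℝ) (g : SL(2, ℝ)) (z : ℍ) :
    0 < formEval q (g • z) ↔ 0 < formEval (formAct q g) z := by
  rw [← formEval_smul_mul, mul_pos_iff_of_pos_right (autFactor_pos g z)]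

theorem formEval_smul_eq_zero (q : ℝ × ℝ × ℝ) (g : SL(2, ℝ)) (z : ℍ) :
    formEval q (g • z) = 0 ↔ formEval (formAct q g) z = 0 := by
  rw [← formEval_smul_mul, mul_eq_zero, or_iff_left (autFactor_pos g z).ne']

@[simp] theorem formEval_neg (q : ℝ × ℝ × ℝ) (z : ℍ) : formEval (-q) z = -formEval q z := by
  simp [formEval]; ring

@[simp] theorem formEval_smul' (t : ℝ) (q : ℝ × ℝ × ℝ) (z : ℍ) :
    formEval (t • q) z = t * formEval q z := by
  simp [formEval]; ring

@[simp] theorem formEval_sub (q r : ℝ × ℝ × ℝ) (z : ℍ) :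
    formEval (q - r) z = formEval q z - formEval r z := by
  simp [formEval]; ring

theorem formAct_mul (q : ℝ × ℝ × ℝ) (g h : SL(2, ℝ)) :
    formAct q (g * h) = formAct (formAct q g) h := by
  simp only [formAct, Matrix.SpecialLinearGroup.coe_mul, Matrix.mul_apply, Fin.sum_univ_two]
  refine Prod.ext ?_ (Prod.ext ?_ ?_) <;> simp only <;> ring

@[simp] theorem formAct_one (q : ℝ × ℝ × ℝ) : formAct q 1 = q := by
  simp [formAct]

theorem formAct_negMat (q : ℝ × ℝ × ℝ) (g : SL(2, ℝ)) : formAct q (-g) = formAct q g := by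
  simp [formAct]

@[simp] theorem formAct_neg (q : ℝ × ℝ × ℝ) (g : SL(2, ℝ)) : formAct (-q) g = -formAct q g := by
  simp only [formAct, Prod.fst_neg, Prod.snd_neg]
  refine Prod.ext ?_ (Prod.ext ?_ ?_) <;> simp <;> ring

theorem formAct_sub (q r : ℝ × ℝ × ℝ) (g : SL(2, ℝ)) :
    formAct (q - r) g = formAct q g - formAct r g := by
  simp only [formAct, Prod.fst_sub, Prod.snd_sub]
  refine Prod.ext ?_ (Prod.ext ?_ ?_) <;> simp <;> ring

theorem formBdry_act (q : ℝ × ℝ × ℝ) (g : SL(2, ℝ)) (x y : ℝ) :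
    formBdry (formAct q g) x y = formBdry q (g 0 0 * x + g 0 1 * y) (g 1 0 * x + g 1 1 * y) := by
  simp only [formBdry, formAct]; ring

theorem formDisc_act (q : ℝ × ℝ × ℝ) (g : SL(2, ℝ)) : formDisc (formAct q g) = formDisc q := by
  have h := sl_det g
  simp only [formDisc, formAct]
  linear_combination (q.2.1 ^ 2 - 4 * q.1 * q.2.2) * (g 0 0 * g 1 1 - g 0 1 * g 1 0 + 1) * h

@[simp] theorem formDisc_neg (q : ℝ × ℝ × ℝ) : formDisc (-q) = formDisc q := by
  simp [formDisc]

/-! ### The parabola model -/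

/-- The coordinates `(Re z, |z|²)`, in which geodesics are straight. -/
def klein (z : ℍ) : ℝ × ℝ := (z.re, Complex.normSq (z : ℂ))

theorem formEval_klein (q : ℝ × ℝ × ℝ) (z : ℍ) :
    formEval q z = q.1 * (klein z).2 + q.2.1 * (klein z).1 + q.2.2 := rfl

theorem klein_injective : Function.Injective klein := by
  intro z w h
  simp only [klein, Prod.mk.injEq] at h
  refine UpperHalfPlane.ext_re_im h.1 ?_
  have h2 := h.2
  rw [normSq_eq, normSq_eq, h.1] at h2
  nlinarith [z.im_pos, w.im_pos]

theorem continuous_klein : Continuous klein :=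
  UpperHalfPlane.continuous_re.prodMk
    (Complex.continuous_normSq.comp UpperHalfPlane.continuous_coe)

/-- The point of `ℍ` with coordinates `(x, w)` (for `x ^ 2 < w`). -/
def ofKlein (p : {p : ℝ × ℝ // p.1 ^ 2 < p.2}) : ℍ :=
  ⟨⟨p.1.1, √(p.1.2 - p.1.1 ^ 2)⟩, Real.sqrt_pos.2 (sub_pos.2 p.2)⟩

theorem klein_ofKlein (p : {p : ℝ × ℝ // p.1 ^ 2 < p.2}) : klein (ofKlein p) = p := by
  have h : (ofKlein p).re = p.1.1 := rfl
  have h' : (ofKlein p).im = √(p.1.2 - p.1.1 ^ 2) := rfl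
  refine Prod.ext h ?_
  change Complex.normSq (ofKlein p : ℂ) = _
  rw [normSq_eq, h, h', Real.sq_sqrt (sub_pos.2 p.2).le]; ring

theorem exists_klein {x w : ℝ} (h : x ^ 2 < w) : ∃ z : ℍ, klein z = (x, w) :=
  ⟨ofKlein ⟨(x, w), h⟩, klein_ofKlein _⟩

/-- The parabola model as a homeomorphism. -/
def kleinHomeo : ℍ ≃ₜ {p : ℝ × ℝ // p.1 ^ 2 < p.2} where
  toFun z := ⟨klein z, re_sq_lt_normSq z⟩
  invFun := ofKlein
  left_inv z := klein_injective (klein_ofKlein _)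
  right_inv p := Subtype.ext (klein_ofKlein p)
  continuous_toFun := continuous_klein.subtype_mk _
  continuous_invFun := by
    refine Continuous.upperHalfPlaneMk (f := fun p : {p : ℝ × ℝ // p.1 ^ 2 < p.2} =>
      (⟨p.1.1, √(p.1.2 - p.1.1 ^ 2)⟩ : ℂ)) ?_ _
    have : (fun p : {p : ℝ × ℝ // p.1 ^ 2 < p.2} => (⟨p.1.1, √(p.1.2 - p.1.1 ^ 2)⟩ : ℂ)) =
        fun p => (p.1.1 : ℂ) + (√(p.1.2 - p.1.1 ^ 2) : ℝ) * Complex.I := by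
      funext p; exact (Complex.mk_eq_add_mul_I _ _)
    rw [this]
    fun_prop

theorem isOpen_parabola : IsOpen {p : ℝ × ℝ | p.1 ^ 2 < p.2} :=
  isOpen_lt (by fun_prop) (by fun_prop)

theorem isOpenEmbedding_klein : Topology.IsOpenEmbedding klein :=
  isOpen_parabola.isOpenEmbedding_subtypeVal.comp kleinHomeo.isOpenEmbedding

theorem continuous_formEval (q : ℝ × ℝ × ℝ) : Continuous (formEval q) := by
  have : formEval q = fun z => q.1 * (klein z).2 + q.2.1 * (klein z).1 + q.2.2 := rfl
  rw [this]
  have := continuous_klein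
  fun_prop

/-- `v` divides the segment from `z` to `w` in the ratio `θ : 1 - θ`. -/
def IsMix (θ : ℝ) (z w v : ℍ) : Prop := klein v = (1 - θ) • klein z + θ • klein w

theorem exists_isMix {θ : ℝ} (h0 : 0 ≤ θ) (h1 : θ ≤ 1) (z w : ℍ) : ∃ v, IsMix θ z w v := by
  have hz := re_sq_lt_normSq z
  have hw := re_sq_lt_normSq w
  obtain ⟨v, hv⟩ := exists_klein (x := (1 - θ) * z.re + θ * w.re)
    (w := (1 - θ) * Complex.normSq (z : ℂ) + θ * Complex.normSq (w : ℂ)) (by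
      rcases h0.eq_or_lt with rfl | h0
      · simpa using hz
      · nlinarith [mul_nonneg (mul_nonneg h0.le (sub_nonneg.2 h1)) (sq_nonneg (z.re - w.re)),
          mul_pos h0 (sub_pos.2 hw), mul_nonneg (sub_nonneg.2 h1) (sub_pos.2 hz).le])
  exact ⟨v, by rw [IsMix, hv]; simp [klein]⟩

theorem IsMix.formEval {θ : ℝ} {z w v : ℍ} (h : IsMix θ z w v) (q : ℝ × ℝ × ℝ) :
    formEval q v = (1 - θ) * formEval q z + θ * formEval q w := by
  rw [formEval_klein, h, formEval_klein, formEval_klein]; simp; ring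

/-- Finite-sided convex regions of `ℍ`. -/
def IsFormPolygon (A : Set ℍ) : Prop :=
  ∃ S : Finset (ℝ × ℝ × ℝ), A = {z : ℍ | ∀ q ∈ S, 0 ≤ formEval q z}

theorem IsFormPolygon.isMix {A : Set ℍ} (hA : IsFormPolygon A) {θ : ℝ} (h0 : 0 ≤ θ) (h1 : θ ≤ 1) {z w v : ℍ}
    (h : IsMix θ z w v) (hz : z ∈ A) (hw : w ∈ A) : v ∈ A := by
  obtain ⟨S, rfl⟩ := hA
  intro q hq
  rw [h.formEval]
  exact add_nonneg (mul_nonneg (sub_nonneg.2 h1) (hz q hq)) (mul_nonneg h0 (hw q hq))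

theorem IsFormPolygon.isClosed {A : Set ℍ} (hA : IsFormPolygon A) : IsClosed A := by
  obtain ⟨S, rfl⟩ := hA
  simp only [Set.ofPred_forall]
  exact isClosed_biInter fun q _ => isClosed_le continuous_const (continuous_formEval q)

theorem IsFormPolygon.convex {A : Set ℍ} (hA : IsFormPolygon A) : Convex ℝ (klein '' A) := by
  rintro _ ⟨z, hz, rfl⟩ _ ⟨w, hw, rfl⟩ a b ha hb hab
  obtain ⟨v, hv⟩ := exists_isMix hb (by linarith) z w
  refine ⟨v, hA.isMix hb (by linarith) hv hz hw, ?_⟩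
  rw [hv, ← hab]; simp

theorem klein_image_interior (A : Set ℍ) : klein '' interior A = interior (klein '' A) := by
  apply subset_antisymm
  · exact isOpenEmbedding_klein.isOpenMap.image_interior_subset A
  · intro p hp
    obtain ⟨z, hz, rfl⟩ := interior_subset hp
    refine ⟨z, ?_, rfl⟩
    have : klein ⁻¹' (klein '' A) = A := Set.preimage_image_eq _ klein_injective
    rw [← this]
    exact preimage_interior_subset_interior_preimage continuous_klein hp

theorem IsFormPolygon.interior_isMix {A : Set ℍ} (hA : IsFormPolygon A) {θ : ℝ} (h0 : 0 < θ) (h1 : θ ≤ 1)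
    {z w v : ℍ} (h : IsMix θ z w v) (hz : z ∈ A) (hw : w ∈ interior A) : v ∈ interior A := by
  have : klein v ∈ interior (klein '' A) := by
    rw [h]
    refine hA.convex.combo_self_interior_mem_interior ⟨z, hz, rfl⟩ ?_ (sub_nonneg.2 h1) h0
      (by ring)
    rw [← klein_image_interior]; exact ⟨w, hw, rfl⟩
  rw [← klein_image_interior] at this
  obtain ⟨v', hv', e⟩ := this
  rwa [← klein_injective e]

theorem IsFormPolygon.interior_convex {A : Set ℍ} (hA : IsFormPolygon A) :
    Convex ℝ (klein '' interior A) := by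
  rw [klein_image_interior]; exact hA.convex.interior

theorem IsFormPolygon.subset_closure_interior {A : Set ℍ} (hA : IsFormPolygon A) (h : (interior A).Nonempty) :
    A ⊆ closure (interior A) := by
  intro z hz
  have h1 : klein z ∈ closure (interior (klein '' A)) := by
    rw [hA.convex.closure_interior_eq_closure_of_nonempty_interior]
    · exact subset_closure ⟨z, hz, rfl⟩
    · rw [← klein_image_interior]; exact h.image _
  rw [← klein_image_interior] at h1
  rwa [isOpenEmbedding_klein.isInducing.closure_eq_preimage_closure_image]

/-- In the parabola model the form is affine, and the hypothesis on its first two coefficients says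
that it is not constant. At an interior zero a short step against the gradient would make it
negative. -/
theorem formEval_pos_of_mem_interior {A : Set ℍ} {q : ℝ × ℝ × ℝ} (hq : (q.1, q.2.1) ≠ 0)
    (hA : ∀ z ∈ A, 0 ≤ formEval q z) {z : ℍ} (hz : z ∈ interior A) : 0 < formEval q z := by
  refine lt_of_le_of_ne (hA z (interior_subset hz)) fun h0 => ?_
  have hz' : klein z ∈ interior (klein '' A) := by
    rw [← klein_image_interior]; exact ⟨z, hz, rfl⟩
  have hc : Continuous fun e : ℝ => ((klein z).1 - e * q.2.1, (klein z).2 - e * q.1) := by fun_prop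
  have hev : ∀ᶠ e in nhds (0 : ℝ), ((klein z).1 - e * q.2.1, (klein z).2 - e * q.1) ∈
      interior (klein '' A) := by
    apply hc.continuousAt.eventually_mem
    simpa using isOpen_interior.mem_nhds hz'
  obtain ⟨e, he, hpos⟩ := ((hev.filter_mono nhdsWithin_le_nhds).and
    (self_mem_nhdsWithin (s := Set.Ioi (0 : ℝ)))).exists
  obtain ⟨w, hw, hwe⟩ := interior_subset he
  have h1 := hA w hw
  rw [formEval_klein] at h0 h1
  rw [hwe] at h1
  have h2 : 0 < q.1 ^ 2 + q.2.1 ^ 2 := by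
    by_contra hcon
    exact hq (Prod.ext (by simp; nlinarith [sq_nonneg q.1, sq_nonneg q.2.1])
      (by simp; nlinarith [sq_nonneg q.1, sq_nonneg q.2.1]))
  have hpos' : (0 : ℝ) < e := hpos
  simp only at h1
  nlinarith [mul_pos hpos' h2]

/-! ### The group action -/

theorem psl_mk_eq_mk_iff (g h : SL(2, ℝ)) :
    (QuotientGroup.mk g : PSL(2, ℝ)) = QuotientGroup.mk h ↔ h = g ∨ h = -g := by
  rw [QuotientGroup.eq, Matrix.SpecialLinearGroup.mem_center_iff]
  constructor
  · rintro ⟨r, hr, e⟩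
    simp only [Fintype.card_fin, sq_eq_one_iff] at hr
    have e' : (1 : SL(2, ℝ)) = g⁻¹ * h ∨ (-1 : SL(2, ℝ)) = g⁻¹ * h := by
      rcases hr with rfl | rfl
      · left; ext i j; rw [← e]; simp [Matrix.one_apply]
      · right; ext i j; rw [← e]
        fin_cases i <;> fin_cases j <;> simp
    rcases e' with e' | e'
    · left; rw [← mul_one g, e']; group
    · right
      have : h = g * (g⁻¹ * h) := by group
      rw [this, ← e', mul_neg, mul_one]
  · rintro (rfl | rfl)
    · exact ⟨1, by simp, by simp⟩
    · refine ⟨-1, by simp, ?_⟩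
      rw [mul_neg, inv_mul_cancel]
      ext i j
      fin_cases i <;> fin_cases j <;> simp

theorem psl_exists_mk (g : PSL(2, ℝ)) : ∃ a : SL(2, ℝ), (QuotientGroup.mk a : PSL(2, ℝ)) = g :=
  QuotientGroup.mk_surjective g

instance : ContinuousConstSMul PSL(2, ℝ) ℍ where
  continuous_const_smul g := by
    obtain ⟨a, rfl⟩ := psl_exists_mk g
    exact (continuous_const_smul a : Continuous fun z : ℍ => a • z)

theorem smul_interior (g : PSL(2, ℝ)) (A : Set ℍ) : interior (g • A) = g • interior A :=
  (interior_smul g A)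

theorem mem_mk_smul_iff (a : SL(2, ℝ)) (A : Set ℍ) (z : ℍ) :
    z ∈ (QuotientGroup.mk a : PSL(2, ℝ)) • A ↔ a⁻¹ • z ∈ A :=
  Set.mem_smul_set_iff_inv_smul_mem

theorem IsFormPolygon.smul {A : Set ℍ} (hA : IsFormPolygon A) (g : PSL(2, ℝ)) :
    IsFormPolygon (g • A) := by
  classical
  obtain ⟨S, rfl⟩ := hA
  obtain ⟨a, rfl⟩ := psl_exists_mk g
  refine ⟨S.image fun q => formAct q a⁻¹, ?_⟩
  ext z
  simp only [mem_mk_smul_iff, Finset.forall_mem_image, Set.mem_ofPred_eq, formEval_smul_nonneg]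

/-- A fixed point is a nonreal root of cz² + (d − a)z − b. The imaginary and real parts of this
equation give 2c Re z = a − d and c|z|² = −b, which determine z when c ≠ 0. If c = 0, they force a =
d and b = 0. -/
theorem psl_smul_eq_of_two_fixed {g : PSL(2, ℝ)} {z w : ℍ} (hz : g • z = z) (hw : g • w = w)
    (hzw : z ≠ w) : g = 1 := by
  obtain ⟨a, rfl⟩ := psl_exists_mk g
  have key : ∀ v : ℍ, (QuotientGroup.mk a : PSL(2, ℝ)) • v = v →
      2 * a 1 0 * v.re + a 1 1 - a 0 0 = 0 ∧
      a 1 0 * Complex.normSq (v : ℂ) + a 0 1 = 0 := by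
    intro v hv
    rw [psl_mk_smul] at hv
    have h1 := im_smul_mul a v
    have h2 := re_smul_mul a v
    rw [hv] at h1 h2
    have hj : autFactor a v = 1 := by
      have := v.im_pos.ne'
      field_simp at h1; exact h1
    have hd := sl_det a
    rw [hj] at h2
    have hc := sl_coe_smul a v
    rw [hv] at hc
    have hne : ((a 1 0 : ℂ) * v + a 1 1) ≠ 0 := by
      intro h0
      have := autFactor_eq a v
      rw [h0, hj] at this; simp at this
    rw [eq_div_iff hne] at hc
    have hr := congrArg Complex.re hc
    have hi := congrArg Complex.im hc
    simp only [Complex.add_re, Complex.mul_re, Complex.ofReal_re,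
      Complex.ofReal_im, Complex.add_im, Complex.mul_im, UpperHalfPlane.coe_re,
      UpperHalfPlane.coe_im] at hr hi
    have hi' : v.im * (2 * a 1 0 * v.re + a 1 1 - a 0 0) = 0 := by linear_combination hi
    have h3 : 2 * a 1 0 * v.re + a 1 1 - a 0 0 = 0 :=
      (mul_eq_zero.1 hi').resolve_left v.im_pos.ne'
    refine ⟨h3, ?_⟩
    rw [normSq_eq]
    linear_combination v.re * h3 - hr
  obtain ⟨z1, z2⟩ := key z hz
  obtain ⟨w1, w2⟩ := key w hw
  have hc : a 1 0 = 0 := by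
    by_contra hc
    refine hzw (klein_injective (Prod.ext ?_ ?_))
    · exact mul_left_cancel₀ (mul_ne_zero two_ne_zero hc) (by
        change 2 * a 1 0 * z.re = 2 * a 1 0 * w.re; linarith)
    · exact mul_left_cancel₀ hc (by
        change a 1 0 * Complex.normSq (z : ℂ) = a 1 0 * Complex.normSq (w : ℂ); linarith)
  simp only [hc, mul_zero, zero_mul, zero_add] at z1 z2
  have hd := sl_det a
  have e1 : a 1 1 = a 0 0 := by linarith
  rw [hc, e1] at hd
  change (QuotientGroup.mk a : PSL(2, ℝ)) = QuotientGroup.mk 1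
  rw [psl_mk_eq_mk_iff]
  have : a 0 0 = 1 ∨ a 0 0 = -1 := sq_eq_one_iff.1 (by linarith)
  rcases this with h | h
  · left
    ext i j; fin_cases i <;> fin_cases j <;> simp [h, hc, e1, z2]
  · right
    ext i j; fin_cases i <;> fin_cases j <;> simp [h, hc, e1, z2]

/-! ### Tessellations -/

section Tile

variable {Γ : Subgroup PSL(2, ℝ)} {P : Set ℍ}

/-- A tile is contained in the closure of its interior, so an open set meeting it already meets its
interior, and two different interiors are disjoint. -/
theorem tile_eq_of_interior (hT : IsFundamentalTile Γ P) (hP : IsFormPolygon P)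
    (hne : (interior P).Nonempty) {h h' : PSL(2, ℝ)} (hh : h ∈ Γ) (hh' : h' ∈ Γ) {z : ℍ}
    (hz : z ∈ interior (h • P)) (hz' : z ∈ h' • P) : h = h' := by
  by_contra hcon
  have h1 : z ∈ closure (interior (h' • P)) := (hP.smul h').subset_closure_interior (by
    rw [smul_interior]; exact hne.smul_set) hz'
  obtain ⟨w, hw, hw'⟩ := mem_closure_iff.1 h1 _ isOpen_interior hz
  have hd := hT.disjoint_interior (h⁻¹ * h') (Γ.mul_mem (Γ.inv_mem hh) hh') (by
    rwa [Ne, inv_mul_eq_one])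
  rw [smul_interior] at hw hw' hd
  refine Set.disjoint_left.1 hd (Set.mem_smul_set_iff_inv_smul_mem.1 hw) ?_
  rw [mul_smul]
  exact Set.smul_mem_smul_set hw'

theorem IsFundamentalTile.countable (hT : IsFundamentalTile Γ P) (hne : P.Nonempty) :
    Countable Γ := by
  rw [← Set.countable_univ_iff]
  exact hT.locallyFinite.countable_univ fun g => hne.smul_set

/-- By local finiteness the union of all the other tiles is closed. Its complement is a
neighbourhood of z contained in h • P, because the tiles cover. -/
theorem mem_interior_of_unique_tile (hT : IsFundamentalTile Γ P) (hP : IsFormPolygon P)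
    {h : PSL(2, ℝ)} {z : ℍ} (hu : ∀ h' ∈ Γ, z ∈ h' • P → h' = h) : z ∈ interior (h • P) := by
  have hc : IsClosed (⋃ i : {g : Γ // (g : PSL(2, ℝ)) ≠ h}, ((i : Γ) : PSL(2, ℝ)) • P) :=
    (hT.locallyFinite.comp_injective (g := fun i : {g : Γ // (g : PSL(2, ℝ)) ≠ h} => (i : Γ))
      Subtype.val_injective).isClosed_iUnion fun i => (hP.smul _).isClosed
  refine mem_interior.2 ⟨_, ?_, hc.isOpen_compl, ?_⟩
  · intro w hw
    obtain ⟨g, hg, hwg⟩ := hT.cover w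
    by_cases e : g = h
    · rwa [← e]
    · exact absurd (Set.mem_iUnion.2 ⟨⟨⟨g, hg⟩, e⟩, hwg⟩) hw
  · intro hz
    obtain ⟨⟨g, hg⟩, hzg⟩ := Set.mem_iUnion.1 hz
    exact hg (hu g g.2 hzg)

theorem exists_other_tile (hT : IsFundamentalTile Γ P) (hP : IsFormPolygon P)
    {h : PSL(2, ℝ)} {z : ℍ} (hz : z ∉ interior (h • P)) : ∃ h' ∈ Γ, h' ≠ h ∧ z ∈ h' • P := by
  by_contra! hcon
  exact hz (mem_interior_of_unique_tile hT hP fun h' hh' hz' => by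
    by_contra e; exact hcon h' hh' e hz')

theorem finite_tiles_at (hT : IsFundamentalTile Γ P) (z : ℍ) :
    {h : PSL(2, ℝ) | h ∈ Γ ∧ z ∈ h • P}.Finite := by
  have := (hT.locallyFinite.point_finite z).image (Subtype.val : Γ → PSL(2, ℝ))
  refine this.subset ?_
  rintro h ⟨hh, hz⟩
  exact ⟨⟨h, hh⟩, hz, rfl⟩

theorem finite_tiles_near (hT : IsFundamentalTile Γ P) (z : ℍ) :
    ∃ U ∈ nhds z, {h : PSL(2, ℝ) | h ∈ Γ ∧ (h • P ∩ U).Nonempty}.Finite := by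
  obtain ⟨U, hU, hf⟩ := hT.locallyFinite z
  refine ⟨U, hU, (hf.image (Subtype.val : Γ → PSL(2, ℝ))).subset ?_⟩
  rintro h ⟨hh, hz⟩
  exact ⟨⟨h, hh⟩, hz, rfl⟩

/-- The powers of g carry a tile through z to tiles through z. If they were all different, local
finiteness would fail at z. -/
theorem isOfFinOrder_of_fixed (hT : IsFundamentalTile Γ P) {g : PSL(2, ℝ)} (hg : g ∈ Γ) {z : ℍ}
    (hz : g • z = z) : IsOfFinOrder g := by
  obtain ⟨h, hh, hzh⟩ := hT.cover z
  by_contra hcon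
  have hinj : Function.Injective fun n : ℕ => g ^ n * h := fun m n e =>
    (injective_pow_iff_not_isOfFinOrder.2 hcon) (mul_right_cancel e)
  refine Set.infinite_range_of_injective hinj ((finite_tiles_at hT z).subset ?_)
  rintro _ ⟨n, rfl⟩
  refine ⟨Γ.mul_mem (Γ.pow_mem hg n) hh, ?_⟩
  have hn : g ^ n • z = z := by
    induction n with
    | zero => simp
    | succ n ih => rw [pow_succ, mul_smul, hz, ih]
  dsimp only
  rw [mul_smul, ← hn]
  exact Set.smul_mem_smul_set hzh

theorem inv_mem_neighborhoodSet {g : PSL(2, ℝ)} (hg : g ∈ neighborhoodSet Γ P) :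
    g⁻¹ ∈ neighborhoodSet Γ P := by
  obtain ⟨h1, h2, h3⟩ := hg
  refine ⟨Γ.inv_mem h1, inv_ne_one.2 h2, ?_⟩
  have : P ∩ g⁻¹ • P = g⁻¹ • (P ∩ g • P) := by
    rw [Set.smul_set_inter, inv_smul_smul, Set.inter_comm]
  rw [this]
  exact h3.image (MulAction.injective g⁻¹)

end Tile

/-! ### Separation -/

/-- At a zero the discriminant equals (b + 2a Re z)² + 4a²(Im z)². -/
theorem formDisc_pos_of_zero {q : ℝ × ℝ × ℝ} (hq : (q.1, q.2.1) ≠ 0) {z : ℍ}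
    (hz : formEval q z = 0) : 0 < formDisc q := by
  have h := re_sq_lt_normSq z
  unfold formEval at hz
  have e : formDisc q = (q.2.1 + 2 * q.1 * z.re) ^ 2 +
      4 * q.1 ^ 2 * (Complex.normSq (z : ℂ) - z.re ^ 2) := by
    unfold formDisc; linear_combination -4 * q.1 * hz
  rw [e]
  by_cases h1 : q.1 = 0
  · have h2 : q.2.1 ≠ 0 := fun h2 => hq (by simp [h1, h2])
    simp only [h1]; simp; positivity
  · have := sub_pos.2 h
    positivity

theorem fst_ne_zero_of_formDisc_pos {q : ℝ × ℝ × ℝ} (hq : 0 < formDisc q) :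
    (q.1, q.2.1) ≠ 0 := by
  intro h
  simp only [Prod.mk_eq_zero] at h
  simp [formDisc, h.1, h.2] at hq

/-- Hahn–Banach in the parabola model separates the two open convex interiors, and the closed
polygons follow by taking closures. A common point lies on the separating line, so the line meets ℍ
and is a geodesic. -/
theorem exists_separating_form {A B : Set ℍ} (hA : IsFormPolygon A) (hB : IsFormPolygon B)
    (hA' : (interior A).Nonempty) (hB' : (interior B).Nonempty)
    (hd : Disjoint (interior A) (interior B)) (hAB : (A ∩ B).Nonempty) :
    ∃ q, 0 < formDisc q ∧ (∀ z ∈ A, 0 ≤ formEval q z) ∧ ∀ z ∈ B, formEval q z ≤ 0 := by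
  have hopen : ∀ C : Set ℍ, IsOpen (klein '' interior C) := fun C =>
    isOpenEmbedding_klein.isOpenMap _ isOpen_interior
  obtain ⟨f, u, hf1, hf2⟩ := geometric_hahn_banach_open_open hB.interior_convex (hopen B)
    hA.interior_convex (hopen A)
    (Set.disjoint_image_iff klein_injective |>.2 hd.symm)
  let q : ℝ × ℝ × ℝ := (f (0, 1), f (1, 0), -u)
  have hfq : ∀ z, formEval q z = f (klein z) - u := by
    intro z
    have : klein z = (klein z).1 • ((1, 0) : ℝ × ℝ) + (klein z).2 • ((0, 1) : ℝ × ℝ) := by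
      ext <;> simp
    rw [formEval_klein, this, map_add, map_smul, map_smul]
    simp [q]; ring
  have hA1 : ∀ z ∈ A, 0 ≤ formEval q z := by
    have : A ⊆ {z | 0 ≤ formEval q z} := (hA.subset_closure_interior hA').trans <|
      closure_minimal (fun z hz => by
        have := hf2 _ ⟨z, hz, rfl⟩
        simp only [Set.mem_ofPred_eq, hfq]; linarith)
        (isClosed_le continuous_const (continuous_formEval q))
    exact this
  have hB1 : ∀ z ∈ B, formEval q z ≤ 0 := by
    have : B ⊆ {z | formEval q z ≤ 0} := (hB.subset_closure_interior hB').trans <|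
      closure_minimal (fun z hz => by
        have := hf1 _ ⟨z, hz, rfl⟩
        simp only [Set.mem_ofPred_eq, hfq]; linarith)
        (isClosed_le (continuous_formEval q) continuous_const)
    exact this
  obtain ⟨v, hvA, hvB⟩ := hAB
  refine ⟨q, formDisc_pos_of_zero ?_ (le_antisymm (hB1 v hvB) (hA1 v hvA)), hA1, hB1⟩
  -- With zero linear part the functional would take the same value everywhere, against the strict
  -- inequalities on the two interiors.
  intro h0
  obtain ⟨a, ha⟩ := hA'
  obtain ⟨b, hb⟩ := hB'
  have h1 := hf2 _ ⟨a, ha, rfl⟩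
  have h2 := hf1 _ ⟨b, hb, rfl⟩
  have e1 := hfq a
  have e2 := hfq b
  simp only [Prod.mk_eq_zero] at h0
  simp only [formEval, h0.1, h0.2] at e1 e2
  linarith

theorem exists_separating_form_tiles {Γ : Subgroup PSL(2, ℝ)} {P : Set ℍ}
    (hT : IsFundamentalTile Γ P) (hP : IsFormPolygon P) (hne : (interior P).Nonempty)
    {h h' : PSL(2, ℝ)} (hh : h ∈ Γ) (hh' : h' ∈ Γ) (hn : h ≠ h')
    (hi : (h • P ∩ h' • P).Nonempty) :
    ∃ q, 0 < formDisc q ∧ (∀ z ∈ h • P, 0 ≤ formEval q z) ∧ ∀ z ∈ h' • P, formEval q z ≤ 0 := by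
  refine exists_separating_form (hP.smul h) (hP.smul h') ?_ ?_ ?_ hi
  · rw [smul_interior]; exact hne.smul_set
  · rw [smul_interior]; exact hne.smul_set
  · exact Set.disjoint_left.2 fun z hz hz' =>
      hn (tile_eq_of_interior hT hP hne hh hh' hz (interior_subset hz'))

/-- Two affine functions vanishing at two distinct points have the line through them in common. -/
theorem forms_proportional {q r : ℝ × ℝ × ℝ} (hq : (q.1, q.2.1) ≠ 0) {z w : ℍ} (hzw : z ≠ w)
    (h1 : formEval q z = 0) (h2 : formEval q w = 0) (h3 : formEval r z = 0)
    (h4 : formEval r w = 0) : ∃ t : ℝ, r = t • q := by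
  have hk : klein z ≠ klein w := klein_injective.ne hzw
  rw [formEval_klein] at h1 h2 h3 h4
  set X := (klein z).1; set Y := (klein z).2; set X' := (klein w).1; set Y' := (klein w).2
  have hne : X ≠ X' ∨ Y ≠ Y' := by
    by_contra! h; exact hk (Prod.ext h.1 h.2)
  have e1 : q.1 * (Y - Y') + q.2.1 * (X - X') = 0 := by linear_combination h1 - h2
  have e2 : r.1 * (Y - Y') + r.2.1 * (X - X') = 0 := by linear_combination h3 - h4
  have e3 : r.1 * q.2.1 = r.2.1 * q.1 := by
    rcases hne with h | h
    · refine mul_left_cancel₀ (sub_ne_zero.2 h) ?_; linear_combination r.1 * e1 - q.1 * e2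
    · refine mul_left_cancel₀ (sub_ne_zero.2 h) ?_; linear_combination q.2.1 * e2 - r.2.1 * e1
  by_cases hq1 : q.1 = 0
  · have hq2 : q.2.1 ≠ 0 := fun h => hq (by simp [hq1, h])
    have hr1 : r.1 = 0 := by
      rw [hq1, mul_zero] at e3; exact (mul_eq_zero.1 e3).resolve_right hq2
    refine ⟨r.2.1 / q.2.1, Prod.ext ?_ (Prod.ext ?_ ?_)⟩
    · simp [hr1, hq1]
    · simp; field_simp
    · simp only [Prod.smul_snd, smul_eq_mul]
      simp only [hq1, hr1] at h1 h3
      field_simp; linear_combination q.2.1 * h3 - r.2.1 * h1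
  · refine ⟨r.1 / q.1, Prod.ext ?_ (Prod.ext ?_ ?_)⟩
    · simp; field_simp
    · simp only [Prod.smul_snd, Prod.smul_fst, smul_eq_mul]
      field_simp; linear_combination -e3
    · simp only [Prod.smul_snd, smul_eq_mul]
      field_simp; linear_combination q.1 * h3 - r.1 * h1 + X * e3

/-! ### Geodesics -/

theorem IsMix.formEval_pos {θ : ℝ} {z w v : ℍ} (h : IsMix θ z w v) (h0 : 0 < θ) (h1 : θ < 1)
    {q : ℝ × ℝ × ℝ} (hz : 0 < _root_.formEval q z) (hw : 0 < _root_.formEval q w) :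
    0 < _root_.formEval q v := by
  rw [h.formEval]
  exact add_pos (mul_pos (sub_pos.2 h1) hz) (mul_pos h0 hw)

/-- The group acts by projective maps of the parabola model, so segments go to segments. The ratio
changes by automorphy factors, and since the factor |cz + d|² is itself the value of a form, it is
affine along the segment. -/
theorem IsMix.smul {θ : ℝ} {z w v : ℍ} (h : IsMix θ z w v) (h0 : 0 < θ) (h1 : θ < 1)
    (g : PSL(2, ℝ)) : ∃ θ', 0 < θ' ∧ θ' < 1 ∧ IsMix θ' (g • z) (g • w) (g • v) := by
  obtain ⟨a, rfl⟩ := psl_exists_mk g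
  simp only [psl_mk_smul]
  have hz := autFactor_pos a z
  have hw := autFactor_pos a w
  have hv := autFactor_pos a v
  have haut : ∀ x, autFactor a x =
      _root_.formEval (a 1 0 ^ 2, 2 * a 1 0 * a 1 1, a 1 1 ^ 2) x := fun x => rfl
  have hsum : autFactor a v = (1 - θ) * autFactor a z + θ * autFactor a w := by
    rw [haut, haut, haut, h.formEval]
  have key : ∀ q, _root_.formEval q (a • v) = (1 - θ * autFactor a w / autFactor a v) *
      _root_.formEval q (a • z) + θ * autFactor a w / autFactor a v *
      _root_.formEval q (a • w) := by
    intro q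
    have e := h.formEval (formAct q a)
    rw [← formEval_smul_mul, ← formEval_smul_mul, ← formEval_smul_mul] at e
    field_simp
    rw [e]
    linear_combination (-(_root_.formEval q (a • z))) * hsum
  refine ⟨θ * autFactor a w / autFactor a v, by positivity, ?_, ?_⟩
  · rw [div_lt_one hv, hsum]
    nlinarith [mul_pos (sub_pos.2 h1) hz]
  · refine Prod.ext ?_ ?_
    · simpa [_root_.formEval, klein] using key (0, 1, 0)
    · simpa [_root_.formEval, klein] using key (1, 0, 0)

/-- A path running monotonically along a geodesic line. -/
structure IsLine (γ : ℝ → ℍ) : Prop where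
  cont : Continuous γ
  mix : ∀ {s r t : ℝ}, s < r → r < t → ∃ θ, 0 < θ ∧ θ < 1 ∧ IsMix θ (γ s) (γ t) (γ r)

theorem IsLine.smul {γ : ℝ → ℍ} (hγ : IsLine γ) (g : PSL(2, ℝ)) : IsLine fun t => g • γ t where
  cont := hγ.cont.const_smul g
  mix hs ht := by
    obtain ⟨θ, h0, h1, h⟩ := hγ.mix hs ht
    exact h.smul h0 h1 g

theorem isLine_geodesic (u : PSL(2, ℝ)) : IsLine (geodesic u) := by
  refine IsLine.smul (γ := fun t => (⟨⟨0, Real.exp t⟩, Real.exp_pos t⟩ : ℍ)) ⟨?_, ?_⟩ u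
  · refine Continuous.upperHalfPlaneMk (f := fun t : ℝ => (⟨0, Real.exp t⟩ : ℂ)) ?_ _
    have : (fun t : ℝ => (⟨0, Real.exp t⟩ : ℂ)) = fun t => (Real.exp t : ℝ) * Complex.I := by
      funext t; rw [Complex.mk_eq_add_mul_I]; simp
    rw [this]
    fun_prop
  · intro s r t hsr hrt
    have h1 := Real.exp_lt_exp.2 hsr
    have h2 := Real.exp_lt_exp.2 hrt
    have h0 := Real.exp_pos s
    have hst : 0 < Real.exp t ^ 2 - Real.exp s ^ 2 := by nlinarith
    refine ⟨(Real.exp r ^ 2 - Real.exp s ^ 2) / (Real.exp t ^ 2 - Real.exp s ^ 2), ?_, ?_, ?_⟩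
    · exact div_pos (by nlinarith) hst
    · rw [div_lt_one hst]; nlinarith
    · have hk : ∀ x : ℝ, klein ⟨⟨0, Real.exp x⟩, Real.exp_pos x⟩ = (0, Real.exp x ^ 2) := by
        intro x
        refine Prod.ext rfl ?_
        change Complex.normSq (⟨0, Real.exp x⟩ : ℂ) = _
        rw [Complex.normSq_mk]; ring
      rw [IsMix, hk, hk, hk]
      refine Prod.ext (by simp) ?_
      simp only [Prod.smul_mk, smul_eq_mul, Prod.mk_add_mk]
      field_simp
      ring

theorem IsLine.mem_interior_of_between {γ : ℝ → ℍ} (hγ : IsLine γ) {A : Set ℍ}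
    (hA : IsFormPolygon A) {s r t : ℝ} (hs : γ s ∈ A) (ht : γ t ∈ interior A) (hsr : s < r)
    (hrt : r < t) : γ r ∈ interior A := by
  obtain ⟨θ, h0, h1, h⟩ := hγ.mix hsr hrt
  exact hA.interior_isMix h0 h1.le h hs ht

/-! ### Itineraries -/

/-- The path `γ` runs in order through the tiles `h i • P`, entering `h i • P` at time `t i`. -/
structure IsItinerary (Γ : Subgroup PSL(2, ℝ)) (P : Set ℍ) (γ : ℝ → ℍ) (h : ℤ → PSL(2, ℝ))
    (t : ℤ → ℝ) : Prop where
  mem : ∀ i, h i ∈ Γ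
  step : ∀ i, (h i)⁻¹ * h (i + 1) ∈ neighborhoodSet Γ P
  mono : StrictMono t
  top : Filter.Tendsto t Filter.atTop Filter.atTop
  bot : Filter.Tendsto t Filter.atBot Filter.atBot
  int : ∀ i, ∀ s ∈ Set.Ioo (t i) (t (i + 1)), γ s ∈ interior (h i • P)

/-! ### Existence of itineraries. -/

section Existence

variable {Γ : Subgroup PSL(2, ℝ)} {P : Set ℍ} {γ : ℝ → ℍ}

/-- The times at which `γ` lies in two tiles. -/
def crossingTimes (Γ : Subgroup PSL(2, ℝ)) (P : Set ℍ) (γ : ℝ → ℍ) : Set ℝ :=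
  {t | ∃ h ∈ Γ, ∃ h' ∈ Γ, h ≠ h' ∧ γ t ∈ h • P ∧ γ t ∈ h' • P}

/-- Away from crossing times, lying in a given tile is the same as lying in its interior. The
condition is therefore both open and closed, and connectedness decides. -/
theorem exists_tile_of_disjoint_crossingTimes (hT : IsFundamentalTile Γ P) (hP : IsFormPolygon P)
    (hγ : Continuous γ) {I : Set ℝ} (hI : IsPreconnected I) (hne : I.Nonempty)
    (hd : ∀ t ∈ I, t ∉ crossingTimes Γ P γ) :
    ∃ h ∈ Γ, ∀ t ∈ I, γ t ∈ interior (h • P) := by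
  obtain ⟨t₀, ht₀⟩ := hne
  obtain ⟨h, hh, hz⟩ := hT.cover (γ t₀)
  have key : ∀ t ∈ I, γ t ∈ h • P → γ t ∈ interior (h • P) := fun t ht hth =>
    mem_interior_of_unique_tile hT hP fun h' hh' hz' => by
      by_contra e
      exact hd t ht ⟨h', hh', h, hh, e, hz', hth⟩
  refine ⟨h, hh, ?_⟩
  refine hI.subset_left_of_subset_union (isOpen_interior.preimage hγ)
    (((hP.smul h).isClosed.isOpen_compl).preimage hγ) ?_ ?_ ⟨t₀, ht₀, key t₀ ht₀ hz⟩
  · exact Set.disjoint_left.2 fun t h1 h2 => h2 (interior_subset h1)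
  · intro t ht
    by_cases e : γ t ∈ h • P
    · exact Or.inl (key t ht e)
    · exact Or.inr e

/-- A compact piece of the path meets finitely many tiles, and each pair of distinct tiles
contributes at most one crossing time. -/
theorem finite_crossingTimes (hT : IsFundamentalTile Γ P) (hγ : Continuous γ)
    (hsub : ∀ h ∈ Γ, ∀ h' ∈ Γ, h ≠ h' → {t | γ t ∈ h • P ∧ γ t ∈ h' • P}.Subsingleton)
    (a b : ℝ) : (crossingTimes Γ P γ ∩ Set.Icc a b).Finite := by
  have hfin := hT.locallyFinite.finite_nonempty_inter_compact
    ((isCompact_Icc (a := a) (b := b)).image hγ)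
  have : crossingTimes Γ P γ ∩ Set.Icc a b ⊆
      ⋃ p ∈ ({g : Γ | ((g : PSL(2, ℝ)) • P ∩ γ '' Set.Icc a b).Nonempty} ×ˢ
        {g : Γ | ((g : PSL(2, ℝ)) • P ∩ γ '' Set.Icc a b).Nonempty}),
        {t | p.1 ≠ p.2 ∧ γ t ∈ (p.1 : PSL(2, ℝ)) • P ∧ γ t ∈ (p.2 : PSL(2, ℝ)) • P} := by
    rintro t ⟨⟨h, hh, h', hh', hn, h1, h2⟩, ht⟩
    simp only [Set.mem_iUnion]
    exact ⟨(⟨h, hh⟩, ⟨h', hh'⟩), ⟨⟨_, h1, t, ht, rfl⟩, ⟨_, h2, t, ht, rfl⟩⟩,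
      fun e => hn (congrArg Subtype.val e), h1, h2⟩
  refine Set.Finite.subset (Set.Finite.biUnion (hfin.prod hfin) ?_) this
  rintro ⟨⟨h, hh⟩, ⟨h', hh'⟩⟩ -
  by_cases e : h = h'
  · subst e; simp
  · exact (Set.Subsingleton.anti (hsub h hh h' hh' e) fun t ht => ht.2).finite

/-- A locally finite set of reals, unbounded in both directions, has the order type of ℤ. The
numbering is shifted so that the gap containing r has index 0. -/
theorem exists_int_parametrization {D : Set ℝ} (hfin : ∀ a b, (D ∩ Set.Icc a b).Finite)
    (htop : ∀ M, ∃ t ∈ D, M < t) (hbot : ∀ M, ∃ t ∈ D, t < M) {r : ℝ} (hr : r ∉ D) :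
    ∃ t : ℤ → ℝ, StrictMono t ∧ Set.range t = D ∧ r ∈ Set.Ioo (t 0) (t 1) := by
  classical
  let _ : LocallyFiniteOrder D := LocallyFiniteOrder.ofFiniteIcc fun a b => by
    refine Set.Finite.of_finite_image ((hfin a b).subset ?_) Subtype.val_injective.injOn
    rintro _ ⟨x, hx, rfl⟩
    exact ⟨x.2, hx.1, hx.2⟩
  let _ : SuccOrder D := LinearLocallyFiniteOrder.succOrder D
  let _ : PredOrder D := LinearLocallyFiniteOrder.predOrder D
  have : NoMaxOrder D := ⟨fun a => by
    obtain ⟨t, ht, h⟩ := htop a; exact ⟨⟨t, ht⟩, h⟩⟩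
  have : NoMinOrder D := ⟨fun a => by
    obtain ⟨t, ht, h⟩ := hbot a; exact ⟨⟨t, ht⟩, h⟩⟩
  have : Nonempty D := by
    obtain ⟨t, ht, -⟩ := htop 0; exact ⟨⟨t, ht⟩⟩
  let f : D ≃o ℤ := orderIsoIntOfLinearSuccPredArch
  have hmono : StrictMono fun i : ℤ => (f.symm i : ℝ) := fun i j hij =>
    (f.symm.strictMono hij : f.symm i < f.symm j)
  obtain ⟨b, hb, hrb⟩ := htop r
  obtain ⟨a, ha, har⟩ := hbot r
  obtain ⟨i₀, hi₀, hmax⟩ := Int.exists_greatest_of_bdd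
    (P := fun i => (f.symm i : ℝ) < r) ⟨f ⟨b, hb⟩, fun i hi => by
      by_contra hcon
      have := hmono (not_le.1 hcon)
      simp only [OrderIso.symm_apply_apply] at this
      linarith⟩ ⟨f ⟨a, ha⟩, by simpa using har⟩
  refine ⟨fun i => f.symm (i₀ + i), fun i j hij => hmono (by omega), ?_, ?_, ?_⟩
  · ext x
    constructor
    · rintro ⟨i, rfl⟩; exact (f.symm _).2
    · intro hx
      exact ⟨f ⟨x, hx⟩ - i₀, by simp⟩
  · simpa using hi₀
  · refine lt_of_le_of_ne ?_ fun e => hr (e ▸ (f.symm _).2)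
    by_contra hcon
    have := hmax (i₀ + 1) (not_le.1 hcon)
    omega

/-- The crossing times cut the line into intervals, each inside one tile. The hypotheses `htop` and
`hbot` prevent the line from ending up in a single tile, and `hnt` says that every crossing takes
place across a side and not at an isolated contact point. -/
theorem exists_itinerary (hT : IsFundamentalTile Γ P) (hP : IsFormPolygon P)
    (hne : (interior P).Nonempty) (hγ : IsLine γ)
    (hsub : ∀ h ∈ Γ, ∀ h' ∈ Γ, h ≠ h' → {t | γ t ∈ h • P ∧ γ t ∈ h' • P}.Subsingleton)
    (hnt : ∀ h ∈ Γ, ∀ h' ∈ Γ, h ≠ h' → ∀ t, γ t ∈ h • P → γ t ∈ h' • P →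
      (h • P ∩ h' • P).Nontrivial)
    (htop : ∀ h ∈ Γ, ∀ M, ∃ t, M < t ∧ γ t ∉ h • P)
    (hbot : ∀ h ∈ Γ, ∀ M, ∃ t, t < M ∧ γ t ∉ h • P)
    {r : ℝ} (hr : γ r ∈ interior P) :
    ∃ h t, h 0 = 1 ∧ IsItinerary Γ P γ h t := by
  have hc := hγ.cont
  have hr' : γ r ∈ interior ((1 : PSL(2, ℝ)) • P) := by rwa [one_smul]
  have hDr : r ∉ crossingTimes Γ P γ := by
    rintro ⟨h, hh, h', hh', hn, h1, h2⟩
    exact hn ((tile_eq_of_interior hT hP hne Γ.one_mem hh hr' h1).symm.trans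
      (tile_eq_of_interior hT hP hne Γ.one_mem hh' hr' h2))
  have hDtop : ∀ M, ∃ t ∈ crossingTimes Γ P γ, M < t := by
    intro M
    by_contra! hcon
    obtain ⟨h, hh, hI⟩ := exists_tile_of_disjoint_crossingTimes hT hP hc
      (isPreconnected_Ioi (a := M)) Set.nonempty_Ioi
      fun t ht hD => absurd (hcon t hD) (not_le.2 ht)
    obtain ⟨t, ht, htn⟩ := htop h hh M
    exact htn (interior_subset (hI t ht))
  have hDbot : ∀ M, ∃ t ∈ crossingTimes Γ P γ, t < M := by
    intro M
    by_contra! hcon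
    obtain ⟨h, hh, hI⟩ := exists_tile_of_disjoint_crossingTimes hT hP hc
      (isPreconnected_Iio (a := M)) Set.nonempty_Iio
      fun t ht hD => absurd (hcon t hD) (not_le.2 ht)
    obtain ⟨t, ht, htn⟩ := hbot h hh M
    exact htn (interior_subset (hI t ht))
  obtain ⟨t, hmono, hrange, hrt⟩ := exists_int_parametrization
    (finite_crossingTimes hT hc hsub) hDtop hDbot hDr
  have hlt : ∀ i, t i < t (i + 1) := fun i => hmono (by omega)
  have hgap : ∀ i, ∀ s ∈ Set.Ioo (t i) (t (i + 1)), s ∉ crossingTimes Γ P γ := by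
    intro i s hs hD
    rw [← hrange] at hD
    obtain ⟨j, rfl⟩ := hD
    have h1 := hmono.lt_iff_lt.1 hs.1
    have h2 := hmono.lt_iff_lt.1 hs.2
    omega
  choose h hmem hint using fun i => exists_tile_of_disjoint_crossingTimes hT hP hc
    (isPreconnected_Ioo (a := t i) (b := t (i + 1))) (Set.nonempty_Ioo.2 (hlt i)) (hgap i)
  refine ⟨h, t, ?_, hmem, ?_, hmono, ?_, ?_, hint⟩
  · exact (tile_eq_of_interior hT hP hne Γ.one_mem (hmem 0) hr'
      (interior_subset (hint 0 r (by simpa using hrt)))).symm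
  · intro i
    have hD : t (i + 1) ∈ crossingTimes Γ P γ := by rw [← hrange]; exact ⟨_, rfl⟩
    have hm1 : γ (t (i + 1)) ∈ h i • P := by
      have : t (i + 1) ∈ closure (Set.Ioo (t i) (t (i + 1))) := by
        rw [closure_Ioo (hlt i).ne]; exact ⟨(hlt i).le, le_rfl⟩
      exact closure_minimal (fun s hs => show γ s ∈ h i • P from interior_subset (hint i s hs))
        ((hP.smul (h i)).isClosed.preimage hc) this
    have hm2 : γ (t (i + 1)) ∈ h (i + 1) • P := by
      have : t (i + 1) ∈ closure (Set.Ioo (t (i + 1)) (t (i + 1 + 1))) := by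
        rw [closure_Ioo (hlt _).ne]; exact ⟨le_rfl, (hlt _).le⟩
      exact closure_minimal (fun s hs => show γ s ∈ h (i + 1) • P from interior_subset (hint (i + 1) s hs))
        ((hP.smul _).isClosed.preimage hc) this
    -- If both sides of the crossing were in the same tile, convexity would put the crossing point
    -- in its interior, where no second tile is present.
    have hn : h i ≠ h (i + 1) := by
      intro e
      obtain ⟨s, hs⟩ := Set.nonempty_Ioo.2 (hlt i)
      obtain ⟨s', hs'⟩ := Set.nonempty_Ioo.2 (hlt (i + 1))
      have h1 : γ s ∈ interior (h i • P) := hint i s hs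
      have h2 : γ s' ∈ interior (h i • P) := by rw [e]; exact hint _ s' hs'
      have h3 := hγ.mem_interior_of_between (hP.smul (h i)) (interior_subset h1) h2 hs.2 hs'.1
      obtain ⟨k, hk, k', hk', hkn, hk1, hk2⟩ := hD
      exact hkn ((tile_eq_of_interior hT hP hne (hmem i) hk h3 hk1).symm.trans
        (tile_eq_of_interior hT hP hne (hmem i) hk' h3 hk2))
    refine ⟨Γ.mul_mem (Γ.inv_mem (hmem i)) (hmem _), by rwa [Ne, inv_mul_eq_one], ?_⟩
    have := (hnt _ (hmem i) _ (hmem (i + 1)) hn _ hm1 hm2).image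
      (MulAction.injective (h i)⁻¹)
    have e : (fun z : ℍ => (h i)⁻¹ • z) '' (h i • P ∩ h (i + 1) • P) =
        P ∩ ((h i)⁻¹ * h (i + 1)) • P := by
      rw [Set.image_smul, Set.smul_set_inter, inv_smul_smul, mul_smul]
    rwa [← e]
  · refine Filter.tendsto_atTop_atTop_of_monotone hmono.monotone fun b => ?_
    obtain ⟨s, hs, hbs⟩ := hDtop b
    rw [← hrange] at hs
    obtain ⟨i, rfl⟩ := hs
    exact ⟨i, hbs.le⟩
  · refine Filter.tendsto_atBot_atBot_of_monotone hmono.monotone fun b => ?_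
    obtain ⟨s, hs, hbs⟩ := hDbot b
    rw [← hrange] at hs
    obtain ⟨i, rfl⟩ := hs
    exact ⟨i, hbs.le⟩

end Existence

/-! ### Consequences of convexity for itineraries. -/

section Itinerary

variable {Γ : Subgroup PSL(2, ℝ)} {P : Set ℍ} {γ : ℝ → ℍ} {h : ℤ → PSL(2, ℝ)} {t : ℤ → ℝ}

theorem IsItinerary.lt (hI : IsItinerary Γ P γ h t) (i : ℤ) : t i < t (i + 1) :=
  hI.mono (by omega)

theorem IsItinerary.ne (hI : IsItinerary Γ P γ h t) (i : ℤ) : h i ≠ h (i + 1) := by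
  have := (hI.step i).2.1
  rwa [Ne, inv_mul_eq_one] at this

theorem IsItinerary.mem_left (hI : IsItinerary Γ P γ h t) (hP : IsFormPolygon P)
    (hγ : IsLine γ) (i : ℤ) : γ (t i) ∈ h i • P := by
  have : t i ∈ closure (Set.Ioo (t i) (t (i + 1))) := by
    rw [closure_Ioo (hI.lt i).ne]; exact ⟨le_rfl, (hI.lt i).le⟩
  exact closure_minimal (fun s hs => show γ s ∈ h i • P from interior_subset (hI.int i s hs))
    ((hP.smul (h i)).isClosed.preimage hγ.cont) this

theorem IsItinerary.mem_right (hI : IsItinerary Γ P γ h t) (hP : IsFormPolygon P)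
    (hγ : IsLine γ) (i : ℤ) : γ (t (i + 1)) ∈ h i • P := by
  have : t (i + 1) ∈ closure (Set.Ioo (t i) (t (i + 1))) := by
    rw [closure_Ioo (hI.lt i).ne]; exact ⟨(hI.lt i).le, le_rfl⟩
  exact closure_minimal (fun s hs => show γ s ∈ h i • P from interior_subset (hI.int i s hs))
    ((hP.smul (h i)).isClosed.preimage hγ.cont) this

/-- A line that leaves a convex tile cannot come back. If two indices gave the same tile, the whole
time between them would be spent in its interior, including the interval right after the first
index. -/
theorem IsItinerary.injective (hI : IsItinerary Γ P γ h t) (hT : IsFundamentalTile Γ P)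
    (hP : IsFormPolygon P) (hne : (interior P).Nonempty) (hγ : IsLine γ) :
    Function.Injective h := by
  have key : ∀ i j, i < j → h i ≠ h j := by
    intro i j hij e
    obtain ⟨s, hs⟩ := Set.nonempty_Ioo.2 (hI.lt i)
    have hs1 := hI.int i s hs
    rcases (show i + 1 ≤ j by omega).eq_or_lt with h1 | h1
    · exact hI.ne i (h1 ▸ e)
    · obtain ⟨r, hr⟩ := Set.nonempty_Ioo.2 (hI.lt (i + 1))
      have hr1 := hI.int _ r hr
      obtain ⟨s', hs'⟩ := Set.nonempty_Ioo.2 (hI.lt j)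
      have hs2 := hI.int _ s' hs'
      rw [← e] at hs2
      have h2 : t (i + 1 + 1) ≤ t j := hI.mono.monotone (by omega)
      have h3 := hγ.mem_interior_of_between (hP.smul (h i)) (interior_subset hs1) hs2
        (hs.2.trans hr.1) ((hr.2.trans_le h2).trans hs'.1)
      exact hI.ne i (tile_eq_of_interior hT hP hne (hI.mem i) (hI.mem _) h3
        (interior_subset hr1))
  intro i j e
  rcases lt_trichotomy i j with h1 | h1 | h1
  · exact absurd e (key i j h1)
  · exact h1
  · exact absurd e.symm (key j i h1)

theorem IsItinerary.exists_index (hI : IsItinerary Γ P γ h t) (hT : IsFundamentalTile Γ P)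
    (hP : IsFormPolygon P) (hne : (interior P).Nonempty) (hγ : IsLine γ) {k : PSL(2, ℝ)}
    (hk : k ∈ Γ) {r : ℝ} (hr : γ r ∈ interior (k • P)) :
    ∃ i, h i = k ∧ r ∈ Set.Ioo (t i) (t (i + 1)) := by
  obtain ⟨b, hb⟩ := (hI.top.eventually (Filter.eventually_gt_atTop r)).exists
  obtain ⟨a, ha⟩ := (hI.bot.eventually (Filter.eventually_lt_atBot r)).exists
  obtain ⟨i, hi, hmax⟩ := Int.exists_greatest_of_bdd (P := fun i => t i ≤ r)
    ⟨b, fun j hj => by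
      by_contra hcon
      have := hI.mono (not_le.1 hcon)
      linarith⟩ ⟨a, ha.le⟩
  have h2 : r < t (i + 1) := by
    by_contra hcon
    have := hmax _ (not_lt.1 hcon)
    omega
  -- A crossing time belongs to two different tiles, hence to the interior of neither.
  have h1 : t i < r := by
    refine lt_of_le_of_ne hi fun e => ?_
    rw [← e] at hr
    have e1 := tile_eq_of_interior hT hP hne hk (hI.mem i) hr (hI.mem_left hP hγ i)
    have h3 := hI.mem_right hP hγ (i - 1)
    rw [sub_add_cancel] at h3
    have e2 := tile_eq_of_interior hT hP hne hk (hI.mem _) hr h3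
    have h4 := hI.ne (i - 1)
    rw [sub_add_cancel] at h4
    exact h4 (e2.symm.trans e1)
  exact ⟨i, (tile_eq_of_interior hT hP hne hk (hI.mem i) hr
    (interior_subset (hI.int i r ⟨h1, h2⟩))).symm, h1, h2⟩

/-- If, between a time in the `i`-th tile and a later time outside of it, the itinerary stays
away from all sides of the `i`-th tile except one, then it leaves the tile through that side. -/
theorem IsItinerary.next (hI : IsItinerary Γ P γ h t) (hP : IsFormPolygon P) (hγ : IsLine γ)
    {i : ℤ} {r r' : ℝ} (hr : r ∈ Set.Ioo (t i) (t (i + 1))) (hrr : r < r')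
    (hout : γ r' ∉ h i • P) {x : PSL(2, ℝ)}
    (hx : ∀ y ∈ neighborhoodSet Γ P, y ≠ x → ∃ q, (∀ z ∈ P ∩ y • P, formEval q z = 0) ∧
      0 < formEval q ((h i)⁻¹ • γ r) ∧ 0 < formEval q ((h i)⁻¹ • γ r')) :
    h (i + 1) = h i * x := by
  have h1 : t (i + 1) < r' := by
    by_contra hcon
    rcases (not_lt.1 hcon).eq_or_lt with e | e
    · exact hout (e ▸ hI.mem_right hP hγ i)
    · exact hout (interior_subset (hI.int i r' ⟨hr.1.trans hrr, e⟩))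
  by_contra hcon
  obtain ⟨q, hq0, hq1, hq2⟩ := hx _ (hI.step i) fun e => hcon (by rw [← e]; group)
  obtain ⟨θ, h0, h1', hm⟩ := (hγ.smul (h i)⁻¹).mix hr.2 h1
  refine (hm.formEval_pos h0 h1' hq1 hq2).ne' (hq0 _ ⟨?_, ?_⟩)
  · exact Set.mem_smul_set_iff_inv_smul_mem.1 (hI.mem_right hP hγ i)
  · rw [mul_smul]
    exact Set.smul_mem_smul_set (hI.mem_left hP hγ (i + 1))

/-- The mirror image of `IsItinerary.next`: the side through which a tile is entered. -/
theorem IsItinerary.prev (hI : IsItinerary Γ P γ h t) (hP : IsFormPolygon P) (hγ : IsLine γ)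
    {i : ℤ} {r r' : ℝ} (hr : r ∈ Set.Ioo (t i) (t (i + 1))) (hrr : r' < r)
    (hout : γ r' ∉ h i • P) {x : PSL(2, ℝ)}
    (hx : ∀ y ∈ neighborhoodSet Γ P, y ≠ x → ∃ q, (∀ z ∈ P ∩ y • P, formEval q z = 0) ∧
      0 < formEval q ((h i)⁻¹ • γ r) ∧ 0 < formEval q ((h i)⁻¹ • γ r')) :
    h (i - 1) = h i * x := by
  have hst := hI.step (i - 1)
  have hmr := hI.mem_right hP hγ (i - 1)
  rw [sub_add_cancel] at hst hmr
  have h1 : r' < t i := by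
    by_contra hcon
    rcases (not_lt.1 hcon).eq_or_lt with e | e
    · exact hout (e ▸ hI.mem_left hP hγ i)
    · exact hout (interior_subset (hI.int i r' ⟨e, hrr.trans hr.2⟩))
  by_contra hcon
  obtain ⟨q, hq0, hq1, hq2⟩ := hx _ (inv_mem_neighborhoodSet hst) fun e => hcon (by
    rw [← e]; group)
  obtain ⟨θ, h0, h1', hm⟩ := (hγ.smul (h i)⁻¹).mix h1 hr.1
  refine (hm.formEval_pos h0 h1' hq2 hq1).ne' (hq0 _ ⟨?_, ?_⟩)
  · exact Set.mem_smul_set_iff_inv_smul_mem.1 (hI.mem_left hP hγ i)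
  · rw [mul_inv_rev, inv_inv, mul_smul]
    exact Set.smul_mem_smul_set hmr

end Itinerary

/-! ### Points at infinity -/

theorem isOpenEmbedding_toSphere : Topology.IsOpenEmbedding toSphere :=
  OnePoint.isOpenEmbedding_coe.comp UpperHalfPlane.isOpenEmbedding_coe

/-- The boundary vector `(x, 1)` of a point `x` of the real line, and `(1, 0)` of `∞`. -/
def bdryVec (ζ : OnePoint ℂ) : ℝ × ℝ := ζ.elim (1, 0) fun w => (w.re, 1)

theorem bdryVec_ne_zero (ζ : OnePoint ℂ) : bdryVec ζ ≠ 0 := by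
  induction ζ using OnePoint.rec with
  | infty => simp [bdryVec]
  | coe w => simp [bdryVec]

theorem exists_real_of_mem_idealPoints {X : Set ℍ} {ζ : OnePoint ℂ} (hζ : ζ ∈ idealPoints X) :
    ζ = OnePoint.infty ∨ ∃ x : ℝ, ζ = ((x : ℂ) : OnePoint ℂ) := by
  obtain ⟨h1, h2⟩ := hζ
  induction ζ using OnePoint.rec with
  | infty => exact Or.inl rfl
  | coe w =>
    right
    have h3 : w ∈ closure ((UpperHalfPlane.coe : ℍ → ℂ) '' X) := by
      rw [OnePoint.isOpenEmbedding_coe.isInducing.closure_eq_preimage_closure_image,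
        Set.image_image]
      exact h1
    have h4 : 0 ≤ w.im := by
      refine closure_minimal (t := {w : ℂ | 0 ≤ w.im}) ?_
        (isClosed_le continuous_const Complex.continuous_im) h3
      rintro _ ⟨z, -, rfl⟩
      exact z.im_pos.le
    have h5 : w.im = 0 := by
      by_contra h0
      exact h2 ⟨⟨w, lt_of_le_of_ne h4 (Ne.symm h0)⟩, rfl⟩
    exact ⟨w.re, by rw [← Complex.re_add_im w, h5]; simp⟩

/-- At a real point the inequality passes to the closure. At ∞ the boundary value is the leading
coefficient, and if that were negative the inequality would bound |z| on X and keep X away from ∞.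
-/
theorem formBdry_nonneg_of_mem_idealPoints {X : Set ℍ} {ζ : OnePoint ℂ} (hζ : ζ ∈ idealPoints X)
    {q : ℝ × ℝ × ℝ} (hq : ∀ z ∈ X, 0 ≤ formEval q z) :
    0 ≤ formBdry q (bdryVec ζ).1 (bdryVec ζ).2 := by
  rcases exists_real_of_mem_idealPoints hζ with rfl | ⟨x, rfl⟩
  · have e : formBdry q (bdryVec OnePoint.infty).1 (bdryVec OnePoint.infty).2 = q.1 := by
      simp [formBdry, bdryVec]
    rw [e]
    by_contra! hneg
    -- Young's inequality bounds b Re z by b²/(2|a|) + |a|(Re z)²/2, and (Re z)² < |z|². Solving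
    -- a|z|² + b Re z + c ≥ 0 for |z|² gives this radius.
    let R : ℝ := (q.2.1 ^ 2 / (-q.1) + 2 * |q.2.2|) / (-q.1)
    have hsub : toSphere '' X ⊆ ((↑) : ℂ → OnePoint ℂ) '' {w : ℂ | Complex.normSq w ≤ R} := by
      rintro _ ⟨z, hz, rfl⟩
      refine ⟨z, ?_, rfl⟩
      have h1 := hq z hz
      have h2 := re_sq_lt_normSq z
      simp only [Set.mem_ofPred_eq]
      have hp : 0 < -q.1 := by linarith
      rw [le_div_iff₀ hp]
      have h3 : q.2.1 * z.re ≤ q.2.1 ^ 2 / (-q.1) / 2 + (-q.1) * z.re ^ 2 / 2 := by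
        rw [div_div, div_add_div _ _ (by positivity) two_ne_zero, le_div_iff₀ (by positivity)]
        nlinarith [sq_nonneg (q.2.1 - (-q.1) * z.re)]
      unfold formEval at h1
      nlinarith [le_abs_self q.2.2]
    have hcl : IsClosed (((↑) : ℂ → OnePoint ℂ) '' {w : ℂ | Complex.normSq w ≤ R}) := by
      rw [OnePoint.isClosed_image_coe]
      have hc : IsClosed {w : ℂ | Complex.normSq w ≤ R} :=
        isClosed_le Complex.continuous_normSq continuous_const
      refine ⟨hc, (isCompact_closedBall (0 : ℂ) (R + 1)).of_isClosed_subset hc ?_⟩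
      intro w hw
      rw [mem_closedBall_zero_iff]
      have : Complex.normSq w = ‖w‖ ^ 2 := Complex.normSq_eq_norm_sq w
      have hw' : Complex.normSq w ≤ R := hw
      nlinarith [norm_nonneg w, sq_nonneg (‖w‖ - 1)]
    obtain ⟨w, -, hw⟩ := closure_minimal hsub hcl hζ.1
    exact OnePoint.coe_ne_infty w hw
  · have h3 : (x : ℂ) ∈ closure ((UpperHalfPlane.coe : ℍ → ℂ) '' X) := by
      rw [OnePoint.isOpenEmbedding_coe.isInducing.closure_eq_preimage_closure_image,
        Set.image_image]
      exact hζ.1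
    have h4 := closure_minimal (t := {w : ℂ | 0 ≤ q.1 * Complex.normSq w + q.2.1 * w.re + q.2.2})
      (s := (UpperHalfPlane.coe : ℍ → ℂ) '' X) (by
        rintro _ ⟨z, hz, rfl⟩
        exact hq z hz)
      (isClosed_le continuous_const (by
        have := Complex.continuous_normSq
        have := Complex.continuous_re
        fun_prop)) h3
    have e : formBdry q (bdryVec ((x : ℂ) : OnePoint ℂ)).1 (bdryVec ((x : ℂ) : OnePoint ℂ)).2 =
        q.1 * Complex.normSq (x : ℂ) + q.2.1 * (x : ℂ).re + q.2.2 := by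
      rw [Complex.normSq_ofReal]
      change q.1 * x ^ 2 + q.2.1 * x * 1 + q.2.2 * 1 ^ 2 = q.1 * (x * x) + q.2.1 * x + q.2.2
      ring
    rw [e]; exact h4

theorem formBdry_eq_zero_of_mem_idealPoints {X : Set ℍ} {ζ : OnePoint ℂ}
    (hζ : ζ ∈ idealPoints X) {q : ℝ × ℝ × ℝ} (hq : ∀ z ∈ X, formEval q z = 0) :
    formBdry q (bdryVec ζ).1 (bdryVec ζ).2 = 0 := by
  have h1 := formBdry_nonneg_of_mem_idealPoints hζ fun z hz => (hq z hz).ge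
  have h2 := formBdry_nonneg_of_mem_idealPoints (q := -q) hζ fun z hz => by
    rw [formEval_neg, hq z hz, neg_zero]
  have e : ∀ x y, formBdry (-q) x y = -formBdry q x y := fun x y => by simp [formBdry]; ring
  rw [e] at h2
  linarith

/-- A real ideal point satisfies all the boundary inequalities. Either all are strict, which is
covered by `hstar`, or the point is a root of one of finitely many nonzero polynomials. -/
theorem countable_idealPoints {X : Set ℍ} {S : Finset (ℝ × ℝ × ℝ)}
    (hS : ∀ q ∈ S, 0 < formDisc q) (hX : ∀ z ∈ X, ∀ q ∈ S, 0 ≤ formEval q z)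
    (hstar : {x : ℝ | ∀ q ∈ S, 0 < formBdry q x 1}.Countable) : (idealPoints X).Countable := by
  have hroots : ∀ q ∈ S, {x : ℝ | formBdry q x 1 = 0}.Countable := by
    intro q hq
    let p : Polynomial ℝ := Polynomial.C q.1 * Polynomial.X ^ 2 + Polynomial.C q.2.1 * Polynomial.X
      + Polynomial.C q.2.2
    have hp : p ≠ 0 := by
      intro h0
      have h1 : p.coeff 2 = 0 := by rw [h0]; simp
      have h2 : p.coeff 1 = 0 := by rw [h0]; simp
      simp [p, Polynomial.coeff_C] at h1 h2
      have := hS q hq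
      simp [formDisc, h1, h2] at this
    refine (p.roots.toFinset.finite_toSet.subset ?_).countable
    intro x hx
    simp only [Finset.mem_coe, Multiset.mem_toFinset, Polynomial.mem_roots hp,
      Polynomial.IsRoot.def]
    simp only [Set.mem_ofPred_eq, formBdry] at hx
    simp [p]; linarith
  have hc : ({x : ℝ | ∀ q ∈ S, 0 < formBdry q x 1} ∪
      ⋃ q ∈ S, {x : ℝ | formBdry q x 1 = 0}).Countable :=
    hstar.union (S.countable_toSet.biUnion hroots)
  refine ((hc.image fun x : ℝ => ((x : ℂ) : OnePoint ℂ)).union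
    (Set.countable_singleton OnePoint.infty)).mono ?_
  intro ζ hζ
  rcases exists_real_of_mem_idealPoints hζ with rfl | ⟨x, rfl⟩
  · right; rfl
  · left
    refine ⟨x, ?_, rfl⟩
    have h1 : ∀ q ∈ S, 0 ≤ formBdry q x 1 := fun q hq => by
      have := formBdry_nonneg_of_mem_idealPoints hζ fun z hz => hX z hz q hq
      simpa [bdryVec] using this
    by_cases h2 : ∀ q ∈ S, 0 < formBdry q x 1
    · exact Or.inl h2
    · push Not at h2
      obtain ⟨q, hq, hq0⟩ := h2
      right
      simp only [Set.mem_iUnion]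
      exact ⟨q, hq, le_antisymm hq0 (h1 q hq)⟩

theorem dist_geodesic (u : PSL(2, ℝ)) (s t : ℝ) :
    dist (geodesic u s) (geodesic u t) = |s - t| := by
  obtain ⟨a, rfl⟩ := psl_exists_mk u
  unfold geodesic
  rw [psl_mk_smul, psl_mk_smul, dist_smul, UpperHalfPlane.dist_of_re_eq (by rfl)]
  change dist (Real.log (Real.exp s)) (Real.log (Real.exp t)) = _
  rw [Real.log_exp, Real.log_exp, Real.dist_eq]

theorem geodesic_injective (u : PSL(2, ℝ)) : Function.Injective (geodesic u) := by
  intro s t h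
  have := dist_geodesic u s t
  rw [h, dist_self] at this
  exact sub_eq_zero.1 (abs_eq_zero.1 this.symm)

/-- The Riemann sphere is compact, so the geodesic accumulates somewhere. The limit is not in ℍ,
because a unit-speed geodesic leaves every ball. -/
theorem exists_common_idealPoint (u : PSL(2, ℝ)) {A : Set ℍ} {l : Filter ℝ} [l.NeBot]
    (hl : Filter.Tendsto (fun t : ℝ => |t|) l Filter.atTop) (hA : ∀ᶠ t in l, geodesic u t ∈ A) :
    ∃ ζ, ζ ∈ idealPoints (Set.range (geodesic u)) ∧ ζ ∈ idealPoints A := by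
  obtain ⟨ζ, hζ⟩ := exists_clusterPt_of_compactSpace
    (Filter.map (fun t => toSphere (geodesic u t)) l)
  have hcl : ∀ X : Set ℍ, (∀ᶠ t in l, geodesic u t ∈ X) → ζ ∈ closure (toSphere '' X) := by
    intro X hX
    refine hζ.mem_closure_of_mem _ (Filter.mem_map.2 ?_)
    filter_upwards [hX] with t ht using ⟨_, ht, rfl⟩
  have hr : ζ ∉ Set.range toSphere := by
    rintro ⟨z, rfl⟩
    have hU : toSphere '' Metric.ball z 1 ∈ nhds (toSphere z) :=
      isOpenEmbedding_toSphere.isOpenMap.image_mem_nhds (Metric.ball_mem_nhds z one_pos)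
    have hfr : ∃ᶠ t in l, geodesic u t ∈ Metric.ball z 1 := by
      have := hζ.frequently (p := fun x => x ∈ toSphere '' Metric.ball z 1) hU
      rw [Filter.frequently_map] at this
      refine this.mono fun t ht => ?_
      obtain ⟨w, hw, e⟩ := ht
      rwa [← isOpenEmbedding_toSphere.injective e]
    have hev := hl.eventually (Filter.eventually_gt_atTop (1 + dist z (geodesic u 0)))
    obtain ⟨t, h1, h2⟩ := (hfr.and_eventually hev).exists
    have h3 := dist_geodesic u t 0
    have h4 := dist_triangle (geodesic u t) z (geodesic u 0)
    rw [Metric.mem_ball] at h1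
    rw [sub_zero] at h3
    linarith
  exact ⟨ζ, ⟨hcl _ (Filter.Eventually.of_forall fun t => ⟨t, rfl⟩), hr⟩, hcl _ hA, hr⟩

/-! ### Lines in general position -/

/-- The form vanishing on the line `W = k X + m` of the parabola model. -/
def lineForm (k m : ℝ) : ℝ × ℝ × ℝ := (1, -k, -m)

theorem formEval_lineForm (k m : ℝ) (z : ℍ) :
    formEval (lineForm k m) z = Complex.normSq (z : ℂ) - k * z.re - m := by
  simp [formEval, lineForm]; ring

theorem exists_geodesic_endpoints {A B : ℝ} (hAB : A ≠ B) : ∃ u : PSL(2, ℝ), ∀ t,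
    klein (geodesic u t) = ((B * Real.exp t ^ 2 + A) / (Real.exp t ^ 2 + 1),
      (B ^ 2 * Real.exp t ^ 2 + A ^ 2) / (Real.exp t ^ 2 + 1)) := by
  obtain ⟨σ, hσ, hpos⟩ : ∃ σ : ℝ, σ ^ 2 = 1 ∧ 0 < σ * (B - A) := by
    rcases lt_or_gt_of_ne hAB with h | h
    · exact ⟨1, by norm_num, by linarith⟩
    · exact ⟨-1, by norm_num, by linarith⟩
  set r := √(σ * (B - A)) with hr
  have hr2 : r ^ 2 = σ * (B - A) := Real.sq_sqrt hpos.le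
  have hr0 : r ≠ 0 := (Real.sqrt_pos.2 hpos).ne'
  -- The columns are multiples of the boundary vectors of B and A, so ∞ ↦ B and 0 ↦ A. The sign σ
  -- and the scaling by r give determinant one for either order of A and B.
  let a : SL(2, ℝ) := ⟨!![B / r, σ * A / r; 1 / r, σ / r], by
    rw [Matrix.det_fin_two_of]; field_simp; rw [hr2]⟩
  refine ⟨QuotientGroup.mk a, fun t => ?_⟩
  have hE : (0 : ℝ) < Real.exp t ^ 2 + 1 := by positivity
  unfold geodesic
  rw [psl_mk_smul]
  set z : ℍ := ⟨⟨0, Real.exp t⟩, Real.exp_pos t⟩ with hz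
  have hre : z.re = 0 := rfl
  have hns : Complex.normSq (z : ℂ) = Real.exp t ^ 2 := by
    change Complex.normSq (⟨0, Real.exp t⟩ : ℂ) = _
    rw [Complex.normSq_mk]; ring
  have h00 : a 0 0 = B / r := rfl
  have h01 : a 0 1 = σ * A / r := rfl
  have h10 : a 1 0 = 1 / r := rfl
  have h11 : a 1 1 = σ / r := rfl
  have h1 := re_smul_mul a z
  have h2 := normSq_smul_mul a z
  have h3 : autFactor a z = (Real.exp t ^ 2 + 1) / r ^ 2 := by
    unfold autFactor
    rw [hre, hns, h10, h11]; field_simp; rw [hσ]; ring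
  rw [h3, hre, hns, h00, h01, h10, h11] at h1
  rw [h3, hre, hns, h00, h01] at h2
  refine Prod.ext ?_ ?_
  · change (a • z).re = (B * Real.exp t ^ 2 + A) / (Real.exp t ^ 2 + 1)
    rw [eq_div_iff hE.ne']
    field_simp at h1
    linear_combination h1 + A * hσ
  · change Complex.normSq ((a • z : ℍ) : ℂ) = (B ^ 2 * Real.exp t ^ 2 + A ^ 2) / (Real.exp t ^ 2 + 1)
    rw [eq_div_iff hE.ne']
    field_simp at h2
    linear_combination h2 + A ^ 2 * hσ

/-- In the parabola model the geodesic with endpoints A and B is the chord W = (A + B)X − AB. A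
point on it is reached at the time with exp(2t) = (X − A)/(B − X). -/
theorem exists_geodesic_of_endpoints {A B : ℝ} (hAB : A ≠ B) : ∃ u : PSL(2, ℝ),
    (∀ t, formEval (lineForm (A + B) (-(A * B))) (geodesic u t) = 0) ∧
    (∀ z, formEval (lineForm (A + B) (-(A * B))) z = 0 → ∃ t, geodesic u t = z) ∧
    ∀ s t, s < t → 0 < (B - A) * ((geodesic u t).re - (geodesic u s).re) := by
  obtain ⟨u, hu⟩ := exists_geodesic_endpoints hAB
  have hre : ∀ t, (geodesic u t).re = (B * Real.exp t ^ 2 + A) / (Real.exp t ^ 2 + 1) :=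
    fun t => congrArg Prod.fst (hu t)
  have hns : ∀ t, Complex.normSq (geodesic u t : ℂ) =
      (B ^ 2 * Real.exp t ^ 2 + A ^ 2) / (Real.exp t ^ 2 + 1) :=
    fun t => congrArg Prod.snd (hu t)
  refine ⟨u, fun t => ?_, fun z hz => ?_, fun s t hst => ?_⟩
  · rw [formEval_lineForm, hre, hns]
    have hE : (0 : ℝ) < Real.exp t ^ 2 + 1 := by positivity
    field_simp; ring
  · rw [formEval_lineForm] at hz
    have h1 := re_sq_lt_normSq z
    have hpos : 0 < (z.re - A) * (B - z.re) := by nlinarith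
    have hB : B - z.re ≠ 0 := fun h => by rw [h, mul_zero] at hpos; exact lt_irrefl _ hpos
    have hE : 0 < (z.re - A) / (B - z.re) := by
      rw [← mul_pos_iff_of_pos_right (show 0 < (B - z.re) ^ 2 by positivity)]
      field_simp; exact hpos
    refine ⟨Real.log ((z.re - A) / (B - z.re)) / 2, klein_injective ?_⟩
    have e : Real.exp (Real.log ((z.re - A) / (B - z.re)) / 2) ^ 2 = (z.re - A) / (B - z.re) := by
      rw [← Real.exp_nat_mul]; push_cast
      rw [mul_div_cancel₀ _ two_ne_zero, Real.exp_log hE]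
    have hne : B - A ≠ 0 := sub_ne_zero.2 hAB.symm
    have e1 : (z.re - A) / (B - z.re) + 1 = (B - A) / (B - z.re) := by field_simp; ring
    rw [hu, e, e1]
    refine Prod.ext ?_ ?_
    · change _ = z.re
      simp only
      field_simp; ring
    · change _ = Complex.normSq (z : ℂ)
      simp only
      field_simp; linear_combination (-(B - A)) * hz
  · rw [hre, hre]
    have h1 : Real.exp s < Real.exp t := Real.exp_lt_exp.2 hst
    have h2 := Real.exp_pos s
    have hs : (0 : ℝ) < Real.exp s ^ 2 + 1 := by positivity
    have ht : (0 : ℝ) < Real.exp t ^ 2 + 1 := by positivity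
    have e : (B - A) * ((B * Real.exp t ^ 2 + A) / (Real.exp t ^ 2 + 1) -
        (B * Real.exp s ^ 2 + A) / (Real.exp s ^ 2 + 1)) = (B - A) ^ 2 *
        (Real.exp t ^ 2 - Real.exp s ^ 2) / ((Real.exp t ^ 2 + 1) * (Real.exp s ^ 2 + 1)) := by
      field_simp; ring
    rw [e]
    have h3 : 0 < Real.exp t ^ 2 - Real.exp s ^ 2 := by nlinarith
    have h4 : 0 < (B - A) ^ 2 := by
      have := sub_ne_zero.2 hAB.symm
      positivity
    positivity

/-- Every line `W = k X + m` meeting `ℍ` is a geodesic, which can be run in both directions. -/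
theorem exists_geodesic_lineForm {k m : ℝ} {z₀ : ℍ} (hz₀ : formEval (lineForm k m) z₀ = 0) {σ : ℝ}
    (hσ : σ ≠ 0) : ∃ u : PSL(2, ℝ), (∀ t, formEval (lineForm k m) (geodesic u t) = 0) ∧
    ∀ z, formEval (lineForm k m) z = 0 → ∀ w, formEval (lineForm k m) w = 0 →
      0 < σ * (w.re - z.re) → ∃ s t, s < t ∧ geodesic u s = z ∧ geodesic u t = w := by
  have hd : 0 < k ^ 2 + 4 * m := by
    rw [formEval_lineForm] at hz₀
    nlinarith [re_sq_lt_normSq z₀, sq_nonneg (2 * z₀.re - k)]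
  have hs := Real.sqrt_pos.2 hd
  have hs2 := Real.sq_sqrt hd.le
  set r := √(k ^ 2 + 4 * m)
  obtain ⟨A, B, hAB, hk, hm, hsgn⟩ : ∃ A B : ℝ, A ≠ B ∧ A + B = k ∧ -(A * B) = m ∧
      0 < σ * (B - A) := by
    rcases lt_or_gt_of_ne hσ with h | h
    · exact ⟨(k + r) / 2, (k - r) / 2, by intro e; linarith, by ring, by linarith, by nlinarith⟩
    · exact ⟨(k - r) / 2, (k + r) / 2, by intro e; linarith, by ring, by linarith, by nlinarith⟩
  obtain ⟨u, h1, h2, h3⟩ := exists_geodesic_of_endpoints hAB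
  rw [hk, hm] at h1 h2
  refine ⟨u, h1, fun z hz w hw hzw => ?_⟩
  obtain ⟨s, rfl⟩ := h2 z hz
  obtain ⟨t, rfl⟩ := h2 w hw
  refine ⟨s, t, ?_, rfl, rfl⟩
  rcases lt_trichotomy s t with h | h | h
  · exact h
  · rw [h] at hzw; simp at hzw
  · have h4 := h3 t s h
    nlinarith [mul_pos hsgn hsgn, mul_pos h4 hzw, sq_nonneg ((geodesic u t).re - (geodesic u s).re)]

theorem formEval_act_inv (q : ℝ × ℝ × ℝ) (a : SL(2, ℝ)) (z : ℍ) :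
    formEval q (a⁻¹ • z) = 0 ↔ formEval (formAct q a⁻¹) z = 0 :=
  formEval_smul_eq_zero q a⁻¹ z

theorem lineForm_eq_of_zero {k m m' : ℝ} {z : ℍ} (h : formEval (lineForm k m) z = 0)
    (h' : formEval (lineForm k m') z = 0) : m = m' := by
  rw [formEval_lineForm] at h h'; linarith

theorem lineForm_ne_zero (k m : ℝ) : ((lineForm k m).1, (lineForm k m).2.1) ≠ 0 := by
  simp [lineForm]

/-- Among the images under `a` of the parallel lines `W = k X + m`, all but countably many are in
general position and have a cutting sequence, in whichever direction they are run. -/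
theorem exists_countable_exceptions {Γ : Subgroup PSL(2, ℝ)} {P : Set ℍ}
    (hT : IsFundamentalTile Γ P) (hP : IsFormPolygon P) (hne : (interior P).Nonempty)
    (hvert : (vertexSet Γ P).Countable) (hideal : ∀ h ∈ Γ, (idealPoints (h • P)).Countable)
    (a : SL(2, ℝ)) (k : ℝ) : ∃ M : Set ℝ, M.Countable ∧ ∀ m ∉ M, ∀ u : PSL(2, ℝ),
      (∀ t, formEval (lineForm k m) (a⁻¹ • geodesic u t) = 0) →
      (Set.range (geodesic u) ∩ interior P).Nonempty →
      IsGeneralPosition Γ P (geodesic u) ∧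
        ∃ h t, h 0 = 1 ∧ IsItinerary Γ P (geodesic u) h t := by
  have hcΓ : Countable Γ := hT.countable (hne.mono interior_subset)
  -- Four kinds of bad intercepts m: the line contains two common points of two tiles, it passes
  -- through an isolated contact point of two tiles, it passes through a vertex, or it ends at an
  -- ideal vertex. For fixed slope each pair of tiles, vertex or ideal vertex spoils at most one m,
  -- and there are only countably many of them.
  let B₁ : Γ × Γ → Set ℝ := fun p => {m | p.1 ≠ p.2 ∧ ∃ z w : ℍ, z ≠ w ∧
    z ∈ (p.1 : PSL(2, ℝ)) • P ∩ (p.2 : PSL(2, ℝ)) • P ∧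
    w ∈ (p.1 : PSL(2, ℝ)) • P ∩ (p.2 : PSL(2, ℝ)) • P ∧
    formEval (lineForm k m) (a⁻¹ • z) = 0 ∧ formEval (lineForm k m) (a⁻¹ • w) = 0}
  let B₂ : Γ × Γ → Set ℝ := fun p => {m | ∃ z : ℍ,
    (p.1 : PSL(2, ℝ)) • P ∩ (p.2 : PSL(2, ℝ)) • P = {z} ∧
    formEval (lineForm k m) (a⁻¹ • z) = 0}
  let V : Set ℍ := ⋃ h : Γ, (h : PSL(2, ℝ)) • vertexSet Γ P
  let B₃ : Set ℝ := ⋃ z ∈ V, {m | formEval (lineForm k m) (a⁻¹ • z) = 0}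
  let J : Set (OnePoint ℂ) := ⋃ h : Γ, idealPoints ((h : PSL(2, ℝ)) • P)
  let B₄ : Set ℝ := ⋃ ζ ∈ J, {m | formBdry (formAct (lineForm k m) a⁻¹)
    (bdryVec ζ).1 (bdryVec ζ).2 = 0}
  -- All common points of two tiles lie on one separating line. If the given line contains two of
  -- them it is that line, and so m is determined by the pair.
  have h₁ : ∀ p, (B₁ p).Subsingleton := by
    rintro ⟨⟨h, hh⟩, ⟨h', hh'⟩⟩ m ⟨hn, z, w, hzw, hz, hw, e1, e2⟩ m'
      ⟨-, z', w', hzw', hz', hw', e1', e2'⟩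
    obtain ⟨q, hq, hq1, hq2⟩ := exists_separating_form_tiles hT hP hne hh hh'
      (fun e => hn (Subtype.ext e)) ⟨z, hz⟩
    have hq0 : ∀ x ∈ h • P ∩ h' • P, formEval (formAct q a) (a⁻¹ • x) = 0 := by
      intro x hx
      rw [← formEval_smul_eq_zero, smul_inv_smul]
      exact le_antisymm (hq2 x hx.2) (hq1 x hx.1)
    obtain ⟨τ, hτ⟩ := forms_proportional (lineForm_ne_zero k m)
      ((MulAction.injective a⁻¹).ne hzw) e1 e2 (hq0 z hz) (hq0 w hw)
    obtain ⟨τ', hτ'⟩ := forms_proportional (lineForm_ne_zero k m')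
      ((MulAction.injective a⁻¹).ne hzw') e1' e2' (hq0 z' hz') (hq0 w' hw')
    have hd := formDisc_act q a
    rw [hτ] at hτ'
    have c1 := congrArg Prod.fst hτ'
    have c2 := congrArg (fun x => x.2.2) hτ'
    simp [lineForm] at c1 c2
    have hτ0 : τ ≠ 0 := by
      rintro rfl
      rw [hτ] at hd
      simp [formDisc] at hd
      simp only [formDisc] at hq
      linarith
    rw [← c1] at c2
    exact mul_left_cancel₀ hτ0 c2
  have h₂ : ∀ p, (B₂ p).Subsingleton := by
    rintro ⟨h, h'⟩ m ⟨z, hz, e⟩ m' ⟨z', hz', e'⟩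
    rw [hz] at hz'
    rw [Set.singleton_eq_singleton_iff.1 hz'] at e
    exact lineForm_eq_of_zero e e'
  have h₃ : B₃.Countable := by
    refine (Set.countable_iUnion fun h => ?_ : V.Countable).biUnion fun z _ => ?_
    · exact hvert.image _
    · exact Set.Subsingleton.countable fun m e m' e' => lineForm_eq_of_zero e e'
  have h₄ : B₄.Countable := by
    refine (Set.countable_iUnion fun h => hideal h h.2 : J.Countable).biUnion fun ζ _ => ?_
    refine Set.Subsingleton.countable fun m e m' e' => ?_
    simp only [Set.mem_ofPred_eq, formBdry_act] at e e'
    have hd := sl_det a⁻¹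
    set b := a⁻¹
    set x := (bdryVec ζ).1 with hx
    set y := (bdryVec ζ).2 with hy
    have hxy : x ≠ 0 ∨ y ≠ 0 := by
      by_contra! hcon
      exact bdryVec_ne_zero ζ (Prod.ext hcon.1 hcon.2)
    simp only [formBdry, lineForm] at e e'
    by_cases h0 : b 1 0 * x + b 1 1 * y = 0
    · rw [h0] at e
      have h1 : b 0 0 * x + b 0 1 * y = 0 := by
        have : (b 0 0 * x + b 0 1 * y) ^ 2 = 0 := by linarith
        exact pow_eq_zero_iff two_ne_zero |>.1 this
      rcases hxy with h | h
      · exact absurd (by linear_combination b 1 1 * h1 - b 0 1 * h0 - x * hd) h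
      · exact absurd (by linear_combination -b 1 0 * h1 + b 0 0 * h0 - y * hd) h
    · refine mul_right_cancel₀ (pow_ne_zero 2 h0) ?_
      linear_combination e' - e
  refine ⟨(⋃ p, B₁ p) ∪ (⋃ p, B₂ p) ∪ B₃ ∪ B₄,
    (((Set.countable_iUnion fun p => (h₁ p).countable).union
      (Set.countable_iUnion fun p => (h₂ p).countable)).union h₃).union h₄, ?_⟩
  intro m hm u hu hint
  simp only [Set.mem_union, not_or] at hm
  obtain ⟨⟨⟨hm1, hm2⟩, hm3⟩, hm4⟩ := hm
  have hsub : ∀ h ∈ Γ, ∀ h' ∈ Γ, h ≠ h' →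
      (Set.range (geodesic u) ∩ (h • P ∩ h' • P)).Subsingleton := by
    rintro h hh h' hh' hn z ⟨⟨t, rfl⟩, hz⟩ w ⟨⟨s, rfl⟩, hw⟩
    by_contra hzw
    exact hm1 (Set.mem_iUnion.2 ⟨(⟨h, hh⟩, ⟨h', hh'⟩), fun e => hn (congrArg Subtype.val e),
      _, _, hzw, hz, hw, hu t, hu s⟩)
  have hnoideal : ∀ h ∈ Γ,
      Disjoint (idealPoints (Set.range (geodesic u))) (idealPoints (h • P)) := by
    intro h hh
    refine Set.disjoint_left.2 fun ζ h1 h2 => hm4 ?_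
    simp only [B₄, J, Set.mem_iUnion]
    refine ⟨ζ, ⟨⟨h, hh⟩, h2⟩, formBdry_eq_zero_of_mem_idealPoints h1 ?_⟩
    rintro _ ⟨t, rfl⟩
    rw [← formEval_act_inv]; exact hu t
  have hGP : IsGeneralPosition Γ P (geodesic u) := by
    refine ⟨hint, ?_, ?_, hnoideal⟩
    · intro h hh
      refine Set.disjoint_left.2 ?_
      rintro _ ⟨t, rfl⟩ hz
      refine hm3 ?_
      simp only [B₃, V, Set.mem_iUnion]
      exact ⟨_, ⟨⟨h, hh⟩, hz⟩, hu t⟩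
    · intro h hh g hg
      rw [Set.smul_set_inter, ← mul_smul]
      refine hsub h hh _ (Γ.mul_mem hh hg.1) fun e => hg.2.1 ?_
      simpa using e.symm
  refine ⟨hGP, ?_⟩
  obtain ⟨_, ⟨r, rfl⟩, hr⟩ := hint
  refine exists_itinerary hT hP hne (isLine_geodesic u) ?_ ?_ ?_ ?_ hr
  · intro h hh h' hh' hn s hs t ht
    exact geodesic_injective u (hsub h hh h' hh' hn ⟨⟨s, rfl⟩, hs⟩ ⟨⟨t, rfl⟩, ht⟩)
  · intro h hh h' hh' hn t h1 h2
    by_contra hcon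
    rw [Set.not_nontrivial_iff] at hcon
    exact hm2 (Set.mem_iUnion.2 ⟨(⟨h, hh⟩, ⟨h', hh'⟩), geodesic u t,
      hcon.eq_singleton_of_mem ⟨h1, h2⟩, hu t⟩)
  -- A geodesic staying in one tile from some time on would have an endpoint among the ideal points
  -- of that tile.
  · intro h hh M
    by_contra! hcon
    obtain ⟨ζ, h1, h2⟩ := exists_common_idealPoint u (A := h • P) Filter.tendsto_abs_atTop_atTop
      ((Filter.eventually_gt_atTop M).mono hcon)
    exact Set.disjoint_left.1 (hnoideal h hh) h1 h2
  · intro h hh M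
    by_contra! hcon
    obtain ⟨ζ, h1, h2⟩ := exists_common_idealPoint u (A := h • P) Filter.tendsto_abs_atBot_atTop
      ((Filter.eventually_lt_atBot M).mono hcon)
    exact Set.disjoint_left.1 (hnoideal h hh) h1 h2

/-! ### Words in cutting sequences -/

/-- The word `w 0, …, w (n - 1)` occurs in a cutting sequence. -/
def Occurs (Γ : Subgroup PSL(2, ℝ)) (P : Set ℍ) (n : ℕ) (w : ℕ → PSL(2, ℝ)) : Prop :=
  ∃ c ∈ cuttingShift Γ P, ∃ i : ℤ, ∀ j < n, (c (i + j) : PSL(2, ℝ)) = w j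

/-- Fixing finitely many coordinates is an open condition for the product topology. A word of a
limit sequence is therefore already a word of an actual cutting sequence. -/
theorem occurs_iff {Γ : Subgroup PSL(2, ℝ)} {P : Set ℍ} {n : ℕ} {w : ℕ → PSL(2, ℝ)} :
    Occurs Γ P n w ↔ ∃ u : PSL(2, ℝ), IsGeneralPosition Γ P (geodesic u) ∧ ∃ h t, h 0 = 1 ∧
      IsItinerary Γ P (geodesic u) h t ∧ ∃ i : ℤ, ∀ j < n, h (i + (j + 1 : ℕ)) = h (i + j) * w j := by
  constructor
  · rintro ⟨c, hc, i, hw⟩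
    let _ : TopologicalSpace (neighborhoodSet Γ P) := ⊥
    have : DiscreteTopology (neighborhoodSet Γ P) := ⟨rfl⟩
    have hopen : IsOpen {c' : ℤ → neighborhoodSet Γ P | ∀ j ∈ Finset.range n,
        c' (i + j) = c (i + j)} := by
      have : {c' : ℤ → neighborhoodSet Γ P | ∀ j ∈ Finset.range n, c' (i + j) = c (i + j)} =
          ⋂ j ∈ Finset.range n, (fun c' => c' (i + j)) ⁻¹' {c (i + j)} := by
        ext; simp
      rw [this]
      exact isOpen_biInter_finset fun j _ => (isOpen_discrete _).preimage (continuous_apply _)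
    obtain ⟨c', h1, u, hu, h, t, h0, hmem, hstep, hmono, htop, hbot, hint⟩ :=
      mem_closure_iff.1 hc _ hopen fun j _ => rfl
    have hs : ∀ i, (c' (i + 1) : PSL(2, ℝ)) = (h i)⁻¹ * h (i + 1) := by
      intro i
      have := hstep (i + 1)
      rw [add_sub_cancel_right] at this
      rw [this, inv_mul_cancel_left]
    -- The index drops by one because the symbol c i labels the step from h (i − 1) to h i.
    refine ⟨u, hu, h, t, h0, ⟨hmem, fun i => by rw [← hs]; exact (c' (i + 1)).2, hmono, htop, hbot,
      hint⟩, i - 1, fun j hj => ?_⟩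
    rw [← hw j hj, ← h1 j (Finset.mem_range.2 hj)]
    have := hstep (i + j)
    rw [show i - 1 + ((j + 1 : ℕ) : ℤ) = i + j by push_cast; ring,
      show i - 1 + (j : ℤ) = i + j - 1 by ring]
    exact this
  · rintro ⟨u, hu, h, t, h0, hI, i, hw⟩
    have hs : ∀ i, (h (i - 1))⁻¹ * h i ∈ neighborhoodSet Γ P := by
      intro i
      have := hI.step (i - 1)
      rwa [sub_add_cancel] at this
    refine ⟨fun i => ⟨_, hs i⟩, ?_, i + 1, fun j hj => ?_⟩
    · let _ : TopologicalSpace (neighborhoodSet Γ P) := ⊥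
      exact subset_closure ⟨u, hu, h, t, h0, hI.mem, fun i => by simp, hI.mono, hI.top,
        hI.bot, hI.int⟩
    · have := hw j hj
      dsimp only
      rw [show i + 1 + (j : ℤ) - 1 = i + j by ring,
        show i + 1 + (j : ℤ) = i + ((j + 1 : ℕ) : ℤ) by push_cast; ring, this, inv_mul_cancel_left]

/-- This is the only way in which the conjugacy of the two shifts enters the argument. -/
theorem occurs_transfer {Γ Γ' : Subgroup PSL(2, ℝ)} {P P' : Set ℍ}
    (e : neighborhoodSet Γ P ≃ neighborhoodSet Γ' P')
    (he : (fun c : ℤ → neighborhoodSet Γ P => fun i => e (c i)) '' cuttingShift Γ P =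
      cuttingShift Γ' P') (n : ℕ) (w : ℕ → neighborhoodSet Γ P) :
    Occurs Γ P n (fun j => w j) ↔ Occurs Γ' P' n (fun j => e (w j)) := by
  constructor
  · rintro ⟨c, hc, i, hw⟩
    refine ⟨fun i => e (c i), by rw [← he]; exact ⟨c, hc, rfl⟩, i, fun j hj => ?_⟩
    exact congrArg (fun x => (e x : PSL(2, ℝ))) (Subtype.ext (hw j hj))
  · rintro ⟨c, hc, i, hw⟩
    rw [← he] at hc
    obtain ⟨c', hc', rfl⟩ := hc
    refine ⟨c', hc', i, fun j hj => ?_⟩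
    have := e.injective (Subtype.ext (hw j hj))
    rw [this]

/-- A generator all of whose powers occur as words has infinite order. -/
theorem not_isOfFinOrder_of_occurs {Γ : Subgroup PSL(2, ℝ)} {P : Set ℍ}
    (hT : IsFundamentalTile Γ P) (hP : IsFormPolygon P) (hne : (interior P).Nonempty)
    {g : PSL(2, ℝ)} (h : ∀ n, Occurs Γ P n fun _ => g) : ¬ IsOfFinOrder g := by
  intro hg
  obtain ⟨n, hn, hgn⟩ := isOfFinOrder_iff_pow_eq_one.1 hg
  obtain ⟨u, -, h, t, -, hI, i, hw⟩ := occurs_iff.1 (h n)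
  have key : ∀ j ≤ n, h (i + j) = h i * g ^ j := by
    intro j hj
    induction j with
    | zero => simp
    | succ j ih => rw [hw j (by omega), ih (by omega), pow_succ, mul_assoc]
  have h1 := key n le_rfl
  rw [hgn, mul_one] at h1
  have := hI.injective hT hP hne (isLine_geodesic u) h1
  omega

/-! ### Finite area -/

/-- The slice ε/2 < Im z < ε of the box has Euclidean area δε, and the density there is at least
ε⁻². Its hyperbolic area is thus at least δ/ε, which is unbounded as ε → 0. -/
theorem volume_cuspBox_eq_top {x δ : ℝ} (hδ : 0 < δ) :
    MeasureTheory.volume {z : ℍ | |z.re - x| < δ ∧ z.im < δ} = ⊤ := by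
  rw [UpperHalfPlane.volume_eq_lintegral, eq_top_iff]
  refine ENNReal.le_of_forall_nnreal_lt fun r _ => ?_
  obtain ⟨ε, hε0, hε1, hε2⟩ : ∃ ε : ℝ, 0 < ε ∧ ε < δ ∧ (r : ℝ) ≤ δ / ε := by
    refine ⟨min (δ / 2) (δ / (r + 1)), by positivity, (min_le_left _ _).trans_lt (by linarith), ?_⟩
    rw [le_div_iff₀ (by positivity)]
    calc (r : ℝ) * min (δ / 2) (δ / (r + 1)) ≤ r * (δ / (r + 1)) := by
          gcongr; exact min_le_right _ _
      _ ≤ δ := by rw [mul_div_assoc', div_le_iff₀ (by positivity)]; nlinarith [r.coe_nonneg]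
  let Bx : Set ℂ := Complex.measurableEquivRealProd ⁻¹'
    (Set.Ioo (x - δ) (x + δ) ×ˢ Set.Ioo (ε / 2) ε)
  have hBm : MeasurableSet Bx :=
    Complex.measurableEquivRealProd.measurable (measurableSet_Ioo.prod measurableSet_Ioo)
  have hBvol : MeasureTheory.volume Bx = ENNReal.ofReal (2 * δ) * ENNReal.ofReal (ε / 2) := by
    rw [Complex.volume_preserving_equiv_real_prod.measure_preimage
      (measurableSet_Ioo.prod measurableSet_Ioo).nullMeasurableSet,
      MeasureTheory.Measure.volume_eq_prod, MeasureTheory.Measure.prod_prod, Real.volume_Ioo,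
      Real.volume_Ioo]
    congr 2 <;> ring
  have hBsub : Bx ⊆ (UpperHalfPlane.coe : ℍ → ℂ) '' {z : ℍ | |z.re - x| < δ ∧ z.im < δ} := by
    rintro w ⟨h1, h2⟩
    simp only [Complex.measurableEquivRealProd_apply, Set.mem_Ioo] at h1 h2
    refine ⟨⟨w, by linarith⟩, ⟨?_, h2.2.trans hε1⟩, rfl⟩
    change |w.re - x| < δ
    rw [abs_lt]; constructor <;> linarith
  calc (r : ENNReal) ≤ ENNReal.ofReal (δ / ε) := by
        rw [← ENNReal.ofReal_coe_nnreal]; exact ENNReal.ofReal_le_ofReal hε2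
    _ = ENNReal.ofReal ((1 / ε) ^ 2) * MeasureTheory.volume Bx := by
        rw [hBvol, ← ENNReal.ofReal_mul (by positivity), ← ENNReal.ofReal_mul (by positivity)]
        congr 1; field_simp
    _ = ∫⁻ _ in Bx, ENNReal.ofReal ((1 / ε) ^ 2) := by
        rw [MeasureTheory.setLIntegral_const]
    _ ≤ ∫⁻ w in Bx, ↑((1 / ‖w.im‖₊) ^ 2 : NNReal) := by
        refine MeasureTheory.setLIntegral_mono' hBm fun w hw => ?_
        obtain ⟨-, h2⟩ := hw
        simp only [Complex.measurableEquivRealProd_apply, Set.mem_Ioo] at h2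
        rw [← ENNReal.ofReal_coe_nnreal]
        refine ENNReal.ofReal_le_ofReal ?_
        push_cast
        rw [Real.norm_of_nonneg (by linarith)]
        have : 0 < w.im := by linarith
        gcongr
        exact h2.2.le
    _ ≤ _ := MeasureTheory.lintegral_mono_set hBsub

/-- If all forms were positive at a boundary point, then by continuity the polygon would contain a
full half-neighbourhood of that point, which has infinite area. -/
theorem exists_formBdry_nonpos {S : Finset (ℝ × ℝ × ℝ)}
    (h : MeasureTheory.volume {z : ℍ | ∀ q ∈ S, 0 ≤ formEval q z} < ⊤) (x : ℝ) :
    ∃ q ∈ S, formBdry q x 1 ≤ 0 := by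
  by_contra! hpos
  have hev : ∀ q ∈ S, ∀ᶠ p in nhds ((x, 0) : ℝ × ℝ),
      0 < q.1 * (p.1 ^ 2 + p.2 ^ 2) + q.2.1 * p.1 + q.2.2 := by
    intro q hq
    have hc : Continuous fun p : ℝ × ℝ => q.1 * (p.1 ^ 2 + p.2 ^ 2) + q.2.1 * p.1 + q.2.2 := by
      fun_prop
    refine hc.continuousAt.eventually (lt_mem_nhds ?_)
    have := hpos q hq
    simp only [formBdry] at this
    simp only; linarith
  rw [← Filter.eventually_all_finset, Metric.eventually_nhds_iff] at hev
  obtain ⟨δ, hδ, hb⟩ := hev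
  refine h.ne (eq_top_iff.2 ?_)
  rw [← volume_cuspBox_eq_top (x := x) hδ]
  refine MeasureTheory.measure_mono fun z hz q hq => ?_
  have h1 : dist ((z.re, z.im) : ℝ × ℝ) (x, 0) < δ := by
    rw [Prod.dist_eq, max_lt_iff]
    refine ⟨by simpa [Real.dist_eq] using hz.1, ?_⟩
    simpa [Real.dist_eq, abs_of_pos z.im_pos] using hz.2
  have h2 := hb h1 q hq
  unfold formEval
  rw [normSq_eq]
  exact h2.le

theorem formBdry_pos_of_large {q : ℝ × ℝ × ℝ} (hq : 0 < q.1) {x : ℝ}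
    (hx : 1 + (|q.2.1| + |q.2.2|) / q.1 ≤ x) : 0 < formBdry q x 1 := by
  have h1 : q.1 + (|q.2.1| + |q.2.2|) ≤ x * q.1 := by
    have := mul_le_mul_of_nonneg_right hx hq.le
    rwa [add_mul, one_mul, div_mul_cancel₀ _ hq.ne'] at this
  have hx1 : 1 ≤ x := le_trans (by
    have : 0 ≤ (|q.2.1| + |q.2.2|) / q.1 := by positivity
    linarith) hx
  unfold formBdry
  have h2 : -(|q.2.1| * x) ≤ q.2.1 * x := by
    have := neg_abs_le q.2.1; nlinarith
  have h3 := neg_abs_le q.2.2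
  nlinarith [abs_nonneg q.2.2, mul_le_mul_of_nonneg_left h1 (by linarith : (0 : ℝ) ≤ x)]

/-- Two half-planes with a common interior point have a common interval of ideal points. -/
theorem exists_formBdry_pos_of_two {q r : ℝ × ℝ × ℝ} {p : ℍ} (hq : 0 < formEval q p)
    (hr : 0 < formEval r p) : ∃ x : ℝ, 0 < formBdry q x 1 ∧ 0 < formBdry r x 1 := by
  have hp := re_sq_lt_normSq p
  set X := p.re
  set W := Complex.normSq (p : ℂ)
  simp only [formEval] at hq hr
  change 0 < q.1 * W + q.2.1 * X + q.2.2 at hq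
  change 0 < r.1 * W + r.2.1 * X + r.2.2 at hr
  -- Here q does not change along the vertical line through p, so the foot X of that line works
  -- unless r is nonpositive there. In that case r has positive leading coefficient, and a point far
  -- out on the side on which q is positive serves.
  by_cases h1 : q.1 = 0
  · by_cases h2 : 0 < formBdry r X 1
    · refine ⟨X, ?_, h2⟩
      simp only [formBdry, h1] at hq ⊢; linarith
    · have hr1 : 0 < r.1 := by
        by_contra hcon
        simp only [formBdry] at h2
        nlinarith
      rcases le_total 0 q.2.1 with h3 | h3
      · refine ⟨max X (1 + (|r.2.1| + |r.2.2|) / r.1), ?_,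
          formBdry_pos_of_large hr1 (le_max_right _ _)⟩
        have := le_max_left X (1 + (|r.2.1| + |r.2.2|) / r.1)
        simp only [formBdry, h1] at hq ⊢
        nlinarith
      · have hr' := formBdry_pos_of_large (q := (r.1, -r.2.1, r.2.2)) hr1
          (x := max (-X) (1 + (|-r.2.1| + |r.2.2|) / r.1)) (le_max_right _ _)
        have := le_max_left (-X) (1 + (|-r.2.1| + |r.2.2|) / r.1)
        refine ⟨-max (-X) (1 + (|-r.2.1| + |r.2.2|) / r.1), ?_, ?_⟩
        · simp only [formBdry, h1] at hq ⊢
          nlinarith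
        · simp only [formBdry] at hr' ⊢; linarith
  -- The chord through p parallel to the boundary line of q has slope k. Along it q keeps its
  -- positive value, so q is positive at both ends of the chord. The ends are the numbers (k ± s)/2.
  · set k := -q.2.1 / q.1 with hk
    have hqk : q.2.1 = -q.1 * k := by rw [hk]; field_simp
    have hd : 0 < k ^ 2 + 4 * (W - k * X) := by nlinarith [sq_nonneg (2 * X - k)]
    have hs2 := Real.sq_sqrt hd.le
    have hs := Real.sqrt_pos.2 hd
    set s := √(k ^ 2 + 4 * (W - k * X))
    have hroot : ∀ σ : ℝ, σ ^ 2 = 1 →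
        ((k + σ * s) / 2) ^ 2 = k * ((k + σ * s) / 2) + (W - k * X) := by
      intro σ hσ
      nlinarith
    have hqx : ∀ σ : ℝ, σ ^ 2 = 1 → 0 < formBdry q ((k + σ * s) / 2) 1 := by
      intro σ hσ
      have := hroot σ hσ
      simp only [formBdry]
      rw [this, hqk]
      rw [hqk] at hq
      linarith
    -- The value r(p) > 0 is a weighted mean of the values of r at the two ends of the chord, so one
    -- of these is positive.
    have hsum : ((k + 1 * s) / 2 - (k + -1 * s) / 2) * (r.1 * W + r.2.1 * X + r.2.2) =
        (X - (k + -1 * s) / 2) * formBdry r ((k + 1 * s) / 2) 1 +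
        ((k + 1 * s) / 2 - X) * formBdry r ((k + -1 * s) / 2) 1 := by
      simp only [formBdry]
      rw [hroot 1 (by norm_num), hroot (-1) (by norm_num)]
      ring
    have hX : 0 < (X - (k + -1 * s) / 2) * ((k + 1 * s) / 2 - X) := by nlinarith
    by_cases h2 : 0 < formBdry r ((k + 1 * s) / 2) 1
    · exact ⟨_, hqx 1 (by norm_num), h2⟩
    · by_cases h3 : 0 < formBdry r ((k + -1 * s) / 2) 1
      · exact ⟨_, hqx (-1) (by norm_num), h3⟩
      · exfalso
        have h4 : 0 < X - (k + -1 * s) / 2 := by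
          by_contra hcon
          have : (k + 1 * s) / 2 - X < 0 := by
            by_contra hc2
            nlinarith
          linarith
        have h5 : 0 < (k + 1 * s) / 2 - X := (mul_pos_iff_of_pos_left h4).1 hX
        nlinarith [mul_pos hs hr, mul_nonneg h4.le (sub_nonneg.2 (not_lt.1 h2)),
          mul_nonneg h5.le (sub_nonneg.2 (not_lt.1 h3))]

/-! ### The sides of a fundamental polygon -/

theorem exists_mixPath (z w : ℍ) : ∃ f : Set.Icc (0 : ℝ) 1 → ℍ, Continuous f ∧
    ∀ θ : Set.Icc (0:ℝ) 1, IsMix (θ:ℝ) z w (f θ) := by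
  have h : ∀ θ : Set.Icc (0 : ℝ) 1,
      ((1 - (θ : ℝ)) • klein z + (θ : ℝ) • klein w).1 ^ 2 <
        ((1 - (θ : ℝ)) • klein z + (θ : ℝ) • klein w).2 := fun θ => by
    obtain ⟨v, hv⟩ := exists_isMix θ.2.1 θ.2.2 z w
    rw [IsMix] at hv
    rw [← hv]; exact re_sq_lt_normSq v
  refine ⟨fun θ => kleinHomeo.symm ⟨_, h θ⟩, ?_, fun θ => klein_ofKlein _⟩
  refine kleinHomeo.symm.continuous.comp (Continuous.subtype_mk ?_ _)
  fun_prop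

theorem isMix_injective {z w v : ℍ} (hzw : z ≠ w) {θ θ' : ℝ} (h : IsMix θ z w v)
    (h' : IsMix θ' z w v) : θ = θ' := by
  have hk : klein w - klein z ≠ 0 := sub_ne_zero.2 (klein_injective.ne hzw.symm)
  rw [IsMix] at h h'
  have : (θ - θ') • (klein w - klein z) = 0 := by
    have e := h.symm.trans h'
    have e2 : (θ - θ') • (klein w - klein z) = ((1 - θ) • klein z + θ • klein w) -
      ((1 - θ') • klein z + θ' • klein w) := by module
    rw [e2, e, sub_self]
  rcases smul_eq_zero.1 this with h | h
  · linarith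
  · exact absurd h hk

section Sides

variable {Γ : Subgroup PSL(2, ℝ)} {P : Set ℍ}

/-- Besides sides, two tiles may share a single point. Such contacts are countable in number and are
avoided by genericity below, so that no prior knowledge of the combinatorics of the tessellation is
needed. -/
theorem countable_singleton_meets (hT : IsFundamentalTile Γ P) (hne : (interior P).Nonempty) :
    {v | ∃ x ∈ Γ, P ∩ x • P = {v}}.Countable := by
  have hcΓ : Countable Γ := hT.countable (hne.mono interior_subset)
  have : {v | ∃ x ∈ Γ, P ∩ x • P = {v}} = ⋃ x : Γ, {v | P ∩ (x : PSL(2, ℝ)) • P = {v}} := by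
    ext v; simp
  rw [this]
  refine Set.countable_iUnion fun x => Set.Subsingleton.countable ?_
  intro v hv w hw
  rw [Set.mem_ofPred_eq] at hv hw
  exact Set.singleton_eq_singleton_iff.1 (hv.symm.trans hw)

theorem mem_neighborhoodSet_of_meets {x : PSL(2, ℝ)} (hx : x ∈ Γ) (hx1 : x ≠ 1) {v : ℍ}
    (hv : v ∈ P) (hv' : v ∈ x • P) (hn : ¬ ∃ x ∈ Γ, P ∩ x • P = {v}) :
    x ∈ neighborhoodSet Γ P := by
  refine ⟨hx, hx1, ?_⟩
  by_contra hcon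
  rw [Set.not_nontrivial_iff] at hcon
  exact hn ⟨x, hx, hcon.eq_singleton_of_mem ⟨hv, hv'⟩⟩

/-- Suppose z satisfies all side inequalities but is not in P. A segment from an interior point p to
z leaves P at a point of another tile. If this tile were a neighbour, its form would vanish at the
exit point while being positive at p and nonnegative at z, which is impossible before the end of the
segment. So every such segment leaves through an isolated contact point. There are only countably
many of these, while p varies over a continuum of directions from z. -/
theorem region_eq_of_sides (hT : IsFundamentalTile Γ P) (hP : IsFormPolygon P)
    (hne : (interior P).Nonempty) {q : PSL(2, ℝ) → ℝ × ℝ × ℝ}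
    (hq : ∀ x ∈ neighborhoodSet Γ P, 0 < formDisc (q x))
    (hqP : ∀ x ∈ neighborhoodSet Γ P, ∀ z ∈ P, 0 ≤ formEval (q x) z)
    (hq0 : ∀ x ∈ neighborhoodSet Γ P, ∀ z ∈ P ∩ x • P, formEval (q x) z = 0) :
    P = {z | ∀ x ∈ neighborhoodSet Γ P, 0 ≤ formEval (q x) z} := by
  refine subset_antisymm (fun z hz x hx => hqP x hx z hz) fun z hz => ?_
  by_contra hzP
  have hexit : ∀ p ∈ interior P, ∃ v, (v ∈ P ∧ ∃ x ∈ Γ, P ∩ x • P = {v}) ∧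
      ∃ θ : ℝ, IsMix θ p z v := by
    intro p hp
    obtain ⟨f, hf, hfm⟩ := exists_mixPath p z
    have h0 : f ⟨0, by simp⟩ = p := klein_injective (by rw [hfm ⟨0, by simp⟩]; simp)
    have h1 : f ⟨1, by simp⟩ = z := klein_injective (by rw [hfm ⟨1, by simp⟩]; simp)
    obtain ⟨θ, hθ⟩ := (nonempty_frontier_iff (s := f ⁻¹' P)).2
      ⟨⟨⟨0, by simp⟩, by rw [Set.mem_preimage, h0]; exact interior_subset hp⟩, fun hu => hzP (by
        have : (⟨1, by simp⟩ : Set.Icc (0 : ℝ) 1) ∈ f ⁻¹' P := by rw [hu]; trivial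
        rwa [Set.mem_preimage, h1] at this)⟩
    have hvP : f θ ∈ P := by
      have := frontier_subset_closure hθ
      rwa [(hP.isClosed.preimage hf).closure_eq] at this
    have hvn : f θ ∉ interior P := fun h =>
      hθ.2 (preimage_interior_subset_interior_preimage hf h)
    have hθ1 : (θ : ℝ) < 1 := lt_of_le_of_ne θ.2.2 fun e => by
      have : θ = ⟨1, by simp⟩ := Subtype.ext e
      rw [this, h1] at hvP; exact hzP hvP
    rw [← one_smul PSL(2, ℝ) P] at hvn
    obtain ⟨x, hx, hx1, hvx⟩ := exists_other_tile hT hP hvn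
    refine ⟨f θ, ⟨hvP, ?_⟩, θ, hfm θ⟩
    by_contra hn
    have hxN := mem_neighborhoodSet_of_meets hx hx1 hvP hvx hn
    have e := (hfm θ).formEval (q x)
    rw [hq0 x hxN _ ⟨hvP, hvx⟩] at e
    have h2 := formEval_pos_of_mem_interior (fst_ne_zero_of_formDisc_pos (hq x hxN))
      (hqP x hxN) hp
    nlinarith [mul_nonneg θ.2.1 (hz x hxN), mul_pos (sub_pos.2 hθ1) h2]
  obtain ⟨p₀, hp₀⟩ := hne
  -- The point p is moved perpendicularly to d. A contact point v ≠ z lies on the line from z to at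
  -- most one of the displaced points, and the vanishing cross product in `hbad` expresses this
  -- collinearity.
  set d := klein p₀ - klein z with hd
  have hd0 : d ≠ 0 := sub_ne_zero.2 (klein_injective.ne fun e => hzP (e ▸ interior_subset hp₀))
  have hd2 : d.1 ^ 2 + d.2 ^ 2 ≠ 0 := fun h => hd0 (Prod.ext
    (by simp; nlinarith [sq_nonneg d.1, sq_nonneg d.2])
    (by simp; nlinarith [sq_nonneg d.1, sq_nonneg d.2]))
  have hopen : IsOpen {e : ℝ | klein p₀ + e • ((-d.2, d.1) : ℝ × ℝ) ∈ klein '' interior P} :=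
    (isOpenEmbedding_klein.isOpenMap _ isOpen_interior).preimage (by fun_prop)
  have hbad : ({e : ℝ | ∃ v, (v ∈ P ∧ ∃ x ∈ Γ, P ∩ x • P = {v}) ∧
      ((klein v - klein z).1 * (d + e • ((-d.2, d.1) : ℝ × ℝ)).2 =
        (klein v - klein z).2 * (d + e • ((-d.2, d.1) : ℝ × ℝ)).1)}).Countable := by
    have : {e : ℝ | ∃ v, (v ∈ P ∧ ∃ x ∈ Γ, P ∩ x • P = {v}) ∧
      ((klein v - klein z).1 * (d + e • ((-d.2, d.1) : ℝ × ℝ)).2 =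
        (klein v - klein z).2 * (d + e • ((-d.2, d.1) : ℝ × ℝ)).1)} ⊆
      ⋃ v ∈ {v | ∃ x ∈ Γ, P ∩ x • P = {v}}, {e | v ∈ P ∧
        ((klein v - klein z).1 * (d + e • ((-d.2, d.1) : ℝ × ℝ)).2 =
        (klein v - klein z).2 * (d + e • ((-d.2, d.1) : ℝ × ℝ)).1)} := by
      rintro e ⟨v, ⟨h1, h2⟩, h3⟩
      simp only [Set.mem_iUnion]
      exact ⟨v, h2, h1, h3⟩
    refine Set.Countable.mono this ((countable_singleton_meets hT ⟨p₀, hp₀⟩).biUnion fun v _ =>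
      Set.Subsingleton.countable ?_)
    rintro e ⟨hv, h1⟩ e' ⟨-, h2⟩
    have hvz : klein v - klein z ≠ 0 :=
      sub_ne_zero.2 (klein_injective.ne fun e => hzP (e ▸ hv))
    set y := klein v - klein z
    simp only [Prod.snd_add, Prod.fst_add, Prod.smul_mk, smul_eq_mul] at h1 h2
    have h3 : (e - e') * (y.1 * d.1 + y.2 * d.2) = 0 := by linear_combination h1 - h2
    rcases mul_eq_zero.1 h3 with h | h
    · linarith
    · have h4 : y.1 * d.2 - y.2 * d.1 = 0 := by linear_combination h1 - e * h
      exfalso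
      refine hvz (Prod.ext ?_ ?_)
      · exact (mul_eq_zero.1 (show y.1 * (d.1 ^ 2 + d.2 ^ 2) = 0 by
          linear_combination d.1 * h + d.2 * h4)).resolve_right hd2
      · exact (mul_eq_zero.1 (show y.2 * (d.1 ^ 2 + d.2 ^ 2) = 0 by
          linear_combination d.2 * h - d.1 * h4)).resolve_right hd2
  obtain ⟨e, he1, he2⟩ := (hbad.dense_compl ℝ).inter_open_nonempty _ hopen
    ⟨0, by simp only [Set.mem_ofPred_eq, zero_smul, add_zero]; exact ⟨p₀, hp₀, rfl⟩⟩
  obtain ⟨p, hp, hpe⟩ := he1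
  obtain ⟨v, hv, θ, hm⟩ := hexit p hp
  refine he2 ⟨v, hv, ?_⟩
  have h1 : klein v - klein z = (1 - θ) • (d + e • ((-d.2, d.1) : ℝ × ℝ)) := by
    rw [hm, hpe, hd]; module
  rw [h1]
  simp only [Prod.smul_fst, Prod.smul_snd, smul_eq_mul]
  ring

/-- Join z to another point of the side P ∩ x • P. The joining segment lies in the boundary of P, so
each of its points is in some other tile. All but countably many are neither isolated contacts nor
on the line of a different side, and hence lie in x • P. Closedness of x • P gives the endpoint z.
-/
theorem mem_tile_of_mem_side (hT : IsFundamentalTile Γ P) (hP : IsFormPolygon P)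
    (hne : (interior P).Nonempty) {q : PSL(2, ℝ) → ℝ × ℝ × ℝ}
    (hq : ∀ x ∈ neighborhoodSet Γ P, 0 < formDisc (q x))
    (hqP : ∀ x ∈ neighborhoodSet Γ P, ∀ z ∈ P, 0 ≤ formEval (q x) z)
    (hq0 : ∀ x ∈ neighborhoodSet Γ P, ∀ z ∈ P ∩ x • P, formEval (q x) z = 0)
    (hprop : ∀ x ∈ neighborhoodSet Γ P, ∀ y ∈ neighborhoodSet Γ P, x ≠ y →
      ¬ ∃ t : ℝ, q y = t • q x)
    {x : PSL(2, ℝ)} (hx : x ∈ neighborhoodSet Γ P) {z : ℍ} (hz : z ∈ P)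
    (hzx : formEval (q x) z = 0) : z ∈ x • P := by
  have hcΓ : Countable Γ := hT.countable (hne.mono interior_subset)
  obtain ⟨z₁, hz₁, hzz⟩ := hx.2.2.exists_ne z
  obtain ⟨f, hf, hfm⟩ := exists_mixPath z z₁
  have hfP : ∀ θ, f θ ∈ P := fun θ => hP.isMix θ.2.1 θ.2.2 (hfm θ) hz hz₁.1
  have hf0 : ∀ θ, formEval (q x) (f θ) = 0 := fun θ => by
    rw [(hfm θ).formEval, hzx, hq0 x hx z₁ hz₁]; simp
  have hinj : Function.Injective f := fun θ θ' e => Subtype.ext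
    (isMix_injective hzz.symm (hfm θ) (by rw [e]; exact hfm θ'))
  let Bad : Set ℍ := {v | ∃ x ∈ Γ, P ∩ x • P = {v}} ∪
    ⋃ y : Γ, {v | (y : PSL(2, ℝ)) ∈ neighborhoodSet Γ P ∧ (y : PSL(2, ℝ)) ≠ x ∧
      formEval (q y) v = 0 ∧ formEval (q x) v = 0}
  have hBad : Bad.Countable := by
    refine (countable_singleton_meets hT hne).union (Set.countable_iUnion fun y =>
      Set.Subsingleton.countable ?_)
    rintro v ⟨hy, hyx, h1, h2⟩ w ⟨-, -, h3, h4⟩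
    by_contra hvw
    exact hprop x hx y hy hyx.symm (forms_proportional
      (fst_ne_zero_of_formDisc_pos (hq x hx)) hvw h2 h4 h1 h3)
  have hgood : ∀ θ, f θ ∉ Bad → f θ ∈ x • P := by
    intro θ hθ
    simp only [Bad, Set.mem_union, not_or, Set.mem_iUnion, not_exists] at hθ
    have hni : f θ ∉ interior P := fun h =>
      (formEval_pos_of_mem_interior (fst_ne_zero_of_formDisc_pos (hq x hx)) (hqP x hx) h).ne'
        (hf0 θ)
    rw [← one_smul PSL(2, ℝ) P] at hni
    obtain ⟨y, hy, hy1, hvy⟩ := exists_other_tile hT hP hni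
    have hyN := mem_neighborhoodSet_of_meets hy hy1 (hfP θ) hvy (by simpa using hθ.1)
    by_contra hcon
    have hyx : y ≠ x := fun e => hcon (e ▸ hvy)
    exact hθ.2 ⟨y, hy⟩ ⟨hyN, hyx, hq0 y hyN _ ⟨hfP θ, hvy⟩, hf0 θ⟩
  have hcount : (Subtype.val '' (f ⁻¹' Bad) : Set ℝ).Countable :=
    (hBad.preimage_of_injOn hinj.injOn).image _
  have hz0 : f ⟨0, by simp⟩ = z := klein_injective (by rw [hfm ⟨0, by simp⟩]; simp)
  have hcl : IsClosed (f ⁻¹' (x • P)) := (hP.smul x).isClosed.preimage hf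
  have h0 : (⟨0, by simp⟩ : Set.Icc (0 : ℝ) 1) ∈ closure (f ⁻¹' (x • P)) := by
    rw [Metric.mem_closure_iff]
    intro ε hε
    obtain ⟨r, hr1, hr2⟩ := (hcount.dense_compl ℝ).inter_open_nonempty _ isOpen_Ioo
      (Set.nonempty_Ioo.2 (lt_min hε one_pos))
    have hr01 : r ∈ Set.Icc (0 : ℝ) 1 := ⟨hr1.1.le, hr1.2.le.trans (min_le_right _ _)⟩
    refine ⟨⟨r, hr01⟩, hgood _ fun hb => hr2 ⟨_, hb, rfl⟩, ?_⟩
    rw [Subtype.dist_eq, Real.dist_eq]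
    simp only [zero_sub, abs_neg, abs_of_pos hr1.1]
    exact hr1.2.trans_le (min_le_left _ _)
  rw [hcl.closure_eq, Set.mem_preimage, hz0] at h0
  exact h0

/-- By `hprop` different sides lie on different lines, which meet at most once, and a nontrivial
element fixes at most one point. Both kinds of vertices are indexed by a countable group. -/
theorem countable_vertexSet (hT : IsFundamentalTile Γ P) (hne : (interior P).Nonempty)
    {q : PSL(2, ℝ) → ℝ × ℝ × ℝ}
    (hq : ∀ x ∈ neighborhoodSet Γ P, 0 < formDisc (q x))
    (hq0 : ∀ x ∈ neighborhoodSet Γ P, ∀ z ∈ P ∩ x • P, formEval (q x) z = 0)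
    (hprop : ∀ x ∈ neighborhoodSet Γ P, ∀ y ∈ neighborhoodSet Γ P, x ≠ y →
      ¬ ∃ t : ℝ, q y = t • q x) : (vertexSet Γ P).Countable := by
  have hcΓ : Countable Γ := hT.countable (hne.mono interior_subset)
  have hsub : vertexSet Γ P ⊆ (⋃ p : Γ × Γ, {z | (p.1 : PSL(2, ℝ)) ∈ neighborhoodSet Γ P ∧
      (p.2 : PSL(2, ℝ)) ∈ neighborhoodSet Γ P ∧ (p.1 : PSL(2, ℝ)) ≠ p.2 ∧
      formEval (q p.1) z = 0 ∧ formEval (q p.2) z = 0}) ∪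
      ⋃ g : Γ, {z | (g : PSL(2, ℝ)) ≠ 1 ∧ (g : PSL(2, ℝ)) • z = z} := by
    rintro z ⟨hz, ⟨g, hg, g', hg', hn, h1, h2⟩ | ⟨g, hg, h1⟩⟩
    · left
      exact Set.mem_iUnion.2 ⟨(⟨g, hg.1⟩, ⟨g', hg'.1⟩), hg, hg', hn, hq0 g hg z ⟨hz, h1⟩,
        hq0 g' hg' z ⟨hz, h2⟩⟩
    · right
      exact Set.mem_iUnion.2 ⟨⟨g, hg.1⟩, hg.2.1, h1⟩
  refine Set.Countable.mono hsub (Set.Countable.union ?_ ?_)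
  · refine Set.countable_iUnion fun p => Set.Subsingleton.countable ?_
    rintro z ⟨h1, h2, hn, e1, e2⟩ w ⟨-, -, -, e3, e4⟩
    by_contra hzw
    exact hprop _ h1 _ h2 hn (forms_proportional (fst_ne_zero_of_formDisc_pos (hq _ h1)) hzw
      e1 e3 e2 e4)
  · refine Set.countable_iUnion fun g => Set.Subsingleton.countable ?_
    rintro z ⟨h1, e1⟩ w ⟨-, e2⟩
    by_contra hzw
    exact h1 (psl_smul_eq_of_two_fixed e1 e2 hzw)

end Sides

/-! ### Fundamental triangles with a side pairing `g` and a half-turn `s` -/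

/-- `P` is a fundamental tile bounded by three geodesics, of which `g` maps the first to the second
and `s` reverses the third, and has finite area in the sense that no ideal point is in the
interior of the three half-planes. -/
structure TriangleTile (Γ : Subgroup PSL(2, ℝ)) (P : Set ℍ) (g s : SL(2, ℝ))
    (q₁ q₂ q₃ : ℝ × ℝ × ℝ) : Prop where
  tile : IsFundamentalTile Γ P
  g_mem : (QuotientGroup.mk g : PSL(2, ℝ)) ∈ Γ
  s_mem : (QuotientGroup.mk s : PSL(2, ℝ)) ∈ Γ
  region : ∀ z, z ∈ P ↔ 0 ≤ formEval q₁ z ∧ 0 ≤ formEval q₂ z ∧ 0 ≤ formEval q₃ z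
  inner : ∃ z, 0 < formEval q₁ z ∧ 0 < formEval q₂ z ∧ 0 < formEval q₃ z
  star : ∀ x y : ℝ, (x ≠ 0 ∨ y ≠ 0) →
    formBdry q₁ x y ≤ 0 ∨ formBdry q₂ x y ≤ 0 ∨ formBdry q₃ x y ≤ 0
  side : ∃ z w, z ≠ w ∧ z ∈ P ∧ w ∈ P ∧ formEval q₁ z = 0 ∧ formEval q₁ w = 0
  map_side : ∀ z, formEval q₁ z = 0 → (z ∈ P ↔ g • z ∈ P)
  act_g : formAct q₂ g = -q₁
  act_s : formAct q₃ s = -q₃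
  s_side : ∀ z ∈ P, formEval q₃ z = 0 → s • z ∈ P
  disc₁ : 0 < formDisc q₁
  disc₃ : 0 < formDisc q₃
  not_fixed : ∀ z : ℍ, g • z ≠ z

namespace TriangleTile

variable {Γ : Subgroup PSL(2, ℝ)} {P : Set ℍ} {g s : SL(2, ℝ)} {q₁ q₂ q₃ : ℝ × ℝ × ℝ}

theorem disc₂ (h : TriangleTile Γ P g s q₁ q₂ q₃) : 0 < formDisc q₂ := by
  rw [← formDisc_act q₂ g, h.act_g, formDisc_neg]; exact h.disc₁

theorem isFormPolygon (h : TriangleTile Γ P g s q₁ q₂ q₃) : IsFormPolygon P := by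
  classical
  refine ⟨{q₁, q₂, q₃}, ?_⟩
  ext z
  rw [h.region]; simp

theorem mem_interior_of_pos (h : TriangleTile Γ P g s q₁ q₂ q₃) {z : ℍ} (h1 : 0 < formEval q₁ z)
    (h2 : 0 < formEval q₂ z) (h3 : 0 < formEval q₃ z) : z ∈ interior P := by
  refine mem_interior.2 ⟨{z | 0 < formEval q₁ z} ∩ {z | 0 < formEval q₂ z} ∩
    {z | 0 < formEval q₃ z}, ?_, ?_, ⟨⟨h1, h2⟩, h3⟩⟩
  · rintro z ⟨⟨h1, h2⟩, h3⟩
    exact (h.region z).2 ⟨le_of_lt h1, le_of_lt h2, le_of_lt h3⟩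
  · exact ((isOpen_lt continuous_const (continuous_formEval _)).inter
      (isOpen_lt continuous_const (continuous_formEval _))).inter
      (isOpen_lt continuous_const (continuous_formEval _))

theorem interior_nonempty (h : TriangleTile Γ P g s q₁ q₂ q₃) : (interior P).Nonempty := by
  obtain ⟨z, h1, h2, h3⟩ := h.inner
  exact ⟨z, h.mem_interior_of_pos h1 h2 h3⟩

theorem countable_idealPoints_smul (h : TriangleTile Γ P g s q₁ q₂ q₃) (x : PSL(2, ℝ)) :
    (idealPoints (x • P)).Countable := by
  classical
  obtain ⟨a, rfl⟩ := psl_exists_mk x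
  refine countable_idealPoints (S := {formAct q₁ a⁻¹, formAct q₂ a⁻¹, formAct q₃ a⁻¹}) ?_ ?_ ?_
  · simp only [Finset.mem_insert, Finset.mem_singleton, forall_eq_or_imp, forall_eq, formDisc_act]
    exact ⟨h.disc₁, h.disc₂, h.disc₃⟩
  · intro z hz
    rw [mem_mk_smul_iff, h.region] at hz
    simpa only [Finset.mem_insert, Finset.mem_singleton, forall_eq_or_imp, forall_eq,
      formEval_smul_nonneg] using hz
  · convert Set.countable_empty
    rw [Set.eq_empty_iff_forall_notMem]
    intro x hx
    simp only [Finset.mem_insert, Finset.mem_singleton, forall_eq_or_imp, forall_eq,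
      formBdry_act, Set.mem_ofPred_eq] at hx
    have hdet := sl_det a⁻¹
    have hne : a⁻¹ 0 0 * x + a⁻¹ 0 1 * 1 ≠ 0 ∨ a⁻¹ 1 0 * x + a⁻¹ 1 1 * 1 ≠ 0 := by
      by_contra! hcon
      nlinarith [hcon.1, hcon.2, hdet, congrArg (a⁻¹ 1 0 * ·) hcon.1, congrArg (a⁻¹ 0 0 * ·) hcon.2]
    rcases h.star _ _ hne with h1 | h1 | h1 <;> linarith [hx.1, hx.2.1, hx.2.2]

theorem conj (h : TriangleTile Γ P g s q₁ q₂ q₃) (u : SL(2, ℝ)) :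
    TriangleTile (Γ.map (MulAut.conj (QuotientGroup.mk u : PSL(2, ℝ))).toMonoidHom)
      ((QuotientGroup.mk u : PSL(2, ℝ)) • P) (u * g * u⁻¹) (u * s * u⁻¹)
      (formAct q₁ u⁻¹) (formAct q₂ u⁻¹) (formAct q₃ u⁻¹) := by
  have hmem : ∀ z, z ∈ (QuotientGroup.mk u : PSL(2, ℝ)) • P ↔ u⁻¹ • z ∈ P :=
    fun z => mem_mk_smul_iff u P z
  have hev : ∀ (q : ℝ × ℝ × ℝ) z, formEval (formAct q u⁻¹) (u • z) = 0 ↔ formEval q z = 0 :=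
    fun q z => by rw [← formEval_smul_eq_zero, inv_smul_smul]
  refine ⟨⟨fun z => ?_, ?_, ?_⟩, ?_, ?_, ?_, ?_, ?_, ?_, ?_, ?_, ?_, ?_, ?_, ?_, ?_⟩
  · obtain ⟨x, hx, hz⟩ := h.tile.cover (u⁻¹ • z)
    refine ⟨_, ⟨x, hx, rfl⟩, ?_⟩
    rw [← psl_mk_smul] at hz
    simp only [MulEquiv.coe_toMonoidHom, MulAut.conj_apply]
    rw [mul_smul, mul_smul, inv_smul_smul]
    rw [QuotientGroup.mk_inv, ← Set.mem_smul_set_iff_inv_smul_mem] at hz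
    exact hz
  · rintro _ ⟨x, hx, rfl⟩ hx1
    simp only [MulEquiv.coe_toMonoidHom, MulAut.conj_apply] at hx1 ⊢
    rw [mul_smul, mul_smul, inv_smul_smul, smul_interior _ P, smul_interior _ (x • P),
      Set.disjoint_smul_set]
    exact h.tile.disjoint_interior x hx fun e => hx1 (by rw [e]; simp)
  · intro z
    obtain ⟨U, hU, hf⟩ := h.tile.locallyFinite (u⁻¹ • z)
    refine ⟨(QuotientGroup.mk u : PSL(2, ℝ)) • U, ?_, ?_⟩
    · have := (smul_mem_nhds_smul_iff (QuotientGroup.mk u : PSL(2, ℝ))).2 hU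
      rwa [psl_mk_smul, smul_inv_smul] at this
    · let φ : Γ → Γ.map (MulAut.conj (QuotientGroup.mk u : PSL(2, ℝ))).toMonoidHom :=
        fun x => ⟨_, ⟨x, x.2, rfl⟩⟩
      refine (hf.image φ).subset ?_
      rintro ⟨_, x, hx, rfl⟩ hy
      refine ⟨⟨x, hx⟩, ?_, rfl⟩
      simp only [MulEquiv.coe_toMonoidHom, MulAut.conj_apply, Set.mem_ofPred_eq] at hy ⊢
      rwa [mul_smul, mul_smul, inv_smul_smul, ← Set.smul_set_inter, Set.smul_set_nonempty] at hy
  · exact ⟨_, h.g_mem, by simp⟩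
  · exact ⟨_, h.s_mem, by simp⟩
  · intro z
    rw [hmem, h.region]
    simp only [formEval_smul_nonneg]
  · obtain ⟨z, h1, h2, h3⟩ := h.inner
    refine ⟨u • z, ?_⟩
    simp only [← formEval_smul_pos, inv_smul_smul]
    exact ⟨h1, h2, h3⟩
  · intro x y hxy
    simp only [formBdry_act]
    refine h.star _ _ ?_
    have hdet := sl_det u⁻¹
    by_contra! hcon
    obtain ⟨h1, h2⟩ := hcon
    rcases hxy with hx | hx
    · exact hx (by linear_combination (-x) * hdet + u⁻¹ 1 1 * h1 - u⁻¹ 0 1 * h2)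
    · exact hx (by linear_combination (-y) * hdet - u⁻¹ 1 0 * h1 + u⁻¹ 0 0 * h2)
  · obtain ⟨z, w, hzw, hz, hw, h1, h2⟩ := h.side
    refine ⟨u • z, u • w, (MulAction.injective u).ne hzw, ?_, ?_, ?_, ?_⟩
    · rwa [hmem, inv_smul_smul]
    · rwa [hmem, inv_smul_smul]
    · rwa [hev]
    · rwa [hev]
  · intro z hz
    rw [← formEval_smul_eq_zero] at hz
    rw [hmem, hmem, h.map_side _ hz, mul_smul, mul_smul, inv_smul_smul]
  · rw [← formAct_mul, show ∀ x : SL(2, ℝ), u⁻¹ * (u * x * u⁻¹) = x * u⁻¹ by intro x; group,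
      formAct_mul, h.act_g, formAct_neg]
  · rw [← formAct_mul, show ∀ x : SL(2, ℝ), u⁻¹ * (u * x * u⁻¹) = x * u⁻¹ by intro x; group,
      formAct_mul, h.act_s, formAct_neg]
  · intro z hz hz3
    rw [hmem] at hz ⊢
    rw [mul_smul, mul_smul, inv_smul_smul]
    rw [← formEval_smul_eq_zero] at hz3
    exact h.s_side _ hz hz3
  · rw [formDisc_act]; exact h.disc₁
  · rw [formDisc_act]; exact h.disc₃
  · intro z hz
    rw [mul_smul, mul_smul] at hz
    exact h.not_fixed (u⁻¹ • z) (by rw [eq_inv_smul_iff]; exact hz)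

end TriangleTile

theorem exists_third {α : Type*} {a b c x y : α} (hx : x = a ∨ x = b ∨ x = c)
    (hy : y = a ∨ y = b ∨ y = c) (hxy : x ≠ y) : ∃ w, (w = a ∨ w = b ∨ w = c) ∧
      ∀ v, (v = a ∨ v = b ∨ v = c) → v = x ∨ v = y ∨ v = w := by
  rcases hx with rfl | rfl | rfl <;> rcases hy with rfl | rfl | rfl
  all_goals first
    | exact absurd rfl hxy
    | exact ⟨a, by tauto, by tauto⟩
    | exact ⟨b, by tauto, by tauto⟩
    | exact ⟨c, by tauto, by tauto⟩

/-- A finite-area fundamental polygon whose side pairings are `g`, `g⁻¹` and a half-turn `s` is a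
triangle (with possibly some vertices at infinity). -/
theorem exists_triangleTile {Γ : Subgroup PSL(2, ℝ)} {P : Set ℍ} (hT : IsFundamentalTile Γ P)
    (hP : IsFormPolygon P) (hne : (interior P).Nonempty) (harea : MeasureTheory.volume P < ⊤)
    {g s : SL(2, ℝ)} (hN : neighborhoodSet Γ P = {QuotientGroup.mk g, (QuotientGroup.mk g)⁻¹,
      QuotientGroup.mk s}) (hgg : (QuotientGroup.mk g : PSL(2, ℝ)) ≠ (QuotientGroup.mk g)⁻¹)
    (hsg : (QuotientGroup.mk s : PSL(2, ℝ)) ≠ QuotientGroup.mk g)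
    (hsg' : (QuotientGroup.mk s : PSL(2, ℝ)) ≠ (QuotientGroup.mk g)⁻¹)
    (hss : (QuotientGroup.mk s : PSL(2, ℝ))⁻¹ = QuotientGroup.mk s)
    (hg : ¬ IsOfFinOrder (QuotientGroup.mk g : PSL(2, ℝ))) :
    (vertexSet Γ P).Countable ∧ ∃ q₁ q₂ q₃, TriangleTile Γ P g s q₁ q₂ q₃ := by
  classical
  set G : PSL(2, ℝ) := QuotientGroup.mk g with hG
  set S : PSL(2, ℝ) := QuotientGroup.mk s with hS
  have hGN : G ∈ neighborhoodSet Γ P := by rw [hN]; simp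
  have hGN' : G⁻¹ ∈ neighborhoodSet Γ P := by rw [hN]; simp
  have hSN : S ∈ neighborhoodSet Γ P := by rw [hN]; simp
  have hsep : ∀ x ∈ neighborhoodSet Γ P, ∃ q, 0 < formDisc q ∧ (∀ z ∈ P, 0 ≤ formEval q z) ∧
      ∀ z ∈ x • P, formEval q z ≤ 0 := by
    intro x hx
    simpa only [one_smul] using exists_separating_form_tiles hT hP hne Γ.one_mem hx.1 hx.2.1.symm
      (by rw [one_smul]; exact hx.2.2.nonempty)
  obtain ⟨q₂, hd2, hp2, hn2⟩ := hsep G hGN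
  obtain ⟨r, hdr, hpr, hnr⟩ := hsep S hSN
  -- The form of the first side is pulled back from the second, so that `act_g` holds exactly and
  -- not only up to a positive factor.
  set q₁ := -formAct q₂ g with hq1
  -- Since s is an involution, antisymmetrising the separating form gives a form that s changes
  -- exactly to its negative. It still separates P from s • P.
  set q₃ := r - formAct r s with hq3
  have hsP : ∀ z ∈ P, formEval (formAct r s) z ≤ 0 := fun z hz => by
    rw [← formEval_smul_mul]
    exact mul_nonpos_of_nonpos_of_nonneg
      (hnr _ (by rw [← psl_mk_smul]; exact Set.smul_mem_smul_set hz)) (autFactor_pos s z).le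
  have hsP' : ∀ z ∈ S • P, 0 ≤ formEval (formAct r s) z := fun z hz => by
    rw [← formEval_smul_nonneg]
    refine hpr _ ?_
    rwa [← hss, Set.mem_inv_smul_set_iff] at hz
  have hp1 : ∀ z ∈ P, 0 ≤ formEval q₁ z := fun z hz => by
    rw [hq1, formEval_neg, ← formEval_smul_mul, ← neg_mul]
    exact mul_nonneg (neg_nonneg.2 (hn2 _ (by
      rw [← psl_mk_smul]; exact Set.smul_mem_smul_set hz))) (autFactor_pos g z).le
  have hn1 : ∀ z ∈ G⁻¹ • P, formEval q₁ z ≤ 0 := fun z hz => by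
    rw [hq1, formEval_neg, neg_nonpos, ← formEval_smul_nonneg]
    exact hp2 _ (by rwa [Set.mem_inv_smul_set_iff] at hz)
  have hp3 : ∀ z ∈ P, 0 ≤ formEval q₃ z := fun z hz => by
    rw [hq3, formEval_sub]; linarith [hpr z hz, hsP z hz]
  have hn3 : ∀ z ∈ S • P, formEval q₃ z ≤ 0 := fun z hz => by
    rw [hq3, formEval_sub]; linarith [hnr z hz, hsP' z hz]
  have hd1 : 0 < formDisc q₁ := by rw [hq1, formDisc_neg, formDisc_act]; exact hd2
  obtain ⟨p₀, hp₀⟩ := hne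
  have hd3 : 0 < formDisc q₃ := by
    obtain ⟨z, hz, hz'⟩ := hSN.2.2.nonempty
    have hz0 : formEval q₃ z = 0 := le_antisymm (hn3 z hz') (hp3 z hz)
    refine formDisc_pos_of_zero (fun h => ?_) hz0
    rw [Prod.mk_eq_zero] at h
    have h1 := formEval_pos_of_mem_interior (fst_ne_zero_of_formDisc_pos hdr) hpr hp₀
    have h2 : 0 < formEval q₃ p₀ := by
      rw [hq3, formEval_sub]; linarith [hsP p₀ (interior_subset hp₀)]
    simp only [formEval, h.1, h.2] at hz0 h2
    linarith
  set q : PSL(2, ℝ) → ℝ × ℝ × ℝ := fun x => if x = G then q₂ else if x = G⁻¹ then q₁ else q₃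
    with hq
  have hqG : q G = q₂ := by simp [hq]
  have hqG' : q G⁻¹ = q₁ := by simp [hq, hgg.symm]
  have hqS : q S = q₃ := by simp [hq, hsg, hsg']
  have hall : ∀ p : PSL(2, ℝ) → Prop, p G → p G⁻¹ → p S → ∀ x ∈ neighborhoodSet Γ P, p x := by
    intro p h1 h2 h3 x hx
    rw [hN] at hx
    rcases hx with rfl | rfl | rfl <;> assumption
  have hqd : ∀ x ∈ neighborhoodSet Γ P, 0 < formDisc (q x) :=
    hall _ (by rwa [hqG]) (by rwa [hqG']) (by rwa [hqS])
  have hqP : ∀ x ∈ neighborhoodSet Γ P, ∀ z ∈ P, 0 ≤ formEval (q x) z :=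
    hall _ (by rwa [hqG]) (by rwa [hqG']) (by rwa [hqS])
  have hqn : ∀ x ∈ neighborhoodSet Γ P, ∀ z ∈ x • P, formEval (q x) z ≤ 0 :=
    hall _ (by rwa [hqG]) (by rwa [hqG']) (by rwa [hqS])
  have hq0 : ∀ x ∈ neighborhoodSet Γ P, ∀ z ∈ P ∩ x • P, formEval (q x) z = 0 :=
    fun x hx z hz => le_antisymm (hqn x hx z hz.2) (hqP x hx z hz.1)
  have hreg := region_eq_of_sides hT hP ⟨p₀, hp₀⟩ hqd hqP hq0
  have hreg' : ∀ z, z ∈ P ↔ 0 ≤ formEval q₁ z ∧ 0 ≤ formEval q₂ z ∧ 0 ≤ formEval q₃ z := by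
    intro z
    constructor
    · exact fun hz => ⟨hp1 z hz, hp2 z hz, hp3 z hz⟩
    · rintro ⟨h1, h2, h3⟩
      rw [hreg]
      exact hall _ (by rwa [hqG]) (by rwa [hqG']) (by rwa [hqS])
  have hpos : ∀ x ∈ neighborhoodSet Γ P, 0 < formEval (q x) p₀ := fun x hx =>
    formEval_pos_of_mem_interior (fst_ne_zero_of_formDisc_pos (hqd x hx)) (hqP x hx) hp₀
  have hstar1 : ∀ x : ℝ, formBdry q₁ x 1 ≤ 0 ∨ formBdry q₂ x 1 ≤ 0 ∨ formBdry q₃ x 1 ≤ 0 := by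
    intro x
    have := exists_formBdry_nonpos (S := {q₁, q₂, q₃}) (by
      have e : {z : ℍ | ∀ q ∈ ({q₁, q₂, q₃} : Finset (ℝ × ℝ × ℝ)), 0 ≤ formEval q z} = P := by
        ext z; rw [hreg']; simp
      rwa [e]) x
    simpa using this
  -- If two sides lay on the same line, P would be an intersection of only two half-planes. These
  -- have an ideal point in common at which both forms are positive, contrary to finite area.
  have hprop : ∀ x ∈ neighborhoodSet Γ P, ∀ y ∈ neighborhoodSet Γ P, x ≠ y →
      ¬ ∃ t : ℝ, q y = t • q x := by
    rintro x hx y hy hxy ⟨t, ht⟩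
    have ht0 : 0 < t := by
      have h1 := hpos y hy
      rw [ht, formEval_smul'] at h1
      exact (pos_iff_pos_of_mul_pos h1).2 (hpos x hx)
    have key : ∀ v ∈ neighborhoodSet Γ P, v = G ∨ v = G⁻¹ ∨ v = S :=
      hall _ (by simp) (by simp) (by simp)
    obtain ⟨w, hw, hw'⟩ := exists_third (key x hx) (key y hy) hxy
    replace hw : w ∈ neighborhoodSet Γ P := by rwa [hN]
    replace hw' := fun v hv => hw' v (key v hv)
    obtain ⟨X, h1, h2⟩ := exists_formBdry_pos_of_two (hpos x hx) (hpos w hw)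
    have hb : ∀ v ∈ neighborhoodSet Γ P, 0 < formBdry (q v) X 1 := by
      intro v hv
      rcases hw' v hv with rfl | rfl | rfl
      · exact h1
      · rw [ht]
        have : formBdry (t • q x) X 1 = t * formBdry (q x) X 1 := by
          simp only [formBdry, Prod.smul_fst, Prod.smul_snd, smul_eq_mul]; ring
        rw [this]; exact mul_pos ht0 h1
      · exact h2
    have b1 := hb _ hGN'
    have b2 := hb _ hGN
    have b3 := hb _ hSN
    rw [hqG'] at b1
    rw [hqG] at b2
    rw [hqS] at b3
    rcases hstar1 X with h | h | h <;> linarith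
  have hside : ∀ x ∈ neighborhoodSet Γ P, ∀ z ∈ P, formEval (q x) z = 0 → z ∈ x • P :=
    fun x hx z hz hz0 => mem_tile_of_mem_side hT hP ⟨p₀, hp₀⟩ hqd hqP hq0 hprop hx hz hz0
  refine ⟨countable_vertexSet hT ⟨p₀, hp₀⟩ hqd hq0 hprop, q₁, q₂, q₃, hT, hGN.1, hSN.1, hreg',
    ⟨p₀, ?_, ?_, ?_⟩, ?_, ?_, ?_, ?_, ?_, ?_, hd1, hd3, ?_⟩
  · have := hpos _ hGN'; rwa [hqG'] at this
  · have := hpos _ hGN; rwa [hqG] at this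
  · have := hpos _ hSN; rwa [hqS] at this
  · intro x y hxy
    have hsc : ∀ q : ℝ × ℝ × ℝ, y ≠ 0 → formBdry q x y = y ^ 2 * formBdry q (x / y) 1 := by
      intro q hy
      simp only [formBdry]; field_simp
    -- The case y = 0 is the point ∞. If all leading coefficients were positive, then all forms
    -- would be positive at a large real number.
    by_cases hy : y = 0
    · have hx : x ≠ 0 := hxy.resolve_right (not_not.2 hy)
      subst hy
      have e : ∀ q : ℝ × ℝ × ℝ, formBdry q x 0 = q.1 * x ^ 2 := fun q => by simp [formBdry]
      rw [e, e, e]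
      by_contra! hcon
      have hx2 : 0 < x ^ 2 := by positivity
      obtain ⟨h1, h2, h3⟩ := hcon
      have h1 := (pos_iff_pos_of_mul_pos h1).2 hx2
      have h2 := (pos_iff_pos_of_mul_pos h2).2 hx2
      have h3 := (pos_iff_pos_of_mul_pos h3).2 hx2
      set X := max (1 + (|q₁.2.1| + |q₁.2.2|) / q₁.1) (max (1 + (|q₂.2.1| + |q₂.2.2|) / q₂.1)
        (1 + (|q₃.2.1| + |q₃.2.2|) / q₃.1))
      have b1 := formBdry_pos_of_large h1 (x := X) (le_max_left _ _)
      have b2 := formBdry_pos_of_large h2 (x := X) ((le_max_left _ _).trans (le_max_right _ _))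
      have b3 := formBdry_pos_of_large h3 (x := X) ((le_max_right _ _).trans (le_max_right _ _))
      rcases hstar1 X with h | h | h <;> linarith
    · rw [hsc _ hy, hsc _ hy, hsc _ hy]
      have hy2 : 0 ≤ y ^ 2 := sq_nonneg y
      rcases hstar1 (x / y) with h | h | h
      · exact Or.inl (mul_nonpos_of_nonneg_of_nonpos hy2 h)
      · exact Or.inr (Or.inl (mul_nonpos_of_nonneg_of_nonpos hy2 h))
      · exact Or.inr (Or.inr (mul_nonpos_of_nonneg_of_nonpos hy2 h))
  · obtain ⟨z, hz, w, hw, hzw⟩ := hGN'.2.2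
    have h1 := hq0 _ hGN' z hz
    have h2 := hq0 _ hGN' w hw
    rw [hqG'] at h1 h2
    exact ⟨z, w, hzw, hz.1, hw.1, h1, h2⟩
  · intro z hz
    constructor
    · intro hzP
      have := hside _ hGN' z hzP (by rwa [hqG'])
      rwa [Set.mem_inv_smul_set_iff] at this
    · intro hgz
      have h0 : formEval q₂ (g • z) = 0 := by
        rw [formEval_smul_eq_zero]
        rw [hq1, formEval_neg, neg_eq_zero] at hz
        exact hz
      have := hside _ hGN (g • z) hgz (by rwa [hqG])
      rwa [hG, mem_mk_smul_iff, inv_smul_smul] at this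
  · rw [hq1, neg_neg]
  · rw [hq3, formAct_sub, neg_sub, ← formAct_mul]
    congr 1
    have h1 : (QuotientGroup.mk (1 : SL(2, ℝ)) : PSL(2, ℝ)) = QuotientGroup.mk (s * s) := by
      rw [QuotientGroup.mk_mul, QuotientGroup.mk_one]
      rw [inv_eq_iff_mul_eq_one] at hss
      exact hss.symm
    rcases (psl_mk_eq_mk_iff _ _).1 h1 with h | h <;> rw [h]
    · rw [formAct_one]
    · rw [formAct_negMat, formAct_one]
  · intro z hz hz0
    have := hside _ hSN z hz (by rwa [hqS])
    rwa [← hss, Set.mem_inv_smul_set_iff] at this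
  · intro z hz
    exact hg (isOfFinOrder_of_fixed hT hGN.1 (z := z) hz)

/-! ### Normalisation of the triangle -/

/-- A matrix of determinant one, as an element of `SL(2, ℝ)`. -/
def slMk (a b c d : ℝ) (h : a * d - b * c = 1) : SL(2, ℝ) :=
  ⟨!![a, b; c, d], by rw [Matrix.det_fin_two_of]; exact h⟩

section

variable (a b c d : ℝ) (h : a * d - b * c = 1)

@[simp] theorem slMk_00 : slMk a b c d h 0 0 = a := rfl
@[simp] theorem slMk_01 : slMk a b c d h 0 1 = b := rfl
@[simp] theorem slMk_10 : slMk a b c d h 1 0 = c := rfl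
@[simp] theorem slMk_11 : slMk a b c d h 1 1 = d := rfl

end

theorem sl_ext {g h : SL(2, ℝ)} (h00 : g 0 0 = h 0 0) (h01 : g 0 1 = h 0 1) (h10 : g 1 0 = h 1 0)
    (h11 : g 1 1 = h 1 1) : g = h := by
  ext i j
  fin_cases i <;> fin_cases j <;> assumption

theorem sl_inv_00 (g : SL(2, ℝ)) : g⁻¹ 0 0 = g 1 1 := by
  simp [Matrix.SpecialLinearGroup.SL2_inv_expl]
theorem sl_inv_01 (g : SL(2, ℝ)) : g⁻¹ 0 1 = -g 0 1 := by
  simp [Matrix.SpecialLinearGroup.SL2_inv_expl]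
theorem sl_inv_10 (g : SL(2, ℝ)) : g⁻¹ 1 0 = -g 1 0 := by
  simp [Matrix.SpecialLinearGroup.SL2_inv_expl]
theorem sl_inv_11 (g : SL(2, ℝ)) : g⁻¹ 1 1 = g 0 0 := by
  simp [Matrix.SpecialLinearGroup.SL2_inv_expl]

theorem sl_mul_apply (g h : SL(2, ℝ)) (i j : Fin 2) :
    (g * h) i j = g i 0 * h 0 j + g i 1 * h 1 j := by
  simp [Matrix.mul_apply, Fin.sum_univ_two]

/-- An indefinite binary form is a positive multiple of `x y` in suitable coordinates. -/
theorem exists_formAct_eq {q : ℝ × ℝ × ℝ} (hq : 0 < formDisc q) :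
    ∃ (v : SL(2, ℝ)) (l : ℝ), 0 < l ∧ formAct q v = (0, l, 0) := by
  obtain ⟨a, b, c⟩ := q
  suffices H : ∃ (v : SL(2, ℝ)) (l : ℝ), l ≠ 0 ∧ formAct (a, b, c) v = (0, l, 0) by
    obtain ⟨v, l, hl, hv⟩ := H
    rcases lt_or_gt_of_ne hl with h | h
    · refine ⟨v * slMk 0 (-1) 1 0 (by norm_num), -l, by linarith, ?_⟩
      rw [formAct_mul, hv]
      simp [formAct]
    · exact ⟨v, l, h, hv⟩
  simp only [formDisc] at hq
  by_cases ha : a = 0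
  · subst ha
    have hb : b ≠ 0 := by rintro rfl; simp at hq
    refine ⟨slMk 1 (-c / b) 0 1 (by ring), b, hb, ?_⟩
    simp only [formAct, slMk_00, slMk_01, slMk_10, slMk_11, Prod.mk.injEq]
    refine ⟨by ring, by ring, by field_simp; ring⟩
  · have hs := Real.sqrt_pos.2 hq
    have hs2 := Real.sq_sqrt hq.le
    set D := √(b ^ 2 - 4 * a * c)
    -- The columns are the boundary vectors of the two roots, the first scaled by a/D to make the
    -- determinant one. The new form vanishes at ∞ and 0.
    refine ⟨slMk ((-b + D) / (2 * a) * (a / D)) ((-b - D) / (2 * a)) (a / D) 1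
      (by field_simp; ring), -D, by linarith, ?_⟩
    simp only [formAct, slMk_00, slMk_01, slMk_10, slMk_11, Prod.mk.injEq]
    refine ⟨?_, ?_, ?_⟩
    · field_simp; linear_combination a * hs2
    · field_simp; linear_combination hs2
    · field_simp; linear_combination hs2

theorem formBdry_xy (l x y : ℝ) : formBdry (0, l, 0) x y = l * x * y := by simp [formBdry]

/-- A matrix with `|trace| < 2` fixes a point of `ℍ`. -/
theorem exists_fixed_of_trace (g : SL(2, ℝ)) (hc : g 1 0 ≠ 0) (h : (g 0 0 + g 1 1) ^ 2 < 4) :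
    ∃ z : ℍ, g • z = z := by
  have hdet := sl_det g
  -- The fixed point is a root of cz² + (d − a)z − b. Half the sum and the product of the conjugate
  -- roots are its coordinates Re z and |z|².
  obtain ⟨z, hz⟩ := exists_klein (x := (g 0 0 - g 1 1) / (2 * g 1 0)) (w := -g 0 1 / g 1 0) (by
    have e : -g 0 1 / g 1 0 = -4 * g 0 1 * g 1 0 / (2 * g 1 0) ^ 2 := by field_simp; ring
    rw [div_pow, e]
    exact div_lt_div_of_pos_right (by nlinarith) (by positivity))
  rw [klein, Prod.mk.injEq] at hz
  have h1 : autFactor g z = 1 := by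
    rw [autFactor, hz.1, hz.2]; field_simp; linear_combination hdet
  have h2 := re_smul_mul g z
  have h3 := normSq_smul_mul g z
  rw [h1, mul_one, hz.1, hz.2] at h2 h3
  refine ⟨z, klein_injective ?_⟩
  rw [klein, klein, h2, h3, hz.1, hz.2, Prod.mk.injEq]
  constructor
  · field_simp; linear_combination (g 0 0 - g 1 1) * hdet
  · field_simp; linear_combination (-g 0 1) * hdet

theorem pos_of_mul_pos_same {a c d : ℝ} (had : 0 < a * d) (hc : c ≠ 0) (h : 0 < c * d) :
    0 < a * c := by
  have : 0 < (a * c) * (c * d) := by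
    have := mul_pos had (pow_pos (abs_pos.2 hc) 2)
    rw [sq_abs] at this
    linarith
  exact (pos_iff_pos_of_mul_pos this).2 h

theorem pos_of_mul_pos_same' {a b d : ℝ} (had : 0 < a * d) (hb : b ≠ 0) (h : 0 < a * b) :
    0 < b * d := by
  have := pos_of_mul_pos_same (a := d) (d := a) (by linarith) hb (by linarith)
  linarith

/-- Two half-lines, with the same direction, which are cut to the same segment by conditions that
do not affect their endpoints, are equal. -/
theorem sq_eq_sq_of_halfLines {a b c d α δ α' δ' W : ℝ} (ha : a ≠ 0) (hb : b ≠ 0) (hc : c ≠ 0)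
    (hd : d ≠ 0) (had : 0 < a * d) (hbc : b * c < 0) (hW : 0 < W)
    (hf : 0 ≤ c * d * W + a * b ∧ 0 ≤ α * W + δ) (hg : 0 ≤ a * c * W + b * d ∧ 0 ≤ α' * W + δ')
    (hiff : ∀ W : ℝ, 0 < W → ((0 ≤ c * d * W + a * b ∧ 0 ≤ α * W + δ) ↔
      (0 ≤ a * c * W + b * d ∧ 0 ≤ α' * W + δ')))
    (hα : 0 < c * d → α ≤ 0) (hα' : 0 < c * d → α' ≤ 0) (hδ : 0 < a * b → δ ≤ 0)
    (hδ' : 0 < a * b → δ' ≤ 0) : a ^ 2 = d ^ 2 := by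
  have hcd0 : c * d ≠ 0 := mul_ne_zero hc hd
  have hac0 : a * c ≠ 0 := mul_ne_zero ha hc
  have hW₀ : c * d * (-(a * b) / (c * d)) = -(a * b) := mul_div_cancel₀ _ hcd0
  have hW₁ : a * c * (-(b * d) / (a * c)) = -(b * d) := mul_div_cancel₀ _ hac0
  set W₀ := -(a * b) / (c * d)
  set W₁ := -(b * d) / (a * c)
  -- W₀ and W₁ are the endpoints of the two half-lines. The value of each affine function at the
  -- endpoint of the other is bc(d² − a²) or bc(a² − d²), up to a factor whose sign is known. If
  -- each half-line contains the endpoint of the other, then a² = d².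
  have e0 : (a * c * W₀ + b * d) * (c * d) = b * c * (d ^ 2 - a ^ 2) := by
    linear_combination (a * c) * hW₀
  have e1 : (c * d * W₁ + a * b) * (a * c) = b * c * (a ^ 2 - d ^ 2) := by
    linear_combination (c * d) * hW₁
  have hneg : (a * b) * (c * d) < 0 := by
    have := mul_neg_of_pos_of_neg had hbc; linarith
  have hle : ∀ x y : ℝ, 0 ≤ b * c * (x - y) → x ≤ y := fun x y h => by
    by_contra! hcon
    have := mul_neg_of_neg_of_pos hbc (sub_pos.2 hcon); linarith
  have hmono : ∀ x u v : ℝ, 0 < x → x * u ≤ x * v → u ≤ v := fun x u v hx h =>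
    le_of_mul_le_mul_left h hx
  have hanti : ∀ x u v : ℝ, x < 0 → x * u ≤ x * v → v ≤ u := fun x u v hx h =>
    (mul_le_mul_left_of_neg hx).1 h
  have hlin : ∀ x y u v : ℝ, 0 ≤ x * u + y → 0 ≤ x * (v - u) → 0 ≤ x * v + y :=
    fun x y u v h1 h2 => by linarith
  have hnn : ∀ y x : ℝ, 0 ≤ x * W + y → y ≤ 0 → 0 ≤ x := fun y x h1 h2 =>
    nonneg_of_mul_nonneg_left (by linarith : 0 ≤ x * W) hW
  rcases lt_or_gt_of_ne hcd0 with hcd | hcd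
  · have hab : 0 < a * b := by
      rcases mul_neg_iff.1 hneg with h | h
      · exact h.1
      · linarith [h.2]
    have hbd : 0 < b * d := pos_of_mul_pos_same' had hb hab
    have hac : a * c < 0 := by
      rcases lt_or_gt_of_ne hac0 with h | h
      · exact h
      · have := pos_of_mul_pos_same (a := d) (d := a) (by linarith) hc (by linarith)
        linarith
    have l0 : W ≤ W₀ := hanti _ _ _ hcd (by linarith [hf.1])
    -- Both half-lines are bounded above here. The additional conditions have nonnegative slopes,
    -- hence they remain true from W up to the endpoints, so `hiff` may be applied there.
    have l1 : W ≤ W₁ := hanti _ _ _ hac (by linarith [hg.1])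
    have k0 := hnn _ _ hf.2 (hδ hab)
    have k1 := hnn _ _ hg.2 (hδ' hab)
    have r0 := ((hiff W₀ (hW.trans_le l0)).1 ⟨by linarith,
      hlin _ _ _ _ hf.2 (mul_nonneg k0 (sub_nonneg.2 l0))⟩).1
    have r1 := ((hiff W₁ (hW.trans_le l1)).2 ⟨by linarith,
      hlin _ _ _ _ hg.2 (mul_nonneg k1 (sub_nonneg.2 l1))⟩).1
    have m0 := mul_nonpos_of_nonneg_of_nonpos r0 hcd.le
    have m1 := mul_nonpos_of_nonneg_of_nonpos r1 hac.le
    rw [e0] at m0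
    rw [e1] at m1
    exact le_antisymm (hle _ _ (by linarith)) (hle _ _ (by linarith))
  · have hab : a * b < 0 := by
      rcases mul_neg_iff.1 hneg with h | h
      · linarith [h.2]
      · exact h.1
    have hac := pos_of_mul_pos_same had hc hcd
    have hbd : b * d < 0 := by
      rcases lt_or_gt_of_ne (mul_ne_zero hb hd) with h | h
      · exact h
      · have := pos_of_mul_pos_same' (a := d) (d := a) (by linarith) hb (by linarith)
        linarith
    have l0 : W₀ ≤ W := hmono _ _ _ hcd (by linarith [hf.1])
    have l1 : W₁ ≤ W := hmono _ _ _ hac (by linarith [hg.1])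
    have p0 : 0 < W₀ := pos_of_mul_pos_right (by linarith : 0 < c * d * W₀) hcd.le
    have p1 : 0 < W₁ := pos_of_mul_pos_right (by linarith : 0 < a * c * W₁) hac.le
    have r0 := ((hiff W₀ p0).1 ⟨by linarith,
      hlin _ _ _ _ hf.2 (mul_nonneg_of_nonpos_of_nonpos (hα hcd) (sub_nonpos.2 l0))⟩).1
    have r1 := ((hiff W₁ p1).2 ⟨by linarith,
      hlin _ _ _ _ hg.2 (mul_nonneg_of_nonpos_of_nonpos (hα' hcd) (sub_nonpos.2 l1))⟩).1
    have m0 := mul_nonneg r0 hcd.le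
    have m1 := mul_nonneg r1 hac.le
    rw [e0] at m0
    rw [e1] at m1
    exact le_antisymm (hle _ _ m1) (hle _ _ m0)

/-! ### The common ideal point of the paired sides. -/

namespace TriangleTile

variable {Γ : Subgroup PSL(2, ℝ)} {P : Set ℍ} {g s : SL(2, ℝ)} {q₁ q₂ q₃ : ℝ × ℝ × ℝ}

/-- Where the first two forms are positive, finite area makes the third nonpositive, and this
persists in the limit. It controls q₃ at boundary points at which one of the other forms vanishes.
-/
theorem formBdry_nonpos_of_limit (h : TriangleTile Γ P g s q₁ q₂ q₃) {x y x' y' : ℝ}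
    (h1 : ∀ᶠ ε in nhdsWithin (0 : ℝ) (Set.Ioi 0), 0 < formBdry q₁ (x + ε * x') (y + ε * y'))
    (h2 : ∀ᶠ ε in nhdsWithin (0 : ℝ) (Set.Ioi 0), 0 < formBdry q₂ (x + ε * x') (y + ε * y')) :
    formBdry q₃ x y ≤ 0 := by
  have hc : Continuous fun ε : ℝ => formBdry q₃ (x + ε * x') (y + ε * y') := by
    unfold formBdry; fun_prop
  have ht := hc.continuousAt.tendsto.mono_left
    (nhdsWithin_le_nhds : nhdsWithin (0 : ℝ) (Set.Ioi 0) ≤ nhds 0)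
  simp only [zero_mul, add_zero] at ht
  refine le_of_tendsto ht ?_
  filter_upwards [h1, h2] with ε e1 e2
  have hne : x + ε * x' ≠ 0 ∨ y + ε * y' ≠ 0 := by
    by_contra! hcon
    rw [hcon.1, hcon.2] at e1
    simp [formBdry] at e1
  rcases h.star _ _ hne with h | h | h
  · linarith
  · linarith
  · exact h

theorem eventually_formBdry_pos {q : ℝ × ℝ × ℝ} {x y : ℝ} (h : 0 < formBdry q x y) (x' y' : ℝ) :
    ∀ᶠ ε in nhdsWithin (0 : ℝ) (Set.Ioi 0), 0 < formBdry q (x + ε * x') (y + ε * y') := by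
  have hc : Continuous fun ε : ℝ => formBdry q (x + ε * x') (y + ε * y') := by
    unfold formBdry; fun_prop
  refine nhdsWithin_le_nhds (hc.continuousAt.eventually (lt_mem_nhds ?_))
  simpa using h

theorem eq_of_act_g (h : TriangleTile Γ P g s q₁ q₂ q₃) : q₂ = -formAct q₁ g⁻¹ := by
  have := congrArg (fun q => formAct q g⁻¹) h.act_g
  simp only [← formAct_mul, mul_inv_cancel, formAct_one, formAct_neg] at this
  exact this

/-- The two sides paired by `g` have an ideal point in common, fixed by `g`. -/
theorem offDiag_eq_zero {l : ℝ} (hl : 0 < l)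
    (h : TriangleTile Γ P g s (0, l, 0) q₂ q₃) : g 0 1 = 0 ∨ g 1 0 = 0 := by
  by_contra! hbc
  obtain ⟨hb, hc⟩ := hbc
  -- A smaller trace would make g elliptic.
  have htr : 4 ≤ (g 0 0 + g 1 1) ^ 2 := by
    by_contra! hcon
    obtain ⟨z, hz⟩ := exists_fixed_of_trace g hc hcon
    exact h.not_fixed z hz
  have hdet := sl_det g
  have hq2 : q₂ = (l * (g 1 0 * g 1 1), -(l * (g 0 0 * g 1 1 + g 0 1 * g 1 0)),
      l * (g 0 0 * g 0 1)) := by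
    rw [h.eq_of_act_g]
    simp only [formAct, sl_inv_00, sl_inv_01, sl_inv_10, sl_inv_11, Prod.neg_mk, Prod.mk.injEq]
    refine ⟨by ring, by ring, by ring⟩
  obtain ⟨α, β, δ⟩ := q₃
  have hd3 := h.disc₃
  have hmem0 : ∀ z : ℍ, z.re = 0 → (z ∈ P ↔
      0 ≤ g 1 0 * g 1 1 * Complex.normSq (z : ℂ) + g 0 0 * g 0 1 ∧
      0 ≤ α * Complex.normSq (z : ℂ) + δ) := by
    intro z hz
    rw [h.region, hq2]
    simp only [formEval, hz]
    have e : l * (g 1 0 * g 1 1) * Complex.normSq (z : ℂ) +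
      -(l * (g 0 0 * g 1 1 + g 0 1 * g 1 0)) * 0 + l * (g 0 0 * g 0 1) =
      l * (g 1 0 * g 1 1 * Complex.normSq (z : ℂ) + g 0 0 * g 0 1) := by ring
    rw [e, mul_nonneg_iff_of_pos_left hl]
    simp
  have hmem1 : ∀ z : ℍ, z.re = 0 → (g • z ∈ P ↔
      0 ≤ g 0 0 * g 1 0 * Complex.normSq (z : ℂ) + g 0 1 * g 1 1 ∧
      0 ≤ formBdry (α, β, δ) (g 0 0) (g 1 0) * Complex.normSq (z : ℂ) +
        formBdry (α, β, δ) (g 0 1) (g 1 1)) := by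
    intro z hz
    have hz2 : formEval q₂ (g • z) = 0 := by
      rw [formEval_smul_eq_zero, h.act_g]; simp [formEval, hz]
    rw [h.region, hz2, formEval_smul_nonneg, formEval_smul_nonneg]
    simp only [formEval, formAct, hz, formBdry]
    have e : ∀ N : ℝ, (0 * g 0 0 ^ 2 + l * g 0 0 * g 1 0 + 0 * g 1 0 ^ 2) * N +
      (2 * 0 * g 0 0 * g 0 1 + l * (g 0 0 * g 1 1 + g 0 1 * g 1 0) + 2 * 0 * g 1 0 * g 1 1) * 0 +
      (0 * g 0 1 ^ 2 + l * g 0 1 * g 1 1 + 0 * g 1 1 ^ 2) =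
      l * (g 0 0 * g 1 0 * N + g 0 1 * g 1 1) := fun N => by ring
    rw [e, mul_nonneg_iff_of_pos_left hl]
    simp
  -- The first side lies on the imaginary axis, parametrised by W = |z|². That g carries this side
  -- exactly onto the second one becomes an equivalence of two systems of linear inequalities in W.
  have hiff : ∀ W : ℝ, 0 < W → ((0 ≤ g 1 0 * g 1 1 * W + g 0 0 * g 0 1 ∧ 0 ≤ α * W + δ) ↔
      (0 ≤ g 0 0 * g 1 0 * W + g 0 1 * g 1 1 ∧
      0 ≤ formBdry (α, β, δ) (g 0 0) (g 1 0) * W + formBdry (α, β, δ) (g 0 1) (g 1 1))) := by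
    intro W hW
    obtain ⟨z, hz⟩ := exists_klein (x := 0) (w := W) (by simpa using hW)
    rw [klein, Prod.mk.injEq] at hz
    rw [← hz.2, ← hmem0 z hz.1, ← hmem1 z hz.1]
    exact h.map_side z (by simp [formEval, hz.1])
  obtain ⟨W, W', hW, hWW, hf, hf'⟩ : ∃ W W' : ℝ, 0 < W ∧ W < W' ∧
      (0 ≤ g 1 0 * g 1 1 * W + g 0 0 * g 0 1 ∧ 0 ≤ α * W + δ) ∧
      (0 ≤ g 1 0 * g 1 1 * W' + g 0 0 * g 0 1 ∧ 0 ≤ α * W' + δ) := by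
    obtain ⟨z, w, hzw, hz, hw, hz1, hw1⟩ := h.side
    have hz0 : z.re = 0 := by simpa [formEval, hl.ne'] using hz1
    have hw0 : w.re = 0 := by simpa [formEval, hl.ne'] using hw1
    have hpz := re_sq_lt_normSq z
    have hpw := re_sq_lt_normSq w
    rw [hz0] at hpz
    rw [hw0] at hpw
    have hne : Complex.normSq (z : ℂ) ≠ Complex.normSq (w : ℂ) := fun e =>
      hzw (klein_injective (by simp [klein, hz0, hw0, e]))
    rw [hmem0 z hz0] at hz
    rw [hmem0 w hw0] at hw
    rcases lt_or_gt_of_ne hne with h | h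
    · exact ⟨_, _, by simpa using hpz, h, hz, hw⟩
    · exact ⟨_, _, by simpa using hpw, h, hw, hz⟩
  have hW' : 0 < W' := hW.trans hWW
  have hg := (hiff W hW).1 hf
  have hg' := (hiff W' hW').1 hf'
  have hα : 0 < g 1 0 * g 1 1 → α ≤ 0 := fun hp => by
    have := h.formBdry_nonpos_of_limit (x := 1) (y := 0) (x' := 0) (y' := 1)
      (by filter_upwards [self_mem_nhdsWithin] with ε hε
          rw [formBdry_xy]; simp only [Set.mem_Ioi] at hε; simp; positivity)
      (eventually_formBdry_pos (by rw [hq2]; simp only [formBdry]; nlinarith) _ _)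
    simpa [formBdry] using this
  have hδ : 0 < g 0 0 * g 0 1 → δ ≤ 0 := fun hp => by
    have := h.formBdry_nonpos_of_limit (x := 0) (y := 1) (x' := 1) (y' := 0)
      (by filter_upwards [self_mem_nhdsWithin] with ε hε
          rw [formBdry_xy]; simp only [Set.mem_Ioi] at hε; simp; positivity)
      (eventually_formBdry_pos (by rw [hq2]; simp only [formBdry]; nlinarith) _ _)
    simpa [formBdry] using this
  -- The vector (g 0 0, g 1 0) represents g∞, an end of the second side, where q₂ vanishes. The
  -- displacement by ε(g 1 0, 0) makes q₂ positive, and q₁ is positive there already.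
  have hα' : 0 < g 1 0 * g 1 1 → 0 < g 0 0 * g 1 0 →
      formBdry (α, β, δ) (g 0 0) (g 1 0) ≤ 0 := fun hp hp' => by
    refine h.formBdry_nonpos_of_limit (x' := g 1 0) (y' := 0)
      (eventually_formBdry_pos (by rw [formBdry_xy, mul_assoc]; positivity) _ _) ?_
    filter_upwards [self_mem_nhdsWithin] with ε hε
    simp only [Set.mem_Ioi] at hε
    have e : formBdry q₂ (g 0 0 + ε * g 1 0) (g 1 0 + ε * 0) =
        l * (1 + g 1 0 * g 1 1 * ε) * g 1 0 ^ 2 * ε := by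
      rw [hq2]; simp only [formBdry]
      linear_combination (l * ε * g 1 0 ^ 2) * hdet
    rw [e]
    positivity
  have hδ' : 0 < g 0 0 * g 0 1 → 0 < g 0 1 * g 1 1 →
      formBdry (α, β, δ) (g 0 1) (g 1 1) ≤ 0 := fun hp hp' => by
    refine h.formBdry_nonpos_of_limit (x' := 0) (y' := g 0 1)
      (eventually_formBdry_pos (by rw [formBdry_xy, mul_assoc]; positivity) _ _) ?_
    filter_upwards [self_mem_nhdsWithin] with ε hε
    simp only [Set.mem_Ioi] at hε
    have e : formBdry q₂ (g 0 1 + ε * 0) (g 1 1 + ε * g 0 1) =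
        l * (1 + g 0 0 * g 0 1 * ε) * g 0 1 ^ 2 * ε := by
      rw [hq2]; simp only [formBdry]
      linear_combination (l * ε * g 0 1 ^ 2) * hdet
    rw [e]
    positivity
  have ha : g 0 0 ≠ 0 := by
    intro ha
    rw [ha] at hdet htr hf hg
    have hd : 0 < g 1 1 ^ 2 := by nlinarith
    have h1 : 0 ≤ g 1 0 * g 1 1 := by
      have := hf.1; rw [zero_mul, add_zero] at this; exact nonneg_of_mul_nonneg_left this hW
    have h2 : 0 ≤ g 0 1 * g 1 1 := by simpa using hg.1
    nlinarith [mul_nonneg h1 h2]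
  have hd : g 1 1 ≠ 0 := by
    intro hd
    rw [hd] at hdet htr hf hg
    have ha2 : 0 < g 0 0 ^ 2 := by positivity
    have h1 : 0 ≤ g 0 0 * g 1 0 := by
      have := hg.1; rw [mul_zero, add_zero] at this; exact nonneg_of_mul_nonneg_left this hW
    have h2 : 0 ≤ g 0 0 * g 0 1 := by simpa using hf.1
    nlinarith [mul_nonneg h1 h2]
  have key : ∀ x y : ℝ, 0 < x * y → 0 ≤ x * W + y → 0 < x ∧ 0 < y := by
    intro x y hxy hn
    rcases pos_and_pos_or_neg_and_neg_of_mul_pos hxy with h | h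
    · exact h
    · nlinarith [mul_neg_of_neg_of_pos h.1 hW]
  have hab0 : g 0 0 * g 0 1 ≠ 0 := mul_ne_zero ha hb
  have hcd0 : g 1 0 * g 1 1 ≠ 0 := mul_ne_zero hc hd
  -- The product is negative when the second side's line meets the imaginary axis, which makes a
  -- half-line of the axis satisfy q₂ ≥ 0. It is positive when the line is disjoint from the axis.
  rcases lt_or_gt_of_ne (mul_ne_zero hcd0 hab0) with hs | hs
  · have had : 0 < g 0 0 * g 1 1 ∧ g 0 1 * g 1 0 < 0 := by
      have e : g 1 0 * g 1 1 * (g 0 0 * g 0 1) = (g 0 0 * g 1 1) * (g 0 1 * g 1 0) := by ring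
      rw [e] at hs
      rcases mul_neg_iff.1 hs with h | h
      · exact h
      · linarith [h.1, h.2]
    -- If a = d, then the trace bound gives a² ≥ 1, whereas a² = 1 + bc < 1. If a = −d, then ad is
    -- not positive.
    have hfin : ¬ g 0 0 ^ 2 = g 1 1 ^ 2 := by
      intro e
      rcases sq_eq_sq_iff_eq_or_eq_neg.1 e with e | e
      · rw [e] at hdet htr; nlinarith
      · rw [e] at had; nlinarith [sq_nonneg (g 1 1)]
    exact hfin (sq_eq_sq_of_halfLines ha hb hc hd had.1 had.2 hW hf hg hiff hα
      (fun h => hα' h (pos_of_mul_pos_same had.1 hc h)) hδ (fun h => hδ' h (pos_of_mul_pos_same' had.1 hb h)))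
  -- Now 0 and ∞ are both strictly inside the second half-plane. This forces q₃ to be a positive
  -- multiple of xy, like q₁, and then all three forms are positive at boundary points slightly to
  -- the right of 0, contrary to `star`.
  · obtain ⟨hcd, hab⟩ := key _ _ hs hf.1
    have hα0 := hα hcd
    have hδ0 := hδ hab
    have e1 : α = 0 := by
      nlinarith [hf.2, mul_nonpos_of_nonpos_of_nonneg hα0 hW.le]
    have e2 : δ = 0 := by rw [e1] at hf; linarith [hf.2]
    subst e1 e2
    obtain ⟨z, h1, h2, h3⟩ := h.inner
    have hz : 0 < z.re := by
      simp only [formEval, zero_mul, zero_add, add_zero] at h1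
      exact (pos_iff_pos_of_mul_pos h1).1 hl
    have hβ : 0 < β := by
      simp only [formEval, zero_mul, zero_add, add_zero] at h3
      exact (pos_iff_pos_of_mul_pos h3).2 hz
    obtain ⟨ε, e1, e2⟩ := ((eventually_formBdry_pos (q := q₂) (x := 0) (y := 1)
      (by rw [hq2]; simp only [formBdry]; nlinarith) 1 0).and self_mem_nhdsWithin).exists
    replace e2 : 0 < ε := e2
    rcases h.star (0 + ε * 1) (1 + ε * 0) (by right; simp) with h | h | h
    · rw [formBdry_xy] at h
      have : 0 < l * (0 + ε * 1) * (1 + ε * 0) := by simp; positivity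
      linarith
    · linarith
    · rw [formBdry_xy] at h
      have : 0 < β * (0 + ε * 1) * (1 + ε * 0) := by simp; positivity
      linarith

end TriangleTile

/-! ### The cusp -/

/-- Such a g is z ↦ a²z + ab, a homothety about ab/(1 − a²) with ratio a². -/
theorem coe_pow_smul_of_affine {g : SL(2, ℝ)} (hc : g 1 0 = 0) (h1 : g 0 0 ^ 2 ≠ 1) (n : ℕ)
    (z : ℍ) : ((g ^ n • z : ℍ) : ℂ) = ((g 0 0 * g 0 1 / (1 - g 0 0 ^ 2) : ℝ) : ℂ) +
      ((g 0 0 ^ 2) ^ n : ℝ) * (z - ((g 0 0 * g 0 1 / (1 - g 0 0 ^ 2) : ℝ) : ℂ)) := by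
  have hdet := sl_det g
  rw [hc, mul_zero, sub_zero] at hdet
  have hd : g 1 1 ≠ 0 := right_ne_zero_of_mul_eq_one hdet
  have h2 : 1 - g 0 0 ^ 2 ≠ 0 := sub_ne_zero.2 h1.symm
  induction n with
  | zero => simp
  | succ n ih =>
    have hinv : ∀ w : ℂ, ((g 0 0 : ℂ) * w + g 0 1) / ((g 1 0 : ℂ) * z + g 1 1) =
        (g 0 0 : ℂ) * ((g 0 0 : ℂ) * w + g 0 1) := by
      intro w
      have hdet' : (g 0 0 : ℂ) * g 1 1 = 1 := by exact_mod_cast hdet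
      have hd' : (g 1 1 : ℂ) ≠ 0 := by exact_mod_cast hd
      rw [hc]
      simp only [Complex.ofReal_zero, zero_mul, zero_add]
      rw [div_eq_iff hd']
      linear_combination (-(g 0 0 * w + g 0 1)) * hdet'
    rw [pow_succ', mul_smul, sl_coe_smul, ih]
    rw [hc] at hinv ⊢
    simp only [Complex.ofReal_zero, zero_mul] at hinv ⊢
    rw [hinv]
    have h2' : (1 : ℂ) - (g 0 0 : ℂ) ^ 2 ≠ 0 := by exact_mod_cast h2
    push_cast
    field_simp
    ring

/-- Were g a contraction with ratio k < 1, its powers would bring points of P far up in the cusp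
down to bounded height. Infinitely many distinct tiles would then accumulate at the point ξ + i. -/
theorem not_sq_lt_one_of_cusp {Γ : Subgroup PSL(2, ℝ)} {P : Set ℍ} (hT : IsFundamentalTile Γ P)
    {g : SL(2, ℝ)} (hg : (QuotientGroup.mk g : PSL(2, ℝ)) ∈ Γ) (hc : g 1 0 = 0) {x M : ℝ}
    (hline : ∀ z : ℍ, z.re = x → M ≤ Complex.normSq (z : ℂ) → z ∈ P) : ¬ g 0 0 ^ 2 < 1 := by
  intro hlt
  have hdet := sl_det g
  rw [hc, mul_zero, sub_zero] at hdet
  have ha : g 0 0 ≠ 0 := left_ne_zero_of_mul_eq_one hdet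
  have hk : 0 < g 0 0 ^ 2 := by positivity
  have hpow := coe_pow_smul_of_affine hc hlt.ne
  set k := g 0 0 ^ 2
  set ξ := g 0 0 * g 0 1 / (1 - k)
  -- The height k⁻ⁿ is chosen so that gⁿ moves the n-th point to height exactly 1.
  let z : ℕ → ℍ := fun n => ⟨⟨x, (k⁻¹) ^ n⟩, by positivity⟩
  have hcoe : ∀ n, ((g ^ n • z n : ℍ) : ℂ) = ⟨ξ + k ^ n * (x - ξ), 1⟩ := by
    intro n
    have hkn : k ^ n * k⁻¹ ^ n = 1 := by rw [← mul_pow, mul_inv_cancel₀ hk.ne', one_pow]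
    rw [hpow]
    apply Complex.ext
    · simp [z, Complex.add_re, Complex.mul_re, -Complex.ofReal_pow]
    · simp [z, Complex.add_im, Complex.mul_im, -Complex.ofReal_pow, -inv_pow]
      exact hkn
  have hlim : Filter.Tendsto (fun n => g ^ n • z n) Filter.atTop
      (nhds (⟨⟨ξ, 1⟩, one_pos⟩ : ℍ)) := by
    rw [UpperHalfPlane.isOpenEmbedding_coe.isEmbedding.tendsto_nhds_iff]
    have h1 : Filter.Tendsto (fun n : ℕ => (⟨ξ + k ^ n * (x - ξ), 1⟩ : ℂ)) Filter.atTop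
        (nhds ⟨ξ + 0 * (x - ξ), 1⟩) := by
      have e : ∀ y : ℝ, (⟨y, 1⟩ : ℂ) = (y : ℂ) + Complex.I := fun y => by
        apply Complex.ext <;> simp
      simp only [e]
      refine Filter.Tendsto.add_const _ ((Complex.continuous_ofReal.tendsto _).comp ?_)
      exact ((tendsto_pow_atTop_nhds_zero_of_lt_one hk.le hlt).mul_const _).const_add _
    rw [zero_mul, add_zero] at h1
    exact h1.congr fun n => (hcoe n).symm
  obtain ⟨U, hU, hfin⟩ := finite_tiles_near hT (⟨⟨ξ, 1⟩, one_pos⟩ : ℍ)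
  have hev : ∀ᶠ n in Filter.atTop, z n ∈ P := by
    have h1 := tendsto_pow_atTop_atTop_of_one_lt ((one_lt_inv₀ hk).2 hlt)
    filter_upwards [h1.eventually_ge_atTop (max M 1)] with n hn
    refine hline _ rfl ?_
    have h2 : M ≤ k⁻¹ ^ n := (le_max_left _ _).trans hn
    have h3 : 1 ≤ k⁻¹ ^ n := (le_max_right _ _).trans hn
    have h4 : Complex.normSq (z n : ℂ) = x ^ 2 + (k⁻¹ ^ n) ^ 2 := normSq_eq (z n)
    rw [h4]
    nlinarith [sq_nonneg x]
  obtain ⟨N, hN⟩ := Filter.eventually_atTop.1 (hev.and (hlim.eventually_mem hU))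
  refine Set.infinite_of_injective_forall_mem (f := fun n : ℕ =>
    (QuotientGroup.mk (g ^ (N + n)) : PSL(2, ℝ))) ?_ ?_ hfin
  · intro n m hnm
    have h1 : (g ^ (N + n) • z 0 : ℍ) = g ^ (N + m) • z 0 := by
      rw [← psl_mk_smul, ← psl_mk_smul]
      exact congrArg (fun y : PSL(2, ℝ) => y • z 0) hnm
    have h2 := congrArg (fun w : ℍ => (w : ℂ).im) h1
    simp only [hpow] at h2
    simp [z, Complex.add_im, Complex.mul_im, -Complex.ofReal_pow] at h2
    have := (pow_right_strictAnti₀ hk hlt).injective h2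
    omega
  · intro n
    obtain ⟨h1, h2⟩ := hN (N + n) (by omega)
    refine ⟨?_, g ^ (N + n) • z (N + n), ?_, h2⟩
    · rw [QuotientGroup.mk_pow]; exact Γ.pow_mem hg _
    · rw [mem_mk_smul_iff, inv_smul_smul]; exact h1

/-- An element fixing the cusp of a fundamental tile is a translation. -/
theorem sq_eq_one_of_cusp {Γ : Subgroup PSL(2, ℝ)} {P : Set ℍ} (hT : IsFundamentalTile Γ P)
    {g : SL(2, ℝ)} (hg : (QuotientGroup.mk g : PSL(2, ℝ)) ∈ Γ) (hc : g 1 0 = 0) {x M : ℝ}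
    (hline : ∀ z : ℍ, z.re = x → M ≤ Complex.normSq (z : ℂ) → z ∈ P) : g 0 0 ^ 2 = 1 := by
  have h1 := not_sq_lt_one_of_cusp hT hg hc hline
  have h2 := not_sq_lt_one_of_cusp hT (g := g⁻¹) (Γ.inv_mem hg) (by rw [sl_inv_10, hc, neg_zero])
    hline
  rw [sl_inv_00] at h2
  have hdet := sl_det g
  rw [hc, mul_zero, sub_zero] at hdet
  have h3 : g 0 0 ^ 2 * g 1 1 ^ 2 = 1 := by rw [← mul_pow, hdet, one_pow]
  nlinarith

/-- The translation `z ↦ z + 1`. -/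
def transSL : SL(2, ℝ) := slMk 1 1 0 1 (by norm_num)

theorem transSL_smul_re (z : ℍ) : (transSL • z).re = z.re + 1 := by
  have := re_smul_mul transSL z
  simpa [transSL, autFactor] using this

theorem transSL_smul_im (z : ℍ) : (transSL • z).im = z.im := by
  have := im_smul_mul transSL z
  simpa [transSL, autFactor] using this

theorem transSL_inv_smul_re (z : ℍ) : (transSL⁻¹ • z).re = z.re - 1 := by
  have := transSL_smul_re (transSL⁻¹ • z)
  rw [smul_inv_smul] at this
  linarith

theorem transSL_inv_smul_im (z : ℍ) : (transSL⁻¹ • z).im = z.im := by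
  have := transSL_smul_im (transSL⁻¹ • z)
  rw [smul_inv_smul] at this
  exact this.symm

/-- The part of a vertical strip above the circle of radius `r`, as a fundamental tile for a group
containing the translation along the strip and a half-turn `s` of the circle. -/
structure StripTile (Γ : Subgroup PSL(2, ℝ)) (P : Set ℍ) (g s : SL(2, ℝ)) (r p t : ℝ) :
    Prop where
  tile : IsFundamentalTile Γ P
  region : ∀ z : ℍ, z ∈ P ↔ -(1 / 2) ≤ z.re ∧ z.re ≤ 1 / 2 ∧ r ^ 2 ≤ Complex.normSq (z : ℂ)
  r_pos : 0 < r
  r_sq : 1 / 4 ≤ r ^ 2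
  s_00 : s 0 0 = p
  s_01 : s 0 1 = -(r ^ 2 * t)
  s_10 : s 1 0 = t
  s_11 : s 1 1 = -p
  s_center : t * p * (4 * r ^ 2 - 1) = 0
  g_eq : (QuotientGroup.mk g : PSL(2, ℝ)) = QuotientGroup.mk transSL ∨
    (QuotientGroup.mk g : PSL(2, ℝ)) = (QuotientGroup.mk transSL)⁻¹
  g_mem : (QuotientGroup.mk g : PSL(2, ℝ)) ∈ Γ
  s_mem : (QuotientGroup.mk s : PSL(2, ℝ)) ∈ Γ

theorem map_conj_mul (Γ : Subgroup PSL(2, ℝ)) (u u' : SL(2, ℝ)) :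
    (Γ.map (MulAut.conj (QuotientGroup.mk u : PSL(2, ℝ))).toMonoidHom).map
      (MulAut.conj (QuotientGroup.mk u' : PSL(2, ℝ))).toMonoidHom =
    Γ.map (MulAut.conj (QuotientGroup.mk (u' * u) : PSL(2, ℝ))).toMonoidHom := by
  rw [Subgroup.map_map, QuotientGroup.mk_mul, map_mul]
  rfl

theorem conj_mul_mat (u u' g : SL(2, ℝ)) :
    u' * (u * g * u⁻¹) * u'⁻¹ = u' * u * g * (u' * u)⁻¹ := by group

namespace TriangleTile

variable {Γ : Subgroup PSL(2, ℝ)} {P : Set ℍ} {g s : SL(2, ℝ)} {q₁ q₂ q₃ : ℝ × ℝ × ℝ}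

theorem conj_conj {u : SL(2, ℝ)} (h : TriangleTile
      (Γ.map (MulAut.conj (QuotientGroup.mk u : PSL(2, ℝ))).toMonoidHom)
      ((QuotientGroup.mk u : PSL(2, ℝ)) • P) (u * g * u⁻¹) (u * s * u⁻¹) q₁ q₂ q₃)
    (u' : SL(2, ℝ)) : TriangleTile
      (Γ.map (MulAut.conj (QuotientGroup.mk (u' * u) : PSL(2, ℝ))).toMonoidHom)
      ((QuotientGroup.mk (u' * u) : PSL(2, ℝ)) • P) (u' * u * g * (u' * u)⁻¹)
      (u' * u * s * (u' * u)⁻¹) (formAct q₁ u'⁻¹) (formAct q₂ u'⁻¹) (formAct q₃ u'⁻¹) := by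
  have := h.conj u'
  rwa [map_conj_mul, conj_mul_mat, conj_mul_mat, ← mul_smul, ← QuotientGroup.mk_mul] at this

/-- Bring the first side to the imaginary axis. By `offDiag_eq_zero` the conjugated g fixes 0 or ∞,
and in the first case the rotation z ↦ −1/z moves 0 to ∞. -/
theorem exists_cusp (h : TriangleTile Γ P g s q₁ q₂ q₃) : ∃ (u : SL(2, ℝ)) (μ : ℝ) (q₂' q₃' : _),
    TriangleTile (Γ.map (MulAut.conj (QuotientGroup.mk u : PSL(2, ℝ))).toMonoidHom)
      ((QuotientGroup.mk u : PSL(2, ℝ)) • P) (u * g * u⁻¹) (u * s * u⁻¹) (0, μ, 0) q₂' q₃' ∧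
    (u * g * u⁻¹) 1 0 = 0 := by
  obtain ⟨v, l, hl, hv⟩ := exists_formAct_eq h.disc₁
  have h1 := h.conj v⁻¹
  rw [inv_inv] at h1
  rw [hv] at h1
  rcases h1.offDiag_eq_zero hl with h2 | h2
  · have h3 := h.conj v⁻¹
    rw [← inv_inv v] at hv
    rw [hv] at h3
    have h4 := h3.conj_conj (slMk 0 (-1) 1 0 (by norm_num))
    have e : formAct (0, l, 0) (slMk 0 (-1) 1 0 (by norm_num))⁻¹ = (0, -l, 0) := by
      simp [formAct, sl_inv_00, sl_inv_01, sl_inv_10, sl_inv_11]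
    rw [e] at h4
    refine ⟨_, -l, _, _, h4, ?_⟩
    rw [← conj_mul_mat, inv_inv]
    generalize v⁻¹ * g * v = x at h2
    simp [sl_mul_apply, sl_inv_00, sl_inv_10, h2]
  · exact ⟨v⁻¹, l, _, _, by rw [inv_inv]; exact h1, by rw [inv_inv]; exact h2⟩

/-- The first two sides are vertical here. Directly below an inner point the first two forms are
unchanged and hence positive, so the third is nonpositive at the real foot. It therefore increases
with height. -/
theorem fst_pos (h : TriangleTile Γ P g s q₁ q₂ q₃) (h1 : q₁.1 = 0) (h2 : q₂.1 = 0) :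
    0 < q₃.1 := by
  obtain ⟨z, e1, e2, e3⟩ := h.inner
  have hz := re_sq_lt_normSq z
  simp only [formEval, h1, h2] at e1 e2 e3
  rcases h.star z.re 1 (Or.inr one_ne_zero) with h | h | h
  · simp only [formBdry, h1] at h; linarith
  · simp only [formBdry, h2] at h; linarith
  · simp only [formBdry] at h; nlinarith

/-- If `g` fixes `∞`, then it is a translation along a strip. -/
theorem sq_eq_one {μ : ℝ} (h : TriangleTile Γ P g s (0, μ, 0) q₂ q₃) (hc : g 1 0 = 0) :
    g 0 0 ^ 2 = 1 ∧ q₂ = (0, -μ, μ * (g 0 0 * g 0 1)) ∧ 0 < μ * (g 0 0 * g 0 1) := by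
  have hdet := sl_det g
  rw [hc, mul_zero, sub_zero] at hdet
  have hq2 : q₂ = (0, -μ, μ * (g 0 0 * g 0 1)) := by
    rw [h.eq_of_act_g]
    simp only [formAct, sl_inv_00, sl_inv_01, sl_inv_10, sl_inv_11, hc, Prod.neg_mk,
      Prod.mk.injEq]
    refine ⟨by ring, by linear_combination (-μ) * hdet, by ring⟩
  have hα := h.fst_pos rfl (by rw [hq2])
  have hτ : 0 < μ * (g 0 0 * g 0 1) := by
    obtain ⟨z, e1, e2, e3⟩ := h.inner
    rw [hq2] at e2
    simp only [formEval] at e1 e2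
    linarith
  refine ⟨sq_eq_one_of_cusp h.tile h.g_mem hc (x := 0) (M := -q₃.2.2 / q₃.1) ?_, hq2, hτ⟩
  intro z hz hM
  rw [h.region, hq2]
  simp only [formEval, hz]
  rw [div_le_iff₀ hα] at hM
  refine ⟨by simp, by linarith, by linarith⟩

/-- The matrix is that of z ↦ ρ²z − σ/2. The scaling makes the translation length σ = ±1, and the
shift centres the strip at 0. -/
theorem exists_centered_aux {μ τ a : ℝ} (hτ : 0 < μ * τ) :
    ∃ (w : SL(2, ℝ)) (σ : ℝ), σ ^ 2 = 1 ∧ 0 < μ * σ ∧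
      formAct (0, μ, 0) w⁻¹ = (0, μ, μ * σ / 2) ∧ formAct (0, -μ, μ * τ) w⁻¹ = (0, -μ, μ * σ / 2) ∧
      ∀ g : SL(2, ℝ), g 1 0 = 0 → g 0 0 = a → g 1 1 = a → g 0 1 = τ * a →
        (w * g * w⁻¹) 0 0 = a ∧ (w * g * w⁻¹) 0 1 = σ * a ∧ (w * g * w⁻¹) 1 0 = 0 ∧
        (w * g * w⁻¹) 1 1 = a := by
  have hτ0 : τ ≠ 0 := by rintro rfl; simp at hτ
  have hab : 0 < |τ| := abs_pos.2 hτ0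
  obtain ⟨ρ, hρ, hρ2⟩ : ∃ ρ : ℝ, 0 < ρ ∧ ρ ^ 2 * |τ| = 1 :=
    ⟨√(|τ|⁻¹), Real.sqrt_pos.2 (by positivity), by
      rw [Real.sq_sqrt (by positivity), inv_mul_cancel₀ hab.ne']⟩
  obtain ⟨σ, hσ, hσ2⟩ : ∃ σ : ℝ, σ ^ 2 = 1 ∧ τ = σ * |τ| := by
    rcases abs_choice τ with h | h
    · exact ⟨1, by norm_num, by linarith⟩
    · exact ⟨-1, by norm_num, by linarith⟩
  have hτρ : ρ ^ 2 * τ = σ := by rw [hσ2]; linear_combination σ * hρ2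
  refine ⟨slMk ρ (-σ / (2 * ρ)) 0 (1 / ρ) (by field_simp; ring), σ, hσ, ?_, ?_, ?_, ?_⟩
  · rw [hσ2, ← mul_assoc] at hτ
    exact (pos_iff_pos_of_mul_pos hτ).2 hab
  · simp only [formAct, sl_inv_00, sl_inv_01, sl_inv_10, sl_inv_11, slMk_00, slMk_01, slMk_10,
      slMk_11, Prod.mk.injEq]
    refine ⟨by ring, by field_simp; ring, by field_simp; ring⟩
  · simp only [formAct, sl_inv_00, sl_inv_01, sl_inv_10, sl_inv_11, slMk_00, slMk_01, slMk_10,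
      slMk_11, Prod.mk.injEq]
    refine ⟨by ring, by field_simp; ring, ?_⟩
    field_simp
    linear_combination (4 * ρ ^ 2 * μ) * hτρ
  · intro g h10 h00 h11 h01
    simp only [sl_mul_apply, sl_inv_00, sl_inv_01, sl_inv_10, sl_inv_11, slMk_00, slMk_01,
      slMk_10, slMk_11, h10, h00, h11, h01]
    refine ⟨by field_simp; ring, ?_, by ring, by field_simp; ring⟩
    field_simp
    linear_combination (4 * ρ ^ 2 * a) * hτρ

theorem exists_centered (h : TriangleTile Γ P g s q₁ q₂ q₃) :
    ∃ (u : SL(2, ℝ)) (μ σ a : ℝ) (q₃' : _),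
    TriangleTile (Γ.map (MulAut.conj (QuotientGroup.mk u : PSL(2, ℝ))).toMonoidHom)
      ((QuotientGroup.mk u : PSL(2, ℝ)) • P) (u * g * u⁻¹) (u * s * u⁻¹)
      (0, μ, μ * σ / 2) (0, -μ, μ * σ / 2) q₃' ∧ σ ^ 2 = 1 ∧ 0 < μ * σ ∧ a ^ 2 = 1 ∧
      (u * g * u⁻¹) 0 0 = a ∧ (u * g * u⁻¹) 0 1 = σ * a ∧ (u * g * u⁻¹) 1 0 = 0 ∧
      (u * g * u⁻¹) 1 1 = a := by
  obtain ⟨u, μ, r₂, r₃, h1, hc⟩ := h.exists_cusp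
  obtain ⟨ha, hr2, hτ⟩ := h1.sq_eq_one hc
  have hdet := sl_det (u * g * u⁻¹)
  rw [hc, mul_zero, sub_zero] at hdet
  obtain ⟨w, σ, hσ, hμσ, e1, e2, e3⟩ := exists_centered_aux (a := (u * g * u⁻¹) 0 0) hτ
  have h2 := h1.conj_conj w
  rw [hr2, e1, e2] at h2
  have h3 := e3 _ hc rfl (by
    linear_combination (u * g * u⁻¹) 0 0 * hdet - (u * g * u⁻¹) 1 1 * ha)
    (by linear_combination -(u * g * u⁻¹) 0 1 * ha)
  rw [conj_mul_mat] at h3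
  exact ⟨_, μ, σ, _, _, h2, hσ, hμσ, ha, h3⟩

theorem stripTile {μ σ a : ℝ} (h : TriangleTile Γ P g s (0, μ, μ * σ / 2) (0, -μ, μ * σ / 2) q₃)
    (hσ : σ ^ 2 = 1) (hμ : 0 < μ * σ) (ha : a ^ 2 = 1) (h00 : g 0 0 = a) (h01 : g 0 1 = σ * a)
    (h10 : g 1 0 = 0) (h11 : g 1 1 = a) : ∃ r p t, StripTile Γ P g s r p t := by
  have hα := h.fst_pos rfl rfl
  obtain ⟨α, β, δ⟩ := q₃
  simp only at hα
  have hσ1 : σ = 1 ∨ σ = -1 := sq_eq_sq_iff_eq_or_eq_neg.1 (hσ.trans (one_pow 2).symm)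
  have hq12 : ∀ x : ℝ, (0 ≤ μ * x + μ * σ / 2 ∧ 0 ≤ -μ * x + μ * σ / 2) ↔
      -(1 / 2) ≤ x ∧ x ≤ 1 / 2 := by
    intro x
    rcases hσ1 with rfl | rfl
    · have hμ' : 0 < μ := by linarith
      constructor
      · rintro ⟨h1, h2⟩; constructor <;> nlinarith
      · rintro ⟨h1, h2⟩; constructor <;> nlinarith
    · have hμ' : μ < 0 := by linarith
      constructor
      · rintro ⟨h1, h2⟩; constructor <;> nlinarith
      · rintro ⟨h1, h2⟩; constructor <;> nlinarith
  have hregion : ∀ z, z ∈ P ↔ -(1 / 2) ≤ z.re ∧ z.re ≤ 1 / 2 ∧ 0 ≤ formEval (α, β, δ) z := by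
    intro z
    rw [h.region, ← and_assoc, ← and_assoc, ← hq12]
    simp only [formEval, zero_mul, zero_add]
  have hbd : ∀ x : ℝ, x ∈ Set.Ioo (-(1 / 2) : ℝ) (1 / 2) → α * x ^ 2 + β * x + δ ≤ 0 := by
    rintro x ⟨h1, h2⟩
    have h3 := h.star x 1 (Or.inr one_ne_zero)
    simp only [formBdry] at h3
    rcases h3 with h | h | h
    · rcases hσ1 with rfl | rfl <;> nlinarith
    · rcases hσ1 with rfl | rfl <;> nlinarith
    · linarith
  have hbd' : ∀ x ∈ Set.Icc (-(1 / 2) : ℝ) (1 / 2), α * x ^ 2 + β * x + δ ≤ 0 := by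
    intro x hx
    rw [← closure_Ioo (by norm_num)] at hx
    have hcl : IsClosed {x : ℝ | α * x ^ 2 + β * x + δ ≤ 0} :=
      isClosed_le (by fun_prop) continuous_const
    exact closure_minimal (fun y hy => hbd y hy) hcl hx
  have hb1 := hbd' (1 / 2) (by constructor <;> norm_num)
  have hb2 := hbd' (-(1 / 2)) (by constructor <;> norm_num)
  -- The two points at height √(−δ/α − 1/4) on the vertical sides are exchanged by g or its inverse.
  -- If β ≠ 0, the form q₃ has opposite signs at them, so one is in P and the other is not, against
  -- `map_side`.
  have hβ : β = 0 := by
    by_contra hβ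
    obtain ⟨z, hz⟩ := exists_klein (x := -σ / 2) (w := -δ / α) (by
      rw [lt_div_iff₀ hα]
      have e : (-σ / 2) ^ 2 = 1 / 4 := by rw [div_pow, neg_sq, hσ]; norm_num
      rw [e]
      rcases lt_or_gt_of_ne hβ with h | h <;> linarith)
    rw [klein, Prod.mk.injEq] at hz
    have h1 := h.map_side z (by simp only [formEval, hz.1]; ring)
    have e1 : (g • z).re = σ / 2 := by
      have := re_smul_mul g z
      simp only [autFactor, h10, h00, h01, h11, hz.1] at this
      linear_combination this + (σ / 2 - (g • z).re) * ha
    have e2 : (g • z).im = z.im := by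
      have := im_smul_mul g z
      simp only [autFactor, h10, h11, hz.1] at this
      linear_combination this - ((g • z).im) * ha
    have e3 : Complex.normSq ((g • z : ℍ) : ℂ) = -δ / α := by
      rw [← hz.2, normSq_eq, normSq_eq, e1, e2, hz.1]; ring
    have e4 : α * (-δ / α) = -δ := mul_div_cancel₀ _ hα.ne'
    rw [hregion, hregion] at h1
    simp only [formEval, e1, e3, hz.1, hz.2, e4] at h1
    rcases hσ1 with rfl | rfl
    · norm_num at h1
      rcases lt_or_gt_of_ne hβ with h | h
      · exact absurd (h1.1 (by linarith)) (by linarith)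
      · exact absurd (h1.2 (by linarith)) (by linarith)
    · norm_num at h1
      rcases lt_or_gt_of_ne hβ with h | h
      · exact absurd (h1.2 (by linarith)) (by linarith)
      · exact absurd (h1.1 (by linarith)) (by linarith)
  subst hβ
  have hr4 : 1 / 4 ≤ -δ / α := by rw [le_div_iff₀ hα]; linarith
  have hr2 : √(-δ / α) ^ 2 = -δ / α := Real.sq_sqrt (by linarith)
  have hδ : δ = -α * √(-δ / α) ^ 2 := by rw [hr2]; field_simp
  have hr : 0 < √(-δ / α) := Real.sqrt_pos.2 (by linarith)
  rw [← hr2] at hr4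
  set r := √(-δ / α)
  have hact := h.act_s
  simp only [formAct, Prod.neg_mk, Prod.mk.injEq] at hact
  obtain ⟨a1, a2, a3⟩ := hact
  rw [hδ] at a1 a2 a3
  -- Reversal of the circle |z| = r, read off in coefficients. With the determinant it gives trace
  -- zero and the shape of s recorded in `StripTile`.
  have b1 : s 0 0 ^ 2 = r ^ 2 * s 1 0 ^ 2 - 1 := by
    apply mul_left_cancel₀ hα.ne'; linear_combination a1
  have b2 : s 0 0 * s 0 1 = r ^ 2 * s 1 0 * s 1 1 := by
    apply mul_left_cancel₀ hα.ne'; linear_combination a2 / 2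
  have b3 : s 0 1 ^ 2 = r ^ 2 * s 1 1 ^ 2 + r ^ 2 := by
    apply mul_left_cancel₀ hα.ne'; linear_combination a3
  have hsdet := sl_det s
  have c1 : s 1 1 = -s 0 0 := by
    linear_combination (-s 0 0) * hsdet + s 1 1 * b1 - s 1 0 * b2
  have c2 : s 0 1 = -(r ^ 2 * s 1 0) := by
    linear_combination (-s 0 1) * hsdet + s 1 1 * b2 - s 1 0 * b3
  have hregion' : ∀ z : ℍ, z ∈ P ↔ -(1 / 2) ≤ z.re ∧ z.re ≤ 1 / 2 ∧
      r ^ 2 ≤ Complex.normSq (z : ℂ) := by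
    intro z
    rw [hregion]
    have : formEval (α, 0, δ) z = α * (Complex.normSq (z : ℂ) - r ^ 2) := by
      simp only [formEval]; linear_combination hδ
    rw [this, mul_nonneg_iff_of_pos_left hα, sub_nonneg]
  refine ⟨r, s 0 0, s 1 0, h.tile, hregion', hr, hr4, rfl, c2, rfl, c1, ?_, ?_, h.g_mem, h.s_mem⟩
  -- If r > 1/2, the bottom arc has two corners in ℍ, and s must map both into the strip. One
  -- inequality from each corner gives the equation. If r = 1/2 the corners are ideal and the factor
  -- 4r² − 1 vanishes.
  · rcases hr4.lt_or_eq with hr4 | hr4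
    · have hpt : ∀ x : ℝ, x ^ 2 = 1 / 4 → -(1 / 2) ≤ x → x ≤ 1 / 2 →
          ∃ X D : ℝ, 0 < D ∧ -(1 / 2) ≤ X ∧ X ≤ 1 / 2 ∧
          D = s 1 0 ^ 2 * r ^ 2 - 2 * s 1 0 * s 0 0 * x + s 0 0 ^ 2 ∧
          X * D = 2 * s 0 0 * s 1 0 * r ^ 2 - (s 0 0 ^ 2 + r ^ 2 * s 1 0 ^ 2) * x := by
        intro x hx hx1 hx2
        obtain ⟨z, hz⟩ := exists_klein (x := x) (w := r ^ 2) (by rw [hx]; exact hr4)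
        rw [klein, Prod.mk.injEq] at hz
        have h1 := h.s_side z ((hregion' z).2 ⟨by rw [hz.1]; exact hx1, by rw [hz.1]; exact hx2,
          hz.2.ge⟩) (by simp only [formEval, hz.2]; linear_combination hδ)
        rw [hregion'] at h1
        refine ⟨_, _, autFactor_pos s z, h1.1, h1.2.1, ?_, ?_⟩
        · rw [autFactor, hz.1, hz.2, c1]; ring
        · rw [re_smul_mul, hz.1, hz.2, c1, c2]; ring
      obtain ⟨X, D, hD, hX1, hX2, hDe, hXD⟩ := hpt (1 / 2) (by norm_num) (by norm_num) le_rfl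
      obtain ⟨Y, E, hE, hY1, hY2, hEe, hYE⟩ := hpt (-(1 / 2)) (by norm_num) le_rfl (by norm_num)
      have m1 := mul_le_mul_of_nonneg_right hX1 hD.le
      have m2 := mul_le_mul_of_nonneg_right hY2 hE.le
      rw [hXD, hDe] at m1
      rw [hYE, hEe] at m2
      refine le_antisymm (by linarith) (by linarith)
    · rw [← hr4]; ring
  · have ha1 : a = 1 ∨ a = -1 := sq_eq_sq_iff_eq_or_eq_neg.1 (ha.trans (one_pow 2).symm)
    rw [← QuotientGroup.mk_inv, psl_mk_eq_mk_iff, psl_mk_eq_mk_iff]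
    rcases hσ1 with rfl | rfl <;> rcases ha1 with rfl | rfl
    · left; left
      apply sl_ext <;> simp [transSL, h00, h01, h10, h11]
    · left; right
      apply sl_ext <;> simp [transSL, h00, h01, h10, h11]
    · right; left
      apply sl_ext <;> simp [transSL, h00, h01, h10, h11, sl_inv_00, sl_inv_01, sl_inv_10,
        sl_inv_11]
    · right; right
      apply sl_ext <;> simp [transSL, h00, h01, h10, h11, sl_inv_00, sl_inv_01, sl_inv_10,
        sl_inv_11]

theorem exists_stripTile (h : TriangleTile Γ P g s q₁ q₂ q₃) : ∃ (u : SL(2, ℝ)) (r p t : ℝ),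
    StripTile (Γ.map (MulAut.conj (QuotientGroup.mk u : PSL(2, ℝ))).toMonoidHom)
      ((QuotientGroup.mk u : PSL(2, ℝ)) • P) (u * g * u⁻¹) (u * s * u⁻¹) r p t := by
  obtain ⟨u, μ, σ, a, q₃', h1, hσ, hμ, ha, h00, h01, h10, h11⟩ := h.exists_centered
  exact ⟨u, h1.stripTile hσ hμ ha h00 h01 h10 h11⟩

end TriangleTile

/-! ### Strip tiles -/

theorem psl_trans_zpow_smul (n : ℤ) (z : ℍ) :
    (((QuotientGroup.mk transSL : PSL(2, ℝ)) ^ n) • z).re = z.re + n ∧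
      (((QuotientGroup.mk transSL : PSL(2, ℝ)) ^ n) • z).im = z.im := by
  induction n using Int.induction_on generalizing z with
  | zero => simp
  | succ n ih =>
    rw [zpow_add_one, mul_smul, psl_mk_smul, (ih _).1, (ih _).2, transSL_smul_re, transSL_smul_im]
    push_cast
    exact ⟨by ring, rfl⟩
  | pred n ih =>
    rw [zpow_sub_one, mul_smul, ← QuotientGroup.mk_inv, psl_mk_smul, (ih _).1, (ih _).2,
      transSL_inv_smul_re, transSL_inv_smul_im]
    push_cast
    exact ⟨by ring, rfl⟩

/-- The half-plane `-1/2 ≤ Re z`. -/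
def leftForm : ℝ × ℝ × ℝ := (0, 1, 1 / 2)

/-- The half-plane `Re z ≤ 1/2`. -/
def rightForm : ℝ × ℝ × ℝ := (0, -1, 1 / 2)

/-- The half-plane `r ≤ |z|`. -/
def bottomForm (r : ℝ) : ℝ × ℝ × ℝ := (1, 0, -r ^ 2)

theorem isFormPolygon_of_strip {P : Set ℍ} {r : ℝ} (hP : ∀ z, z ∈ P ↔ 0 ≤ formEval leftForm z ∧
    0 ≤ formEval rightForm z ∧ 0 ≤ formEval (bottomForm r) z) : IsFormPolygon P := by
  classical
  refine ⟨{leftForm, rightForm, bottomForm r}, ?_⟩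
  ext z
  rw [hP]; simp

theorem mem_interior_of_strip {P : Set ℍ} {r : ℝ} (hP : ∀ z, z ∈ P ↔ 0 ≤ formEval leftForm z ∧
    0 ≤ formEval rightForm z ∧ 0 ≤ formEval (bottomForm r) z) {z : ℍ}
    (h1 : 0 < formEval leftForm z) (h2 : 0 < formEval rightForm z)
    (h3 : 0 < formEval (bottomForm r) z) : z ∈ interior P := by
  refine mem_interior.2 ⟨{z | 0 < formEval leftForm z} ∩ {z | 0 < formEval rightForm z} ∩
    {z | 0 < formEval (bottomForm r) z}, ?_, ?_, ⟨⟨h1, h2⟩, h3⟩⟩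
  · rintro z ⟨⟨h1, h2⟩, h3⟩
    exact (hP z).2 ⟨le_of_lt h1, le_of_lt h2, le_of_lt h3⟩
  · exact ((isOpen_lt continuous_const (continuous_formEval _)).inter
      (isOpen_lt continuous_const (continuous_formEval _))).inter
      (isOpen_lt continuous_const (continuous_formEval _))

theorem mem_strip_iff {P : Set ℍ} {r : ℝ} (hP : ∀ z : ℍ, z ∈ P ↔ -(1 / 2) ≤ z.re ∧
    z.re ≤ 1 / 2 ∧ r ^ 2 ≤ Complex.normSq (z : ℂ)) (z : ℍ) : z ∈ P ↔ 0 ≤ formEval leftForm z ∧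
    0 ≤ formEval rightForm z ∧ 0 ≤ formEval (bottomForm r) z := by
  rw [hP]
  simp only [formEval, leftForm, rightForm, bottomForm]
  constructor
  · rintro ⟨h1, h2, h3⟩; refine ⟨by linarith, by linarith, by linarith⟩
  · rintro ⟨h1, h2, h3⟩; refine ⟨by linarith, by linarith, by linarith⟩

theorem interior_strip_nonempty {P : Set ℍ} {r : ℝ} (hP : ∀ z, z ∈ P ↔ 0 ≤ formEval leftForm z ∧
    0 ≤ formEval rightForm z ∧ 0 ≤ formEval (bottomForm r) z) : (interior P).Nonempty := by
  obtain ⟨z, hz⟩ := exists_klein (x := 0) (w := r ^ 2 + 1) (by nlinarith [sq_nonneg r])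
  rw [klein, Prod.mk.injEq] at hz
  refine ⟨z, mem_interior_of_strip hP ?_ ?_ ?_⟩ <;>
    simp [formEval, leftForm, rightForm, bottomForm, hz.1, hz.2]

namespace StripTile

variable {Γ : Subgroup PSL(2, ℝ)} {P : Set ℍ} {g s : SL(2, ℝ)} {r p t : ℝ}

theorem mem_iff (h : StripTile Γ P g s r p t) (z : ℍ) : z ∈ P ↔ 0 ≤ formEval leftForm z ∧
    0 ≤ formEval rightForm z ∧ 0 ≤ formEval (bottomForm r) z := mem_strip_iff h.region z

theorem isFormPolygon (h : StripTile Γ P g s r p t) : IsFormPolygon P :=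
  isFormPolygon_of_strip h.mem_iff

theorem interior_nonempty (h : StripTile Γ P g s r p t) : (interior P).Nonempty :=
  interior_strip_nonempty h.mem_iff

theorem trans_mem (h : StripTile Γ P g s r p t) :
    (QuotientGroup.mk transSL : PSL(2, ℝ)) ∈ Γ := by
  have := h.g_mem
  rcases h.g_eq with e | e <;> rw [e] at this
  · exact this
  · exact Γ.inv_mem_iff.1 this

theorem det_eq (h : StripTile Γ P g s r p t) : r ^ 2 * t ^ 2 = 1 + p ^ 2 := by
  have := sl_det s
  rw [h.s_00, h.s_01, h.s_10, h.s_11] at this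
  linarith

theorem exists_zpow_mem (h : StripTile Γ P g s r p t) {z : ℍ} (hz : r < z.im) :
    ∃ n : ℤ, z ∈ (QuotientGroup.mk transSL : PSL(2, ℝ)) ^ n • P := by
  refine ⟨round z.re, ?_⟩
  rw [Set.mem_smul_set_iff_inv_smul_mem, ← zpow_neg, h.region, normSq_eq,
    (psl_trans_zpow_smul _ _).1, (psl_trans_zpow_smul _ _).2]
  have := abs_le.1 (abs_sub_round z.re)
  push_cast
  refine ⟨by linarith, by linarith, ?_⟩
  nlinarith [h.r_pos, sq_nonneg (z.re + -(round z.re : ℝ))]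

/-- A version of the Shimizu–Leutbecher lemma for strip tiles. -/
theorem one_le_of_ne_zero (h : StripTile Γ P g s r p t) {M : SL(2, ℝ)}
    (hM : (QuotientGroup.mk M : PSL(2, ℝ)) ∈ Γ) (hc : M 1 0 ≠ 0) : 1 ≤ (M 1 0) ^ 2 * r ^ 2 := by
  by_contra! hlt
  have hr := h.r_pos
  have hc2 : 0 < (M 1 0) ^ 2 := by positivity
  -- M takes the point of height y above −d/c to height 1/(c²y). If c²r² < 1, then both heights can
  -- exceed r. Above height r every point lies in a tile TⁿP, so M maps some TⁿP to some TᵐP and is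
  -- a power of T, which contradicts c ≠ 0.
  obtain ⟨y, hy1, hy2⟩ : ∃ y, r < y ∧ y < 1 / ((M 1 0) ^ 2 * r) := by
    refine exists_between ?_
    rw [lt_div_iff₀ (by positivity)]
    linarith
  have hy : 0 < y := hr.trans hy1
  let V : Set ℍ := {w | r < w.im ∧ r < (M • w).im}
  have hV : IsOpen V := by
    refine IsOpen.inter ?_ ?_
    · exact isOpen_lt continuous_const UpperHalfPlane.continuous_im
    · have hMc : Continuous fun w : ℍ => (QuotientGroup.mk M : PSL(2, ℝ)) • w :=
        continuous_const_smul _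
      exact isOpen_lt continuous_const (UpperHalfPlane.continuous_im.comp hMc)
  let z : ℍ := ⟨⟨-M 1 1 / M 1 0, y⟩, hy⟩
  have hzV : z ∈ V := by
    refine ⟨hy1, ?_⟩
    have h1 := im_smul_mul M z
    have h2 : autFactor M z = (M 1 0) ^ 2 * y ^ 2 := by
      have e1 : z.re = -M 1 1 / M 1 0 := rfl
      have e2 : z.im = y := rfl
      rw [autFactor, normSq_eq, e1, e2]
      field_simp; ring
    have e2 : z.im = y := rfl
    rw [h2, e2] at h1
    rw [lt_div_iff₀ (by positivity)] at hy2
    have h3 : (M • z).im * ((M 1 0) ^ 2 * y) = 1 := by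
      apply mul_right_cancel₀ hy.ne'; linear_combination h1
    by_contra! hcon
    have := mul_le_mul_of_nonneg_right hcon (by positivity : 0 ≤ (M 1 0) ^ 2 * y)
    linarith
  obtain ⟨n, hn⟩ := h.exists_zpow_mem hzV.1
  have hne : (interior ((QuotientGroup.mk transSL : PSL(2, ℝ)) ^ n • P)).Nonempty := by
    rw [smul_interior]; exact h.interior_nonempty.smul_set
  obtain ⟨w, hwV, hw⟩ := mem_closure_iff.1
    ((h.isFormPolygon.smul _).subset_closure_interior hne hn) V hV hzV
  obtain ⟨m, hm⟩ := h.exists_zpow_mem hwV.2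
  have hT := h.trans_mem
  have heq := tile_eq_of_interior h.tile h.isFormPolygon h.interior_nonempty
    (h := QuotientGroup.mk M * (QuotientGroup.mk transSL : PSL(2, ℝ)) ^ n)
    (Γ.mul_mem hM (Γ.zpow_mem hT n)) (Γ.zpow_mem hT m) (z := M • w)
    (by rw [mul_smul, smul_interior _ (_ • P), ← psl_mk_smul]; exact Set.smul_mem_smul_set hw) hm
  rw [← eq_mul_inv_iff_mul_eq, ← zpow_neg, ← zpow_add] at heq
  have hone : ∀ z : ℍ, autFactor M z = 1 := by
    intro z
    have h1 := im_smul_mul M z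
    rw [← psl_mk_smul, heq, (psl_trans_zpow_smul _ _).2] at h1
    exact mul_left_cancel₀ z.im_ne_zero (h1.trans (mul_one _).symm)
  obtain ⟨z₁, h1⟩ := exists_klein (x := 0) (w := 1) (by norm_num)
  obtain ⟨z₂, h2⟩ := exists_klein (x := 0) (w := 2) (by norm_num)
  rw [klein, Prod.mk.injEq] at h1 h2
  have e1 := hone z₁
  have e2 := hone z₂
  rw [autFactor, h1.1, h1.2] at e1
  rw [autFactor, h2.1, h2.2] at e2
  linarith

/-- If r² > 1/2, then s is the half-turn about ir, with p = 0 and r²t² = 1. The lower left entry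
t(t² − 1) of (sT)³ is either zero, which is the modular case t² = 1, or too small for
`one_le_of_ne_zero`: the tested quantity is (t² − 1)², and 0 < t² < 2. -/
theorem eq_one_or_le (h : StripTile Γ P g s r p t) :
    (r = 1 ∧ p = 0 ∧ t ^ 2 = 1) ∨ r ^ 2 ≤ 1 / 2 := by
  by_contra! hcon
  obtain ⟨hcon, hr2⟩ := hcon
  have hdet := h.det_eq
  have ht : t ≠ 0 := by
    rintro rfl; nlinarith [sq_nonneg p]
  have hp : p = 0 := by
    have := h.s_center
    rcases mul_eq_zero.1 this with h1 | h1
    · exact (mul_eq_zero.1 h1).resolve_left ht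
    · linarith
  have hM := h.one_le_of_ne_zero (M := s * transSL * (s * transSL) * (s * transSL)) (by
    simp only [QuotientGroup.mk_mul]
    exact Γ.mul_mem (Γ.mul_mem (Γ.mul_mem h.s_mem h.trans_mem) (Γ.mul_mem h.s_mem h.trans_mem))
      (Γ.mul_mem h.s_mem h.trans_mem))
  have hM10 : (s * transSL * (s * transSL) * (s * transSL)) 1 0 = t * (t ^ 2 - 1) := by
    rw [hp] at hdet
    simp only [sl_mul_apply, h.s_00, h.s_01, h.s_10, h.s_11, transSL, slMk_00, slMk_01, slMk_10,
      slMk_11, hp]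
    linear_combination (-t) * hdet
  rw [hM10] at hM
  rw [hp] at hdet
  have ht2 : 0 < t ^ 2 := by positivity
  by_cases h1 : t ^ 2 = 1
  · rw [h1] at hdet
    have : r = 1 := by nlinarith [h.r_pos]
    exact hcon this hp h1
  · have h2 := hM (mul_ne_zero ht (sub_ne_zero.2 h1))
    have h3 : (t * (t ^ 2 - 1)) ^ 2 * r ^ 2 = (t ^ 2 - 1) ^ 2 := by
      linear_combination (t ^ 2 - 1) ^ 2 * hdet
    rw [h3] at h2
    have h4 : t ^ 2 < 2 := by
      by_contra! hc
      nlinarith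
    nlinarith

theorem formAct_bottom (h : StripTile Γ P g s r p t) :
    formAct (bottomForm r) s = -bottomForm r := by
  have hdet := h.det_eq
  simp only [formAct, bottomForm, h.s_00, h.s_01, h.s_10, h.s_11, Prod.neg_mk, Prod.mk.injEq]
  refine ⟨by linear_combination -hdet, by ring, by linear_combination r ^ 2 * hdet⟩

theorem side_zero (h : StripTile Γ P g s r p t) {z : ℍ} (hz : z ∈ P) :
    (z ∈ (QuotientGroup.mk transSL : PSL(2, ℝ)) • P → formEval rightForm z = 0) ∧
    (z ∈ (QuotientGroup.mk transSL : PSL(2, ℝ))⁻¹ • P → formEval leftForm z = 0) ∧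
    (z ∈ (QuotientGroup.mk s : PSL(2, ℝ)) • P → formEval (bottomForm r) z = 0) := by
  refine ⟨fun hz' => ?_, fun hz' => ?_, fun hz' => ?_⟩
  · rw [mem_mk_smul_iff, h.region, transSL_inv_smul_re] at hz'
    rw [h.region] at hz
    simp only [formEval, rightForm]; linarith [hz.2.1, hz'.1]
  · rw [Set.mem_inv_smul_set_iff, psl_mk_smul, h.region, transSL_smul_re] at hz'
    rw [h.region] at hz
    simp only [formEval, leftForm]; linarith [hz.1, hz'.2.1]
  · rw [mem_mk_smul_iff] at hz'
    have h1 := ((h.mem_iff _).1 hz').2.2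
    have h2 := formEval_smul_mul (bottomForm r) s (s⁻¹ • z)
    rw [smul_inv_smul, h.formAct_bottom, formEval_neg] at h2
    have h3 := ((h.mem_iff z).1 hz).2.2
    nlinarith [autFactor_pos s (s⁻¹ • z)]

/-- This provides the hypothesis of `IsItinerary.next` and `IsItinerary.prev`: positivity at both
points of the forms of all sides except the one to be crossed. -/
theorem exists_form_of_ne (h : StripTile Γ P g s r p t)
    (hN : neighborhoodSet Γ P = {QuotientGroup.mk transSL, (QuotientGroup.mk transSL)⁻¹,
      QuotientGroup.mk s}) {x : PSL(2, ℝ)} {w w' : ℍ}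
    (hR : x ≠ QuotientGroup.mk transSL → 0 < formEval rightForm w ∧ 0 < formEval rightForm w')
    (hL : x ≠ (QuotientGroup.mk transSL)⁻¹ → 0 < formEval leftForm w ∧ 0 < formEval leftForm w')
    (hB : x ≠ QuotientGroup.mk s →
      0 < formEval (bottomForm r) w ∧ 0 < formEval (bottomForm r) w') :
    ∀ y ∈ neighborhoodSet Γ P, y ≠ x → ∃ q, (∀ z ∈ P ∩ y • P, formEval q z = 0) ∧
      0 < formEval q w ∧ 0 < formEval q w' := by
  intro y hy hyx
  rw [hN] at hy
  rcases hy with rfl | rfl | rfl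
  · exact ⟨rightForm, fun z hz => (h.side_zero hz.1).1 hz.2, hR hyx.symm⟩
  · exact ⟨leftForm, fun z hz => (h.side_zero hz.1).2.1 hz.2, hL hyx.symm⟩
  · exact ⟨bottomForm r, fun z hz => (h.side_zero hz.1).2.2 hz.2, hB hyx.symm⟩

end StripTile

/-! ### Geodesics passing around a vertex of small angle. -/

namespace StripTile

variable {Γ : Subgroup PSL(2, ℝ)} {P : Set ℍ} {g s : SL(2, ℝ)} {r p t : ℝ}

/-- The lines bounding the reflected tile `s P` near the vertex `1/2 + i y` of `P`. -/
theorem exists_slope (h : StripTile Γ P g s r p t) (hr : r ^ 2 ≤ 1 / 2) :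
    ∃ κ k l f a b : ℝ, 0 < κ ∧ 0 < k ∧ k ≤ 1 ∧ 1 < l * (3 / 2 - k) ∧ (1 / 4 < r ^ 2 ∨ l < 2) ∧
      0 < f ∧ (∀ z, formEval (formAct leftForm s) z =
        κ * ((Complex.normSq (z : ℂ) - r ^ 2) - k * (z.re - 1 / 2))) ∧
      ∀ z, formEval (formAct rightForm s) z =
        f + a * (Complex.normSq (z : ℂ) - r ^ 2) + b * (z.re - 1 / 2) := by
  have hdet := h.det_eq
  have hcen := h.s_center
  have ht : t ≠ 0 := by
    rintro rfl; nlinarith [sq_nonneg p]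
  have ht2 : 0 < t ^ 2 := by positivity
  have hleft : ∀ z, formEval (formAct leftForm s) z = (t ^ 2 / 2 + p * t) *
      (Complex.normSq (z : ℂ) - r ^ 2) - (t * p + p ^ 2 + r ^ 2 * t ^ 2) * (z.re - 1 / 2) := by
    intro z
    simp only [formEval, formAct, leftForm, h.s_00, h.s_01, h.s_10, h.s_11]
    linear_combination (1 / 2) * hcen
  have hright : ∀ z, formEval (formAct rightForm s) z = (r ^ 2 * t ^ 2 + p ^ 2 - t * p) +
      (t ^ 2 / 2 - p * t) * (Complex.normSq (z : ℂ) - r ^ 2) +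
      (p ^ 2 + r ^ 2 * t ^ 2 - t * p) * (z.re - 1 / 2) := by
    intro z
    simp only [formEval, formAct, rightForm, h.s_00, h.s_01, h.s_10, h.s_11]
    linear_combination (-1 / 2) * hcen
  suffices H : 0 < t ^ 2 / 2 + p * t ∧ 0 < r ^ 2 * t ^ 2 + p ^ 2 - t * p ∧ ∃ k l : ℝ,
      k * (t ^ 2 / 2 + p * t) = t * p + p ^ 2 + r ^ 2 * t ^ 2 ∧ 0 < k ∧ k ≤ 1 ∧
      1 < l * (3 / 2 - k) ∧ (1 / 4 < r ^ 2 ∨ l < 2) by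
    obtain ⟨hκ, hf, k, l, hk, hk0, hk1, hl, hl'⟩ := H
    exact ⟨t ^ 2 / 2 + p * t, k, l, r ^ 2 * t ^ 2 + p ^ 2 - t * p, t ^ 2 / 2 - p * t,
      p ^ 2 + r ^ 2 * t ^ 2 - t * p, hκ, hk0, hk1, hl, hl', hf,
      fun z => by rw [hleft]; linear_combination (z.re - 1 / 2) * hk, hright⟩
  -- For r > 1/2 one has p = 0 and slope k = 2r² ≤ 1. For r = 1/2 the vertex is ideal and p is
  -- unrestricted, but k < 1. There l must also be less than 2, so that the test point at −l stays
  -- above the parabola.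
  rcases h.r_sq.lt_or_eq with hr4 | hr4
  · have hp : p = 0 := by
      rcases mul_eq_zero.1 hcen with h1 | h1
      · exact (mul_eq_zero.1 h1).resolve_left ht
      · linarith
    subst hp
    exact ⟨by linarith, by linarith, 2 * r ^ 2, 3, by ring, by linarith, by linarith, by linarith,
      Or.inl hr4⟩
  · rw [← hr4] at hdet
    have ht4 : t ^ 2 = 4 + 4 * p ^ 2 := by linarith
    have h1 : 0 < 2 * p ^ 2 + 1 + t * p ∧ 0 < 2 * p ^ 2 + 1 - t * p := by
      have : (t * p) ^ 2 < (2 * p ^ 2 + 1) ^ 2 := by rw [mul_pow, ht4]; nlinarith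
      have := abs_lt_of_sq_lt_sq' this (by positivity)
      constructor <;> linarith [this.1, this.2]
    have hκ : t ^ 2 / 2 + p * t = 2 * p ^ 2 + 2 + t * p := by rw [ht4]; ring
    have hκ0 : 0 < 2 * p ^ 2 + 2 + t * p := by linarith [h1.1]
    have hk1 : (2 * p ^ 2 + 1 + t * p) / (2 * p ^ 2 + 2 + t * p) < 1 := by
      rw [div_lt_one hκ0]; linarith
    refine ⟨by rw [hκ]; exact hκ0, by rw [← hr4]; linarith [h1.2],
      (2 * p ^ 2 + 1 + t * p) / (2 * p ^ 2 + 2 + t * p),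
      2 / (2 - (2 * p ^ 2 + 1 + t * p) / (2 * p ^ 2 + 2 + t * p)), ?_, div_pos h1.1 hκ0, hk1.le,
      ?_, Or.inr ?_⟩
    · rw [hκ, div_mul_cancel₀ _ hκ0.ne', ← hr4]; linarith
    · rw [div_mul_eq_mul_div, lt_div_iff₀ (by linarith)]; linarith
    · rw [div_lt_iff₀ (by linarith)]; linarith

/-- The points lie on the line of slope 3/2 at height ε above the vertex (1/2, r²) of the parabola
model, with horizontal offset cε. For r = 1/2 the vertex is on the parabola itself, and being above
the parabola becomes c²ε < 1 + c/2, whence the condition −2 < c. -/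
theorem eventually_point {r f : ℝ} (hf : 0 < f) (a b : ℝ) {c : ℝ}
    (h : 1 / 4 ≤ r ^ 2) (hc : 1 / 4 < r ^ 2 ∨ -2 < c) :
    ∀ᶠ ε in nhdsWithin (0 : ℝ) (Set.Ioi 0), (∃ z : ℍ, z.re = 1 / 2 + c * ε ∧
      Complex.normSq (z : ℂ) = r ^ 2 + ε + 3 / 2 * (c * ε)) ∧
      0 < f + a * (ε + 3 / 2 * (c * ε)) + b * (c * ε) ∧ 0 < 1 + c * ε ∧ 0 < 1 - c * ε := by
  have key : ∀ φ : ℝ → ℝ, Continuous φ → 0 < φ 0 →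
      ∀ᶠ ε in nhdsWithin (0 : ℝ) (Set.Ioi 0), 0 < φ ε := fun φ hφ h0 =>
    nhdsWithin_le_nhds (hφ.continuousAt.eventually (lt_mem_nhds h0))
  have e1 := key (fun ε => f + a * (ε + 3 / 2 * (c * ε)) + b * (c * ε)) (by fun_prop) (by simpa)
  have e2 := key (fun ε => 1 + c * ε) (by fun_prop) (by simp)
  have e3 := key (fun ε => 1 - c * ε) (by fun_prop) (by simp)
  have e4 : ∀ᶠ ε in nhdsWithin (0 : ℝ) (Set.Ioi 0),
      (1 / 2 + c * ε) ^ 2 < r ^ 2 + ε + 3 / 2 * (c * ε) := by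
    rcases hc with hc | hc
    · filter_upwards [key (fun ε => r ^ 2 + ε + 3 / 2 * (c * ε) - (1 / 2 + c * ε) ^ 2)
        (by fun_prop) (by norm_num; linarith)] with ε hε
      linarith
    · filter_upwards [key (fun ε => 1 + c / 2 - c ^ 2 * ε) (by fun_prop)
        (by norm_num; linarith), self_mem_nhdsWithin] with ε hε hε0
      have := mul_pos hε (show 0 < ε from hε0)
      nlinarith
  filter_upwards [e1, e2, e3, e4] with ε e1 e2 e3 e4
  obtain ⟨z, hz⟩ := exists_klein e4
  rw [klein, Prod.mk.injEq] at hz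
  exact ⟨⟨z, hz.1, hz.2⟩, e1, e2, e3⟩

/-- A geodesic passing through `s T⁻¹ P`, `s P`, `P`, `T P` and `T s P`. -/
theorem word_of_points (h : StripTile Γ P g s r p t)
    (hN : neighborhoodSet Γ P = {QuotientGroup.mk transSL, (QuotientGroup.mk transSL)⁻¹,
      QuotientGroup.mk s}) (hss : (QuotientGroup.mk s : PSL(2, ℝ))⁻¹ = QuotientGroup.mk s)
    {u : PSL(2, ℝ)} {A B C D E : ℍ} {tA tB tC tD tE : ℝ} (hA : geodesic u tA = A)
    (hB : geodesic u tB = B) (hC : geodesic u tC = C) (hD : geodesic u tD = D)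
    (hE : geodesic u tE = E) (hAB : tA < tB) (hBC : tB < tC) (hCD : tC < tD) (hDE : tD < tE)
    (LB : 0 < formEval leftForm B) (LC : 0 < formEval leftForm C) (LD : 0 < formEval leftForm D)
    (RB : 0 < formEval rightForm B) (RC : 0 < formEval rightForm C)
    (RD : formEval rightForm D < 0)
    (bB : formEval (bottomForm r) B < 0) (bC : 0 < formEval (bottomForm r) C)
    (bD : 0 < formEval (bottomForm r) D)
    (TL : 0 < formEval leftForm (transSL⁻¹ • D)) (TL' : 0 < formEval leftForm (transSL⁻¹ • E))
    (TR : 0 < formEval rightForm (transSL⁻¹ • D)) (TR' : 0 < formEval rightForm (transSL⁻¹ • E))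
    (TB : 0 < formEval (bottomForm r) (transSL⁻¹ • D))
    (TB' : formEval (bottomForm r) (transSL⁻¹ • E) < 0)
    (SLA : formEval leftForm (s • A) < 0) (SLB : 0 < formEval leftForm (s • B))
    (SRA : 0 < formEval rightForm (s • A)) (SRB : 0 < formEval rightForm (s • B))
    (SBA : 0 < formEval (bottomForm r) (s • A)) (SBB : 0 < formEval (bottomForm r) (s • B))
    {x : ℤ → PSL(2, ℝ)} {τ : ℤ → ℝ} (hI : IsItinerary Γ P (geodesic u) x τ) :
    ∃ i, x (i + 1) = x i * QuotientGroup.mk transSL ∧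
        x (i + 1 + 1) = x (i + 1) * QuotientGroup.mk s ∧
        x (i + 1 + 1 + 1) = x (i + 1 + 1) * QuotientGroup.mk transSL ∧
        x (i + 1 + 1 + 1 + 1) = x (i + 1 + 1 + 1) * QuotientGroup.mk s := by
  have hint := fun z => mem_interior_of_strip (z := z) h.mem_iff
  have hP := h.isFormPolygon
  have hne := h.interior_nonempty
  have hγ := isLine_geodesic u
  obtain ⟨i₀, hi₀, hr₀⟩ := hI.exists_index h.tile hP hne hγ Γ.one_mem (r := tC)
    (by rw [hC, one_smul]; exact hint C LC RC bC)
  obtain ⟨i₁, hi₁, hr₁⟩ := hI.exists_index h.tile hP hne hγ h.trans_mem (r := tD)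
    (by rw [hD, smul_interior, mem_mk_smul_iff]; exact hint _ TL TR TB)
  obtain ⟨i₂, hi₂, hr₂⟩ := hI.exists_index h.tile hP hne hγ h.s_mem (r := tB)
    (by rw [hB, smul_interior, ← hss, Set.mem_inv_smul_set_iff, psl_mk_smul]
        exact hint _ SLB SRB SBB)
  have n0 := hI.next hP hγ hr₀ hCD (x := QuotientGroup.mk transSL)
    (by rw [hD, hi₀, one_smul, h.mem_iff]; exact fun hc => by linarith [hc.2.1])
    (h.exists_form_of_ne hN (by simp)
      (fun _ => by rw [hi₀, hC, hD, inv_one, one_smul, one_smul]; exact ⟨LC, LD⟩)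
      (fun _ => by rw [hi₀, hC, hD, inv_one, one_smul, one_smul]; exact ⟨bC, bD⟩))
  have p0 := hI.prev hP hγ hr₀ hBC (x := QuotientGroup.mk s)
    (by rw [hB, hi₀, one_smul, h.mem_iff]; exact fun hc => by linarith [hc.2.2])
    (h.exists_form_of_ne hN
      (fun _ => by rw [hi₀, hC, hB, inv_one, one_smul, one_smul]; exact ⟨RC, RB⟩)
      (fun _ => by rw [hi₀, hC, hB, inv_one, one_smul, one_smul]; exact ⟨LC, LB⟩)
      (by simp))
  rw [hi₀, one_mul] at n0 p0
  have hinj := hI.injective h.tile hP hne hγ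
  have hi1 : i₁ = i₀ + 1 := hinj (hi₁.trans n0.symm)
  have hi2 : i₂ = i₀ - 1 := hinj (hi₂.trans p0.symm)
  have n1 := hI.next hP hγ hr₁ hDE (x := QuotientGroup.mk s)
    (by rw [hE, hi₁, mem_mk_smul_iff, h.mem_iff]; exact fun hc => by linarith [hc.2.2])
    (h.exists_form_of_ne hN
      (fun _ => by rw [hi₁, hD, hE, ← QuotientGroup.mk_inv, psl_mk_smul, psl_mk_smul]
                   exact ⟨TR, TR'⟩)
      (fun _ => by rw [hi₁, hD, hE, ← QuotientGroup.mk_inv, psl_mk_smul, psl_mk_smul]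
                   exact ⟨TL, TL'⟩)
      (by simp))
  have p2 := hI.prev hP hγ hr₂ hAB (x := (QuotientGroup.mk transSL)⁻¹)
    (by rw [hA, hi₂, ← hss, Set.mem_inv_smul_set_iff, psl_mk_smul, h.mem_iff]
        exact fun hc => by linarith [hc.1])
    (h.exists_form_of_ne hN
      (fun _ => by rw [hi₂, hA, hB, hss, psl_mk_smul, psl_mk_smul]; exact ⟨SRB, SRA⟩)
      (by simp)
      (fun _ => by rw [hi₂, hA, hB, hss, psl_mk_smul, psl_mk_smul]; exact ⟨SBB, SBA⟩))
  rw [hi₁, hi1] at n1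
  rw [hi₂, hi2] at p2
  -- Index i₀ is the tile P. Two steps earlier the geodesic is in the tile sT⁻¹P, from which the
  -- word T s T s is read.
  refine ⟨i₀ - 1 - 1, ?_, ?_, ?_, ?_⟩
  · rw [sub_add_cancel, p0, p2, inv_mul_cancel_right]
  · rw [sub_add_cancel, sub_add_cancel, p0, hi₀]
    rw [inv_eq_iff_mul_eq_one] at hss
    exact hss.symm
  · rw [sub_add_cancel, sub_add_cancel, hi₀, one_mul, n0]
  · rw [sub_add_cancel, sub_add_cancel, n0, n1]

/-- If the circle bounding a strip tile is small, then a geodesic can pass twice around the vertex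
in the order translation, half-turn, translation, half-turn. -/
theorem exists_word (h : StripTile Γ P g s r p t)
    (hN : neighborhoodSet Γ P = {QuotientGroup.mk transSL, (QuotientGroup.mk transSL)⁻¹,
      QuotientGroup.mk s}) (hss : (QuotientGroup.mk s : PSL(2, ℝ))⁻¹ = QuotientGroup.mk s)
    (hr : r ^ 2 ≤ 1 / 2) : ∃ ε₀ : ℝ, 0 < ε₀ ∧ ∀ ε : ℝ, 0 < ε → ε < ε₀ → ∃ u : PSL(2, ℝ),
      (∀ τ, formEval (lineForm (3 / 2) (r ^ 2 + ε - 3 / 4)) (geodesic u τ) = 0) ∧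
      (Set.range (geodesic u) ∩ interior P).Nonempty ∧
      ∀ x τ, IsItinerary Γ P (geodesic u) x τ → ∃ i, x (i + 1) = x i * QuotientGroup.mk transSL ∧
        x (i + 1 + 1) = x (i + 1) * QuotientGroup.mk s ∧
        x (i + 1 + 1 + 1) = x (i + 1 + 1) * QuotientGroup.mk transSL ∧
        x (i + 1 + 1 + 1 + 1) = x (i + 1 + 1 + 1) * QuotientGroup.mk s := by
  obtain ⟨κ, k, l, f, a, b, hκ, hk0, hk1, hl, hl2, hf, hleft, hright⟩ := h.exists_slope hr
  have hl1 : 0 < l := by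
    by_contra! hcon
    have := mul_nonpos_of_nonpos_of_nonneg hcon (by linarith : 0 ≤ 3 / 2 - k)
    linarith
  have hk3 : 0 < 3 - k := by linarith
  have hcB1 : 2 / (3 - k) < l := by
    rw [div_lt_iff₀ hk3]; linarith [mul_pos hl1 hk0]
  have hcB2 : 1 / 3 < 2 / (3 - k) := by rw [div_lt_div_iff₀ (by norm_num) hk3]; linarith
  have hcB3 : 2 / (3 - k) ≤ 1 := by rw [div_le_one hk3]; linarith
  have hcB4 : 2 / (3 - k) * (3 - k) = 2 := div_mul_cancel₀ _ hk3.ne'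
  have hβ0 : 0 < 2 / (3 - k) := by positivity
  set β := 2 / (3 - k)
  -- Near the vertex the relevant lines have slopes k (a side of sP), 0 (the bottom of P), ∞ (the
  -- right side of P) and 2 (the bottom of TP). A line of slope 3/2 slightly above the vertex
  -- crosses them in this order, because k ≤ 1 < 3/2 < 2, at offsets −2ε/(3 − 2k), −2ε/3, 0 and 2ε.
  -- The offsets −l, −β, −1/3, 1, 3 place one test point in each of the five gaps.
  have hev := (eventually_point (c := -l) hf a b h.r_sq (hl2.imp id (by intro h; linarith))).and <|
    (eventually_point (c := -β) hf a b h.r_sq (Or.inr (by linarith))).and <|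
    (eventually_point (c := -(1 / 3)) hf a b h.r_sq (Or.inr (by norm_num))).and <|
    (eventually_point (c := 1) hf a b h.r_sq (Or.inr (by norm_num))).and <|
    (eventually_point (c := 3) hf a b h.r_sq (Or.inr (by norm_num)))
  rw [eventually_nhdsWithin_iff, Metric.eventually_nhds_iff] at hev
  obtain ⟨ε₀, hε₀, hall⟩ := hev
  refine ⟨ε₀, hε₀, fun ε hε hεε => ?_⟩
  obtain ⟨⟨⟨A, A1, A2⟩, A3, A4, A5⟩, ⟨⟨B, B1, B2⟩, B3, B4, B5⟩, ⟨⟨C, C1, C2⟩, C3, C4, C5⟩,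
    ⟨⟨D, D1, D2⟩, D3, D4, D5⟩, ⟨⟨E, E1, E2⟩, E3, E4, E5⟩⟩ :=
    hall (by simpa [abs_of_pos hε] using hεε) hε
  have hline : ∀ z : ℍ, ∀ c : ℝ, z.re = 1 / 2 + c * ε →
      Complex.normSq (z : ℂ) = r ^ 2 + ε + 3 / 2 * (c * ε) →
      formEval (lineForm (3 / 2) (r ^ 2 + ε - 3 / 4)) z = 0 := by
    intro z c h1 h2; rw [formEval_lineForm, h1, h2]; ring
  obtain ⟨u, hu, hord⟩ := exists_geodesic_lineForm (hline A _ A1 A2) one_ne_zero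
  have hlt : ∀ c c' : ℝ, c < c' → 0 < 1 * ((1 / 2 + c' * ε) - (1 / 2 + c * ε)) := fun c c' hc => by
    have := mul_pos (sub_pos.2 hc) hε; linarith
  obtain ⟨tA, tB, hAB, hA, hB⟩ := hord A (hline A _ A1 A2) B (hline B _ B1 B2)
    (by rw [A1, B1]; exact hlt _ _ (by linarith))
  obtain ⟨tB', tC, hBC, hB', hC⟩ := hord B (hline B _ B1 B2) C (hline C _ C1 C2)
    (by rw [B1, C1]; exact hlt _ _ (by linarith))
  obtain ⟨tC', tD, hCD, hC', hD⟩ := hord C (hline C _ C1 C2) D (hline D _ D1 D2)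
    (by rw [C1, D1]; exact hlt _ _ (by norm_num))
  obtain ⟨tD', tE, hDE, hD', hE⟩ := hord D (hline D _ D1 D2) E (hline E _ E1 E2)
    (by rw [D1, E1]; exact hlt _ _ (by norm_num))
  obtain rfl := geodesic_injective u (hB.trans hB'.symm)
  obtain rfl := geodesic_injective u (hC.trans hC'.symm)
  obtain rfl := geodesic_injective u (hD.trans hD'.symm)
  have hint := fun z => mem_interior_of_strip (z := z) h.mem_iff
  -- signs of the forms of `P`
  have LB : 0 < formEval leftForm B := by simp only [formEval, leftForm, B1]; linarith
  have LC : 0 < formEval leftForm C := by simp only [formEval, leftForm, C1]; linarith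
  have LD : 0 < formEval leftForm D := by simp only [formEval, leftForm, D1]; linarith
  have RB : 0 < formEval rightForm B := by
    simp only [formEval, rightForm, B1]; linarith [mul_pos hβ0 hε]
  have RC : 0 < formEval rightForm C := by simp only [formEval, rightForm, C1]; linarith
  have RD : formEval rightForm D < 0 := by simp only [formEval, rightForm, D1]; linarith
  have bA : formEval (bottomForm r) A < 0 := by
    simp only [formEval, bottomForm, A1, A2]
    linarith [mul_pos (show 0 < 3 / 2 * l - 1 by linarith [mul_pos hl1 hk0]) hε]
  have bB : formEval (bottomForm r) B < 0 := by
    simp only [formEval, bottomForm, B1, B2]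
    linarith [mul_pos (show 0 < 3 / 2 * β - 1 by linarith [mul_pos hβ0 hk0]) hε]
  have bC : 0 < formEval (bottomForm r) C := by
    simp only [formEval, bottomForm, C1, C2]; linarith
  have bD : 0 < formEval (bottomForm r) D := by
    simp only [formEval, bottomForm, D1, D2]; linarith
  -- signs of the forms of `T P`
  have hT1 : ∀ z, formEval leftForm (transSL⁻¹ • z) = z.re - 1 / 2 := fun z => by
    simp only [formEval, leftForm, transSL_inv_smul_re]; ring
  have hT2 : ∀ z, formEval rightForm (transSL⁻¹ • z) = 3 / 2 - z.re := fun z => by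
    simp only [formEval, rightForm, transSL_inv_smul_re]; ring
  have hT3 : ∀ z, formEval (bottomForm r) (transSL⁻¹ • z) =
      Complex.normSq (z : ℂ) - 2 * z.re + 1 - r ^ 2 := fun z => by
    simp only [formEval, bottomForm, normSq_eq, transSL_inv_smul_re, transSL_inv_smul_im]; ring
  have TL : 0 < formEval leftForm (transSL⁻¹ • D) := by rw [hT1, D1]; linarith
  have TL' : 0 < formEval leftForm (transSL⁻¹ • E) := by rw [hT1, E1]; linarith
  have TR : 0 < formEval rightForm (transSL⁻¹ • D) := by rw [hT2, D1]; linarith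
  have TR' : 0 < formEval rightForm (transSL⁻¹ • E) := by rw [hT2, E1]; linarith
  have TB : 0 < formEval (bottomForm r) (transSL⁻¹ • D) := by rw [hT3, D1, D2]; linarith
  have TB' : formEval (bottomForm r) (transSL⁻¹ • E) < 0 := by rw [hT3, E1, E2]; linarith
  -- signs of the forms of `s P`
  have hs3 : ∀ z, 0 < formEval (bottomForm r) (s • z) ↔ formEval (bottomForm r) z < 0 :=
    fun z => by rw [formEval_smul_pos, h.formAct_bottom, formEval_neg, neg_pos]
  have hs1 : ∀ z, 0 < formEval leftForm (s • z) ↔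
      0 < (Complex.normSq (z : ℂ) - r ^ 2) - k * (z.re - 1 / 2) := fun z => by
    rw [formEval_smul_pos, hleft, mul_pos_iff_of_pos_left hκ]
  have hs2 : ∀ (z : ℍ) (c : ℝ), z.re = 1 / 2 + c * ε → Complex.normSq (z : ℂ) = r ^ 2 + ε + 3 / 2 * (c * ε) →
      0 < f + a * (ε + 3 / 2 * (c * ε)) + b * (c * ε) → 0 < formEval rightForm (s • z) := by
    intro z c h1 h2 h3
    rw [formEval_smul_pos, hright, h1, h2]
    linarith
  have SLA : formEval leftForm (s • A) < 0 := by
    have h1 := formEval_smul_mul leftForm s A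
    rw [hleft, A1, A2] at h1
    have h2 : (r ^ 2 + ε + 3 / 2 * (-l * ε) - r ^ 2) - k * (1 / 2 + -l * ε - 1 / 2) < 0 := by
      have := mul_neg_of_neg_of_pos (sub_neg.2 hl) hε
      linarith
    have h3 := mul_neg_of_pos_of_neg hκ h2
    by_contra! hcon
    have := mul_nonneg hcon (autFactor_pos s A).le
    linarith
  have SLB : 0 < formEval leftForm (s • B) := by
    rw [hs1, B1, B2]
    have : (r ^ 2 + ε + 3 / 2 * (-β * ε) - r ^ 2) - k * (1 / 2 + -β * ε - 1 / 2) =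
      ε * (k * β) / 2 := by linear_combination (-ε / 2) * hcB4
    rw [this]; positivity
  have SRA := hs2 A _ A1 A2 A3
  have SRB := hs2 B _ B1 B2 B3
  have SBA := (hs3 A).2 bA
  have SBB := (hs3 B).2 bB
  refine ⟨u, hu, ⟨C, ⟨tC, hC⟩, hint C LC RC bC⟩, fun x τ hI => ?_⟩
  exact h.word_of_points hN hss hA hB hC hD hE hAB hBC hCD hDE LB LC LD RB RC RD bB bC bD TL TL'
    TR TR' TB TB' SLA SLB SRA SRB SBA SBB hI

end StripTile

/-! ### The modular group -/

/-- A matrix of `SL(2, ℤ)` as a real matrix. -/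
def toR (γ : SL(2, ℤ)) : SL(2, ℝ) := Matrix.SpecialLinearGroup.map (Int.castRingHom ℝ) γ

theorem toR_smul (γ : SL(2, ℤ)) (z : ℍ) : toR γ • z = γ • z := rfl

theorem toR_apply (γ : SL(2, ℤ)) (i j : Fin 2) : toR γ i j = γ i j := rfl

theorem toR_inv (γ : SL(2, ℤ)) : toR γ⁻¹ = (toR γ)⁻¹ := map_inv _ _

theorem mk_toR_neg (γ : SL(2, ℤ)) : (QuotientGroup.mk (toR (-γ)) : PSL(2, ℝ)) =
    QuotientGroup.mk (toR γ) := by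
  rw [psl_mk_eq_mk_iff]
  right
  apply sl_ext <;> simp [toR_apply]

theorem toR_T : toR ModularGroup.T = transSL := by
  apply sl_ext <;> rw [toR_apply] <;> simp [ModularGroup.T, transSL]

/-- The half-turn `z ↦ -1 / z`. -/
def invSL : SL(2, ℝ) := slMk 0 (-1) 1 0 (by norm_num)

theorem toR_S : toR ModularGroup.S = invSL := by
  apply sl_ext <;> rw [toR_apply] <;> simp [ModularGroup.S, invSL]

theorem transSL_mem : (QuotientGroup.mk transSL : PSL(2, ℝ)) ∈ modularGroup :=
  ⟨ModularGroup.T, by rw [← toR_T]; rfl⟩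

theorem invSL_mem : (QuotientGroup.mk invSL : PSL(2, ℝ)) ∈ modularGroup :=
  ⟨ModularGroup.S, by rw [← toR_S]; rfl⟩

theorem mk_invSL_inv : (QuotientGroup.mk invSL : PSL(2, ℝ))⁻¹ = QuotientGroup.mk invSL := by
  have : invSL⁻¹ = -invSL := by
    apply sl_ext
    · rw [sl_inv_00]; simp [invSL]
    · rw [sl_inv_01]; simp [invSL]
    · rw [sl_inv_10]; simp [invSL]
    · rw [sl_inv_11]; simp [invSL]
  rw [← QuotientGroup.mk_inv, psl_mk_eq_mk_iff, this, neg_neg]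
  exact Or.inr rfl

theorem mem_fd_iff (z : ℍ) : z ∈ ModularGroup.fd ↔
    -(1 / 2) ≤ z.re ∧ z.re ≤ 1 / 2 ∧ (1 : ℝ) ^ 2 ≤ Complex.normSq (z : ℂ) := by
  rw [one_pow, ← and_assoc, ← abs_le, and_comm]
  rfl

/-- The factor |cz + d|² is at least 1 when c = 0 and at least (Im z)² when c ≠ 0, since c and d are
integers. The bound confines the tiles near a compact set to a compact part of the fundamental
domain. -/
theorem im_int_smul_le (γ : SL(2, ℤ)) (z : ℍ) : (γ • z).im ≤ max z.im (1 / z.im) := by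
  have h1 := im_smul_mul (toR γ) z
  rw [toR_smul] at h1
  have hz := z.im_pos
  have hdet := sl_det (toR γ)
  by_cases hc : γ 1 0 = 0
  · refine le_max_of_le_left ?_
    have hc' : toR γ 1 0 = 0 := by rw [toR_apply, hc]; simp
    have hd : 1 ≤ (toR γ 1 1) ^ 2 := by
      have h0 : γ 1 1 ≠ 0 := by
        intro h0
        rw [hc', toR_apply γ 1 1, h0] at hdet
        simp at hdet
      have : 1 ≤ (γ 1 1) ^ 2 := sq_pos_of_ne_zero h0
      rw [toR_apply]
      exact_mod_cast this
    have h2 : 1 ≤ autFactor (toR γ) z := by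
      rw [autFactor, hc']; linarith
    calc (γ • z).im ≤ (γ • z).im * autFactor (toR γ) z :=
          le_mul_of_one_le_right (γ • z).im_pos.le h2
      _ = z.im := h1
  · refine le_max_of_le_right ?_
    have hd : 1 ≤ (toR γ 1 0) ^ 2 := by
      have : 1 ≤ (γ 1 0) ^ 2 := sq_pos_of_ne_zero hc
      rw [toR_apply]
      exact_mod_cast this
    have h2 : z.im ^ 2 ≤ autFactor (toR γ) z := by
      rw [autFactor, normSq_eq]
      nlinarith [sq_nonneg (toR γ 1 0 * z.re + toR γ 1 1), sq_nonneg z.im]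
    rw [le_div_iff₀ hz]
    have h3 := mul_le_mul_of_nonneg_left h2 (γ • z).im_pos.le
    rw [h1] at h3
    nlinarith

theorem isFundamentalTile_fd : IsFundamentalTile modularGroup ModularGroup.fd := by
  refine ⟨fun z => ?_, ?_, ?_⟩
  · obtain ⟨γ, hγ⟩ := ModularGroup.exists_smul_mem_fd z
    refine ⟨QuotientGroup.mk (toR γ⁻¹), ⟨γ⁻¹, rfl⟩, ?_⟩
    rw [mem_mk_smul_iff, toR_inv, inv_inv]
    exact hγ
  · rintro _ ⟨γ, rfl⟩ hγ
    change (QuotientGroup.mk (toR γ) : PSL(2, ℝ)) ≠ 1 at hγ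
    change Disjoint _ (interior ((QuotientGroup.mk (toR γ) : PSL(2, ℝ)) • _))
    rw [Set.disjoint_left]
    intro z hz hz'
    have h1 := interior_subset hz'
    rw [mem_mk_smul_iff, ← toR_inv, toR_smul] at h1
    rw [← ModularGroup.fdo_eq_interior_fd] at hz
    have h2 := ModularGroup.eq_one_or_neg_one_of_mem_fdo_mem_fd hz h1
    apply hγ
    rcases h2 with h2 | h2
    · rw [inv_eq_one] at h2
      rw [h2]
      simp [toR]
    · rw [inv_eq_iff_eq_inv] at h2
      have : γ = -1 := by rw [h2]; simp
      rw [this, mk_toR_neg]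
      simp [toR]
  -- If a tile meets the compact set K, pulling the common point back gives a point of the standard
  -- domain whose height is bounded in terms of K alone. Proper discontinuity then applies to K and
  -- a truncated domain.
  · intro z
    obtain ⟨K, hK, hzK⟩ := exists_compact_mem_nhds z
    have hbdd : ∃ Y : ℝ, ∀ w ∈ K, max w.im (1 / w.im) ≤ Y := by
      have hc : ContinuousOn (fun w : ℍ => max w.im (1 / w.im)) K := by
        refine Continuous.continuousOn (Continuous.max UpperHalfPlane.continuous_im ?_)
        exact continuous_const.div UpperHalfPlane.continuous_im fun w => w.im_ne_zero
      obtain ⟨Y, hY⟩ := (hK.image_of_continuousOn hc).bddAbove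
      exact ⟨Y, fun w hw => hY ⟨w, hw, rfl⟩⟩
    obtain ⟨Y, hY⟩ := hbdd
    let G : Subgroup SL(2, ℝ) := (Matrix.SpecialLinearGroup.map (Int.castRingHom ℝ)).range
    have hG : ProperlyDiscontinuousSMul G ℍ := inferInstance
    have hfin := hG.finite_disjoint_inter_image
      (ModularGroup.isCompact_truncatedFundamentalDomain Y) hK
    refine ⟨K, hzK, ?_⟩
    let φ : G → modularGroup := fun γ => ⟨QuotientGroup.mk (γ : SL(2, ℝ)), by
      obtain ⟨γ', hγ'⟩ := γ.2
      exact ⟨γ', by rw [← hγ']; rfl⟩⟩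
    refine (hfin.image φ).subset ?_
    rintro ⟨_, γ, rfl⟩ ⟨w, hw, hwK⟩
    refine ⟨⟨toR γ, γ, rfl⟩, ?_, rfl⟩
    change w ∈ (QuotientGroup.mk (toR γ) : PSL(2, ℝ)) • ModularGroup.fd at hw
    rw [mem_mk_smul_iff, ← toR_inv, toR_smul] at hw
    have hmem : w ∈ (fun x => (⟨toR γ, γ, rfl⟩ : G) • x) ''
        ModularGroup.truncatedFundamentalDomain Y := by
      refine ⟨γ⁻¹ • w, ⟨hw, (im_int_smul_le _ _).trans (hY w hwK)⟩, ?_⟩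
      change toR γ • (γ⁻¹ • w) = w
      rw [toR_smul, smul_inv_smul]
    exact Exists.intro w (And.intro hmem hwK)

theorem stripTile_fd : StripTile modularGroup ModularGroup.fd transSL invSL 1 0 1 where
  tile := isFundamentalTile_fd
  region := mem_fd_iff
  r_pos := one_pos
  r_sq := by norm_num
  s_00 := rfl
  s_01 := by simp [invSL]
  s_10 := rfl
  s_11 := by simp [invSL]
  s_center := by norm_num
  g_eq := Or.inl rfl
  g_mem := transSL_mem
  s_mem := invSL_mem

theorem invSL_smul_mem_fd {z : ℍ} (hz : z ∈ ModularGroup.fd) (h : Complex.normSq (z : ℂ) = 1) :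
    invSL • z ∈ ModularGroup.fd := by
  have h1 := re_smul_mul invSL z
  have h2 := normSq_smul_mul invSL z
  rw [mem_fd_iff] at hz ⊢
  simp [autFactor, invSL, h] at h1 h2
  simp only [invSL]
  rw [h1, h2]
  refine ⟨by linarith [hz.2.1], by linarith [hz.1], by norm_num⟩

theorem triangleTile_fd : TriangleTile modularGroup ModularGroup.fd transSL invSL leftForm
    rightForm (bottomForm 1) where
  tile := isFundamentalTile_fd
  g_mem := transSL_mem
  s_mem := invSL_mem
  region := stripTile_fd.mem_iff
  inner := by
    obtain ⟨z, hz⟩ := exists_klein (x := 0) (w := 2) (by norm_num)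
    rw [klein, Prod.mk.injEq] at hz
    refine ⟨z, ?_, ?_, ?_⟩ <;>
      norm_num [formEval, leftForm, rightForm, bottomForm, hz.1, hz.2]
  star x y hxy := by
    by_contra! hcon
    simp only [formBdry, leftForm, rightForm, bottomForm] at hcon
    obtain ⟨h1, h2, h3⟩ := hcon
    nlinarith [sq_nonneg y, mul_pos (by linarith : 0 < x * y + 1 / 2 * y ^ 2)
      (by linarith : 0 < -(x * y) + 1 / 2 * y ^ 2), sq_nonneg x]
  side := by
    obtain ⟨z, hz⟩ := exists_klein (x := -(1 / 2)) (w := 2) (by norm_num)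
    obtain ⟨w, hw⟩ := exists_klein (x := -(1 / 2)) (w := 3) (by norm_num)
    refine ⟨z, w, fun e => ?_, ?_⟩
    · rw [e, hw, Prod.mk.injEq] at hz; norm_num at hz
    rw [klein, Prod.mk.injEq] at hz hw
    rw [mem_fd_iff, mem_fd_iff]
    norm_num [formEval, leftForm, hz.1, hz.2, hw.1, hw.2]
  map_side z hz := by
    have h0 : z.re = -(1 / 2) := by simp only [formEval, leftForm] at hz; linarith
    rw [mem_fd_iff, mem_fd_iff, normSq_eq, normSq_eq, transSL_smul_re, transSL_smul_im, h0]
    norm_num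
  act_g := by
    simp [formAct, leftForm, rightForm, transSL]; norm_num
  act_s := stripTile_fd.formAct_bottom
  s_side z hz h := invSL_smul_mem_fd hz (by simp only [formEval, bottomForm] at h; linarith)
  disc₁ := by norm_num [formDisc, leftForm]
  disc₃ := by norm_num [formDisc, bottomForm]
  not_fixed z h := by
    have := transSL_smul_re z
    rw [h] at this; linarith

/-- A polygon with two points contains the segment between them and so is infinite. Two prescribed
corners can be avoided. -/
theorem exists_mem_ne_ne {A : Set ℍ} (hA : IsFormPolygon A) (h : A.Nontrivial) (a b : ℍ) :
    ∃ v ∈ A, v ≠ a ∧ v ≠ b := by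
  obtain ⟨z, hz, w, hw, hzw⟩ := h
  obtain ⟨f, -, hfm⟩ := exists_mixPath z w
  have hinj : Function.Injective f := fun θ θ' e => Subtype.ext
    (isMix_injective hzw (hfm θ) (by rw [e]; exact hfm θ'))
  have hinf : (Set.range f).Infinite := by
    have : Infinite (Set.Icc (0 : ℝ) 1) := (Set.Icc_infinite one_pos).to_subtype
    exact Set.infinite_range_of_injective hinj
  obtain ⟨v, ⟨θ, rfl⟩, hv⟩ := (hinf.sdiff (Set.toFinite {a, b})).nonempty
  simp only [Set.mem_insert_iff, Set.mem_singleton_iff, not_or] at hv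
  exact ⟨_, hA.isMix θ.2.1 θ.2.2 (hfm θ) hz hw, hv⟩

theorem IsFormPolygon.inter {A B : Set ℍ} (hA : IsFormPolygon A) (hB : IsFormPolygon B) :
    IsFormPolygon (A ∩ B) := by
  classical
  obtain ⟨S, rfl⟩ := hA
  obtain ⟨S', rfl⟩ := hB
  refine ⟨S ∪ S', ?_⟩
  ext z
  simp only [Set.mem_inter_iff, Set.mem_ofPred_eq, Finset.mem_union]
  constructor
  · rintro ⟨h1, h2⟩ q (hq | hq)
    exacts [h1 q hq, h2 q hq]
  · exact fun h => ⟨fun q hq => h q (Or.inl hq), fun q hq => h q (Or.inr hq)⟩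

theorem mk_transSL_ne_inv : (QuotientGroup.mk transSL : PSL(2, ℝ)) ≠
    (QuotientGroup.mk transSL)⁻¹ := by
  rw [← QuotientGroup.mk_inv, Ne, psl_mk_eq_mk_iff]
  rintro (h | h)
  · have := congrArg (fun g : SL(2, ℝ) => g 0 1) h
    norm_num [sl_inv_01, transSL] at this
  · have := congrArg (fun g : SL(2, ℝ) => g 0 0) h
    norm_num [sl_inv_00, transSL] at this

theorem mk_invSL_ne : (QuotientGroup.mk invSL : PSL(2, ℝ)) ≠ QuotientGroup.mk transSL := by
  rw [Ne, psl_mk_eq_mk_iff]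
  rintro (h | h) <;>
  · have := congrArg (fun g : SL(2, ℝ) => g 0 0) h
    norm_num [transSL, invSL] at this

theorem mk_invSL_ne_inv : (QuotientGroup.mk invSL : PSL(2, ℝ)) ≠
    (QuotientGroup.mk transSL)⁻¹ := by
  rw [← QuotientGroup.mk_inv, Ne, psl_mk_eq_mk_iff]
  rintro (h | h) <;>
  · have := congrArg (fun g : SL(2, ℝ) => g 0 0) h
    norm_num [sl_inv_00, transSL, invSL] at this

theorem neighborhoodSet_fd : neighborhoodSet modularGroup ModularGroup.fd =
    {QuotientGroup.mk transSL, (QuotientGroup.mk transSL)⁻¹, QuotientGroup.mk invSL} := by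
  have hT : (QuotientGroup.mk transSL : PSL(2, ℝ)) ∈
      neighborhoodSet modularGroup ModularGroup.fd := by
    refine ⟨transSL_mem, fun h => mk_transSL_ne_inv (by rw [h, inv_one]), ?_⟩
    obtain ⟨z, w, hzw, hz, hw, hz1, hw1⟩ := triangleTile_fd.side
    refine ⟨transSL • z, ⟨(triangleTile_fd.map_side z hz1).1 hz, ?_⟩, transSL • w,
      ⟨(triangleTile_fd.map_side w hw1).1 hw, ?_⟩, (MulAction.injective transSL).ne hzw⟩
    · rwa [mem_mk_smul_iff, inv_smul_smul]
    · rwa [mem_mk_smul_iff, inv_smul_smul]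
  apply subset_antisymm
  · rintro x ⟨⟨γ, rfl⟩, hx1, hnt⟩
    change (QuotientGroup.mk (toR γ) : PSL(2, ℝ)) ≠ 1 at hx1
    change (ModularGroup.fd ∩ (QuotientGroup.mk (toR γ) : PSL(2, ℝ)) • ModularGroup.fd).Nontrivial
      at hnt
    change (QuotientGroup.mk (toR γ) : PSL(2, ℝ)) ∈ _
    have hF := stripTile_fd.isFormPolygon
    -- A point of the common side other than ρ and ρ + 1 rules out the elements that relate the
    -- standard domain to itself only at a corner.
    obtain ⟨v, ⟨hv, hv'⟩, h1, h2⟩ := exists_mem_ne_ne (hF.inter (hF.smul _)) hnt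
      UpperHalfPlane.ρ ((1 : ℝ) +ᵥ UpperHalfPlane.ρ)
    rw [mem_mk_smul_iff, ← toR_inv, toR_smul] at hv'
    have hinv : ∀ δ : SL(2, ℤ), γ⁻¹ = δ ∨ γ⁻¹ = -δ → (QuotientGroup.mk (toR γ) : PSL(2, ℝ)) =
        (QuotientGroup.mk (toR δ))⁻¹ := by
      intro δ hδ
      have : (QuotientGroup.mk (toR γ⁻¹) : PSL(2, ℝ)) = QuotientGroup.mk (toR δ) := by
        rcases hδ with h | h <;> rw [h]
        rw [mk_toR_neg]
      rw [← this, toR_inv, QuotientGroup.mk_inv, inv_inv]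
    rcases ModularGroup.cases_of_mem_fd_smul_mem_fd hv hv' with
      h | ⟨h, -⟩ | ⟨h, -⟩ | ⟨h, -⟩ | ⟨-, h⟩ | ⟨-, h⟩ | ⟨-, h⟩ | ⟨-, h⟩ | ⟨-, h⟩ | ⟨-, h⟩
    · exact absurd (hinv 1 h) (by simpa [toR] using hx1)
    · rw [hinv _ h, toR_T]; simp
    · rw [hinv _ h, toR_inv, toR_T, QuotientGroup.mk_inv, inv_inv]; simp
    · rw [hinv _ h, toR_S, mk_invSL_inv]; simp
    · exact absurd h h2
    · exact absurd h h2
    · exact absurd h h2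
    · exact absurd h h1
    · exact absurd h h1
    · exact absurd h h1
  · rintro x (rfl | rfl | rfl)
    · exact hT
    · exact inv_mem_neighborhoodSet hT
    · refine ⟨invSL_mem, fun h => ?_, ?_⟩
      · rw [← QuotientGroup.mk_one, psl_mk_eq_mk_iff] at h
        rcases h with h | h <;>
        · have := congrArg (fun g : SL(2, ℝ) => g 0 0) h
          norm_num [invSL] at this
      · obtain ⟨z, hz⟩ := exists_klein (x := 0) (w := 1) (by norm_num)
        obtain ⟨w, hw⟩ := exists_klein (x := 1 / 2) (w := 1) (by norm_num)
        have hzw : z ≠ w := fun e => by rw [e, hw, Prod.mk.injEq] at hz; norm_num at hz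
        rw [klein, Prod.mk.injEq] at hz hw
        have hzF : z ∈ ModularGroup.fd := by
          rw [mem_fd_iff]; norm_num [hz.1, hz.2]
        have hwF : w ∈ ModularGroup.fd := by
          rw [mem_fd_iff]; norm_num [hw.1, hw.2]
        refine ⟨z, ⟨hzF, ?_⟩, w, ⟨hwF, ?_⟩, hzw⟩
        · rw [← mk_invSL_inv, Set.mem_inv_smul_set_iff, psl_mk_smul]
          exact invSL_smul_mem_fd hzF hz.2
        · rw [← mk_invSL_inv, Set.mem_inv_smul_set_iff, psl_mk_smul]
          exact invSL_smul_mem_fd hwF hw.2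

/-! ### Cutting sequences of the modular group -/

theorem countable_vertexSet_fd : (vertexSet modularGroup ModularGroup.fd).Countable := by
  classical
  let q : PSL(2, ℝ) → ℝ × ℝ × ℝ := fun x =>
    if x = QuotientGroup.mk transSL then rightForm else
      if x = (QuotientGroup.mk transSL)⁻¹ then leftForm else bottomForm 1
  have q1 : q (QuotientGroup.mk transSL) = rightForm := if_pos rfl
  have q2 : q (QuotientGroup.mk transSL)⁻¹ = leftForm := by
    exact (if_neg mk_transSL_ne_inv.symm).trans (if_pos rfl)
  have q3 : q (QuotientGroup.mk invSL) = bottomForm 1 := by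
    exact (if_neg mk_invSL_ne).trans (if_neg mk_invSL_ne_inv)
  refine countable_vertexSet (q := q) isFundamentalTile_fd stripTile_fd.interior_nonempty ?_ ?_ ?_
  · rw [neighborhoodSet_fd]
    rintro x (rfl | rfl | rfl)
    · rw [q1]; norm_num [formDisc, rightForm]
    · rw [q2]; norm_num [formDisc, leftForm]
    · rw [q3]; norm_num [formDisc, bottomForm]
  · rw [neighborhoodSet_fd]
    rintro x (rfl | rfl | rfl) z ⟨hz, hz'⟩
    · rw [q1]; exact (stripTile_fd.side_zero hz).1 hz'
    · rw [q2]; exact (stripTile_fd.side_zero hz).2.1 hz'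
    · rw [q3]; exact (stripTile_fd.side_zero hz).2.2 hz'
  · rw [neighborhoodSet_fd]
    rintro x (rfl | rfl | rfl) y (rfl | rfl | rfl) hxy <;>
      first
      | exact absurd rfl hxy
      | (simp only [q1, q2, q3, leftForm, rightForm, bottomForm, Prod.smul_mk, smul_eq_mul,
          Prod.mk.injEq]
         rintro ⟨t, h1, h2, h3⟩
         linarith)

theorem exists_generic_fd (k : ℝ) : ∃ M : Set ℝ, M.Countable ∧ ∀ m ∉ M, ∀ u : PSL(2, ℝ),
    (∀ t, formEval (lineForm k m) (geodesic u t) = 0) →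
    (Set.range (geodesic u) ∩ interior ModularGroup.fd).Nonempty →
    IsGeneralPosition modularGroup ModularGroup.fd (geodesic u) ∧
      ∃ h t, h 0 = 1 ∧ IsItinerary modularGroup ModularGroup.fd (geodesic u) h t := by
  obtain ⟨M, hM, h⟩ := exists_countable_exceptions isFundamentalTile_fd stripTile_fd.isFormPolygon
    stripTile_fd.interior_nonempty countable_vertexSet_fd
    (fun x _ => triangleTile_fd.countable_idealPoints_smul x) 1 k
  refine ⟨M, hM, fun m hm u hu => h m hm u fun t => ?_⟩
  rw [inv_one, one_smul]
  exact hu t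

/-- A semicircle about 0 of squared radius m > n² + 1 passes above the unit arcs of n + 1
consecutive strips and so crosses n vertical sides one after another. The sign σ is the direction of
travel, and Z j is the point on the axis of the j-th strip. -/
theorem occurs_trans_zpow {σ : ℤ} (hσ : σ = 1 ∨ σ = -1) (n : ℕ) :
    Occurs modularGroup ModularGroup.fd n
      fun _ => (QuotientGroup.mk transSL : PSL(2, ℝ)) ^ σ := by
  have hσ2 : (σ : ℝ) ^ 2 = 1 := by rcases hσ with rfl | rfl <;> norm_num
  obtain ⟨M, hM, hgen⟩ := exists_generic_fd 0
  obtain ⟨m, hmn, hmM⟩ : ∃ m ∈ Set.Ioo ((n : ℝ) ^ 2 + 1) ((n : ℝ) ^ 2 + 2), m ∉ M := by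
    obtain ⟨m, h1, h2⟩ := (hM.dense_compl ℝ).exists_mem_open isOpen_Ioo
      (Set.nonempty_Ioo.2 (by linarith : (n : ℝ) ^ 2 + 1 < (n : ℝ) ^ 2 + 2))
    exact ⟨m, h2, h1⟩
  have hle : ∀ j : ℕ, j ≤ n → (j : ℝ) ^ 2 + 1 < m := fun j hj => by
    have : (j : ℝ) ≤ n := by exact_mod_cast hj
    have := pow_le_pow_left₀ (Nat.cast_nonneg j) this 2
    linarith [hmn.1]
  have hex : ∀ j : ℕ, j ≤ n → ∃ z : ℍ, z.re = σ * j ∧ Complex.normSq (z : ℂ) = m := by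
    intro j hj
    obtain ⟨z, hz⟩ := exists_klein (x := σ * j) (w := m) (by
      rw [mul_pow, hσ2]; linarith [hle j hj])
    rw [klein, Prod.mk.injEq] at hz
    exact ⟨z, hz⟩
  choose! Z hZ hZ' using hex
  have hline : ∀ j ≤ n, formEval (lineForm 0 m) (Z j) = 0 := fun j hj => by
    rw [formEval_lineForm, hZ' j hj]; ring
  obtain ⟨u, hu, hord⟩ := exists_geodesic_lineForm (hline 0 n.zero_le) (σ := σ) (by
    intro h; rw [h] at hσ2; norm_num at hσ2)
  -- coordinates relative to the translated tiles
  have hrel : ∀ (j : ℕ) (z : ℍ),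
      ((((QuotientGroup.mk transSL : PSL(2, ℝ)) ^ σ) ^ j)⁻¹ • z).re = z.re - σ * j ∧
      Complex.normSq (((((QuotientGroup.mk transSL : PSL(2, ℝ)) ^ σ) ^ j)⁻¹ • z : ℍ) : ℂ) =
        (z.re - σ * j) ^ 2 + (Complex.normSq (z : ℂ) - z.re ^ 2) := by
    intro j z
    have h1 := psl_trans_zpow_smul (-(σ * j)) z
    rw [← zpow_natCast, ← zpow_mul, ← zpow_neg, normSq_eq, normSq_eq, h1.1, h1.2]
    push_cast
    exact ⟨by ring, by ring⟩
  have hR : ∀ j : ℕ, j ≤ n →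
      formEval leftForm ((((QuotientGroup.mk transSL : PSL(2, ℝ)) ^ σ) ^ j)⁻¹ • Z j) = 1 / 2 ∧
      formEval rightForm ((((QuotientGroup.mk transSL : PSL(2, ℝ)) ^ σ) ^ j)⁻¹ • Z j) = 1 / 2 ∧
      0 < formEval (bottomForm 1)
        ((((QuotientGroup.mk transSL : PSL(2, ℝ)) ^ σ) ^ j)⁻¹ • Z j) := by
    intro j hj
    simp only [formEval, leftForm, rightForm, bottomForm]
    rw [(hrel j (Z j)).1, (hrel j (Z j)).2, hZ j hj, hZ' j hj, mul_pow, hσ2]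
    exact ⟨by ring, by ring, by linarith [hle j hj]⟩
  have hmem : ∀ j : ℕ, j ≤ n →
      Z j ∈ interior (((QuotientGroup.mk transSL : PSL(2, ℝ)) ^ σ) ^ j • ModularGroup.fd) := by
    intro j hj
    obtain ⟨h1, h2, h3⟩ := hR j hj
    rw [smul_interior, Set.mem_smul_set_iff_inv_smul_mem]
    exact mem_interior_of_strip stripTile_fd.mem_iff (by rw [h1]; norm_num) (by rw [h2]; norm_num)
      h3
  have hon : ∀ j ≤ n, ∃ t, geodesic u t = Z j := by
    intro j hj
    -- For n = 0 there is no second point Z j to order against, and an auxiliary point w of the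
    -- semicircle takes its place.
    rcases Nat.eq_zero_or_pos n with rfl | hn
    · obtain rfl : j = 0 := by omega
      obtain ⟨w, hw⟩ := exists_klein (x := σ * (1 / 2)) (w := m) (by
        rw [mul_pow, hσ2]; have := hle 0 le_rfl; norm_num at this ⊢; linarith)
      rw [klein, Prod.mk.injEq] at hw
      obtain ⟨s, t, -, hs, -⟩ := hord _ (hline 0 le_rfl) w
        (by rw [formEval_lineForm, hw.2]; ring) (by
          rw [hZ 0 le_rfl, hw.1]; push_cast; nlinarith)
      exact ⟨s, hs⟩
    · rcases hj.eq_or_lt with rfl | hj'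
      · obtain ⟨s, t, -, -, ht⟩ := hord _ (hline 0 (by omega)) _ (hline j le_rfl) (by
          rw [hZ 0 (by omega), hZ j le_rfl]
          have : (0 : ℝ) < j := by exact_mod_cast hn
          push_cast; nlinarith)
        exact ⟨t, ht⟩
      · obtain ⟨s, t, -, hs, -⟩ := hord _ (hline j hj) _ (hline n le_rfl) (by
          rw [hZ j hj, hZ n le_rfl]
          have : (j : ℝ) < n := by exact_mod_cast hj'
          nlinarith)
        exact ⟨s, hs⟩
  choose! τ hτ using hon
  have hlt : ∀ j, j + 1 ≤ n → τ j < τ (j + 1) := by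
    intro j hj
    obtain ⟨s, t, hst, hs, ht⟩ := hord _ (hline j (by omega)) _ (hline (j + 1) hj) (by
      rw [hZ j (by omega), hZ (j + 1) hj]; push_cast; nlinarith)
    rw [geodesic_injective u ((hτ j (by omega)).trans hs.symm),
      geodesic_injective u ((hτ (j + 1) hj).trans ht.symm)]
    exact hst
  obtain ⟨hgp, h, t, h0, hI⟩ := hgen m hmM u hu ⟨Z 0, ⟨τ 0, hτ 0 n.zero_le⟩, by
    simpa using hmem 0 n.zero_le⟩
  have hP := stripTile_fd.isFormPolygon
  have hne := stripTile_fd.interior_nonempty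
  have hγ := isLine_geodesic u
  have hpm : ∀ j : ℕ, ((QuotientGroup.mk transSL : PSL(2, ℝ)) ^ σ) ^ j ∈ modularGroup := fun j =>
    modularGroup.pow_mem (modularGroup.zpow_mem transSL_mem σ) j
  have hidx := fun j (hj : j ≤ n) => hI.exists_index isFundamentalTile_fd hP hne hγ (hpm j)
    (r := τ j) (by rw [hτ j hj]; exact hmem j hj)
  obtain ⟨i₀, hi₀, -⟩ := hidx 0 n.zero_le
  have hstep : ∀ j, j + 1 ≤ n → ∀ i, h i = ((QuotientGroup.mk transSL : PSL(2, ℝ)) ^ σ) ^ j →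
      h (i + 1) = h i * (QuotientGroup.mk transSL : PSL(2, ℝ)) ^ σ := by
    intro j hj i hi
    obtain ⟨i', hi', hr⟩ := hidx j (by omega)
    obtain rfl := hI.injective isFundamentalTile_fd hP hne hγ (hi'.trans hi.symm)
    obtain ⟨a1, a2, a3⟩ := hR j (by omega)
    have hre : ((((QuotientGroup.mk transSL : PSL(2, ℝ)) ^ σ) ^ j)⁻¹ • Z (j + 1)).re = σ := by
      rw [(hrel j _).1, hZ _ hj]; push_cast; ring
    have hnq : (1 : ℝ) < Complex.normSq
        (((((QuotientGroup.mk transSL : PSL(2, ℝ)) ^ σ) ^ j)⁻¹ • Z (j + 1) : ℍ) : ℂ) := by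
      rw [(hrel j _).2, hZ _ hj, hZ' _ hj, mul_pow, hσ2]
      have := hle _ hj
      nlinarith [sq_nonneg ((σ : ℝ) * ((j + 1 : ℕ) : ℝ) - σ * j)]
    refine hI.next hP hγ hr (hlt j hj) ?_ ?_
    · rw [hτ _ hj, hi, Set.mem_smul_set_iff_inv_smul_mem, mem_fd_iff, hre]
      rintro ⟨b1, b2, -⟩
      rcases hσ with rfl | rfl
      · norm_num at b2
      · norm_num at b1
    · rw [hi, hτ j (by omega), hτ _ hj]
      refine stripTile_fd.exists_form_of_ne neighborhoodSet_fd (fun hx => ⟨by rw [a2]; norm_num, ?_⟩)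
        (fun hx => ⟨by rw [a1]; norm_num, ?_⟩) fun _ => ⟨a3, ?_⟩
      · simp only [formEval, rightForm]
        rw [hre]
        rcases hσ with rfl | rfl
        · simp at hx
        · norm_num
      · simp only [formEval, leftForm]
        rw [hre]
        rcases hσ with rfl | rfl
        · norm_num
        · simp at hx
      · simp only [formEval, bottomForm]
        linarith
  have hpow : ∀ j ≤ n, h (i₀ + j) = ((QuotientGroup.mk transSL : PSL(2, ℝ)) ^ σ) ^ j := by
    intro j hj
    induction j with
    | zero => simpa using hi₀
    | succ j ih =>
      have := hstep j hj _ (ih (by omega))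
      rw [ih (by omega), ← pow_succ] at this
      rw [← this]; push_cast; rw [add_assoc]
  refine occurs_iff.2 ⟨u, hgp, h, t, h0, hI, i₀, fun j hj => ?_⟩
  rw [← hstep j hj _ (hpow j (by omega))]
  push_cast
  rw [add_assoc]

/-- Normalise so that the middle tile is F. The word runs from the tile SG⁻¹F through F to the tile
GSF. The geodesic |z − σ| = 1, through the corner at which these tiles meet, has F outside it and
the other two tiles inside. Along a line an affine function cannot go from nonpositive to positive
and back to nonpositive. -/
theorem not_occurs_fd {G : SL(2, ℝ)} {σ : ℝ} (hσ : σ = 1 ∨ σ = -1) (h00 : G 0 0 = 1)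
    (h01 : G 0 1 = σ) (h10 : G 1 0 = 0) (h11 : G 1 1 = 1) {w : ℕ → PSL(2, ℝ)}
    (w0 : w 0 = QuotientGroup.mk G) (w1 : w 1 = QuotientGroup.mk invSL)
    (w2 : w 2 = QuotientGroup.mk G) (w3 : w 3 = QuotientGroup.mk invSL) :
    ¬ Occurs modularGroup ModularGroup.fd 4 w := by
  intro hocc
  have hσ2 : σ ^ 2 = 1 := by rcases hσ with rfl | rfl <;> norm_num
  obtain ⟨u, -, h, t, -, hI, i, hw⟩ := occurs_iff.1 hocc
  have e0 := hw 0 (by norm_num)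
  have e1 := hw 1 (by norm_num)
  have e2 := hw 2 (by norm_num)
  have e3 := hw 3 (by norm_num)
  rw [w0] at e0; rw [w1] at e1; rw [w2] at e2; rw [w3] at e3
  norm_num at e0 e1 e2 e3
  obtain ⟨a, ha⟩ := Set.nonempty_Ioo.2 (hI.lt i)
  obtain ⟨b, hb⟩ := Set.nonempty_Ioo.2 (hI.lt (i + 2))
  obtain ⟨c, hc⟩ := Set.nonempty_Ioo.2 (hI.lt (i + 4))
  have hab : a < b := ha.2.trans (lt_of_le_of_lt (hI.mono.monotone (by omega)) hb.1)
  have hbc : b < c := hb.2.trans (lt_of_le_of_lt (hI.mono.monotone (by omega)) hc.1)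
  obtain ⟨θ, t0, t1, hmix⟩ := ((isLine_geodesic u).smul (h (i + 2))⁻¹).mix hab hbc
  have ma := interior_subset (hI.int i a ha)
  have mb := hI.int _ b hb
  have mc := interior_subset (hI.int _ c hc)
  have fa : formEval (1, -2 * σ, 0) ((h (i + 2))⁻¹ • geodesic u a) ≤ 0 := by
    have hh : h i = h (i + 2) * QuotientGroup.mk (invSL * G⁻¹) := by
      rw [e1, e0, QuotientGroup.mk_mul, QuotientGroup.mk_inv]
      nth_rewrite 2 [← mk_invSL_inv]
      group
    rw [hh, mul_smul, Set.mem_smul_set_iff_inv_smul_mem, mem_mk_smul_iff] at ma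
    have hz := (mem_fd_iff _).1 ma
    set z := (invSL * G⁻¹)⁻¹ • (h (i + 2))⁻¹ • geodesic u a
    rw [← smul_inv_smul (invSL * G⁻¹) ((h (i + 2))⁻¹ • geodesic u a)]
    change formEval _ ((invSL * G⁻¹) • z) ≤ 0
    rw [← not_lt, formEval_smul_pos, not_lt]
    simp only [formEval, formAct, sl_mul_apply, sl_inv_00, sl_inv_01, sl_inv_10, sl_inv_11, h00,
      h01, h10, h11, invSL, slMk_00, slMk_01, slMk_10, slMk_11]
    rcases hσ with rfl | rfl <;> linarith [hz.1, hz.2.1]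
  have fc : formEval (1, -2 * σ, 0) ((h (i + 2))⁻¹ • geodesic u c) ≤ 0 := by
    have hh : h (i + 4) = h (i + 2) * QuotientGroup.mk (G * invSL) := by
      rw [e3, e2, QuotientGroup.mk_mul, mul_assoc]
    rw [hh, mul_smul, Set.mem_smul_set_iff_inv_smul_mem, mem_mk_smul_iff] at mc
    have hz := (mem_fd_iff _).1 mc
    set z := (G * invSL)⁻¹ • (h (i + 2))⁻¹ • geodesic u c
    rw [← smul_inv_smul (G * invSL) ((h (i + 2))⁻¹ • geodesic u c)]
    change formEval _ ((G * invSL) • z) ≤ 0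
    rw [← not_lt, formEval_smul_pos, not_lt]
    simp only [formEval, formAct, sl_mul_apply, h00,
      h01, h10, h11, invSL, slMk_00, slMk_01, slMk_10, slMk_11]
    nlinarith [hz.2.2]
  have fb : 0 < formEval (1, -2 * σ, 0) ((h (i + 2))⁻¹ • geodesic u b) := by
    rw [smul_interior, Set.mem_smul_set_iff_inv_smul_mem] at mb
    refine formEval_pos_of_mem_interior (by simp) (fun z hz => ?_) mb
    have hz := (mem_fd_iff _).1 hz
    simp only [formEval]
    rcases hσ with rfl | rfl <;> linarith [hz.1, hz.2.1, hz.2.2]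
  rw [hmix.formEval] at fb
  nlinarith [mul_nonneg (sub_nonneg.2 t1.le) (neg_nonneg.2 fa), mul_nonneg t0.le (neg_nonneg.2 fc)]

theorem modularGroup_le {Γ : Subgroup PSL(2, ℝ)} (hT : (QuotientGroup.mk transSL : PSL(2, ℝ)) ∈ Γ)
    (hS : (QuotientGroup.mk invSL : PSL(2, ℝ)) ∈ Γ) : modularGroup ≤ Γ := by
  rintro _ ⟨γ, rfl⟩
  have : (⊤ : Subgroup SL(2, ℤ)) ≤ Γ.comap ((QuotientGroup.mk' (Subgroup.center SL(2, ℝ))).comp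
      (Matrix.SpecialLinearGroup.map (Int.castRingHom ℝ))) := by
    rw [← SpecialLinearGroup.SL2Z_generators, Subgroup.closure_le]
    rintro _ (rfl | rfl)
    · change (QuotientGroup.mk (toR ModularGroup.S) : PSL(2, ℝ)) ∈ Γ
      rwa [toR_S]
    · change (QuotientGroup.mk (toR ModularGroup.T) : PSL(2, ℝ)) ∈ Γ
      rwa [toR_T]
  exact this (Subgroup.mem_top γ)

/-! ### Conjugation of tessellations -/

theorem mem_neighborhoodSet_conj {Γ : Subgroup PSL(2, ℝ)} {P : Set ℍ} {v x : PSL(2, ℝ)} :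
    v * x * v⁻¹ ∈ neighborhoodSet (Γ.map (MulAut.conj v).toMonoidHom) (v • P) ↔
      x ∈ neighborhoodSet Γ P := by
  have h1 : v * x * v⁻¹ ∈ Γ.map (MulAut.conj v).toMonoidHom ↔ x ∈ Γ := by
    constructor
    · rintro ⟨y, hy, e⟩
      simp only [MulEquiv.coe_toMonoidHom, MulAut.conj_apply, mul_left_inj, mul_right_inj] at e
      rwa [← e]
    · exact fun h => ⟨x, h, rfl⟩
  have h2 : v * x * v⁻¹ = 1 ↔ x = 1 := by rw [mul_inv_eq_one, mul_eq_left]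
  have h3 : v • P ∩ (v * x * v⁻¹) • v • P = v • (P ∩ x • P) := by
    rw [Set.smul_set_inter, mul_smul, mul_smul, inv_smul_smul]
  have h4 : (v • (P ∩ x • P)).Nontrivial ↔ (P ∩ x • P).Nontrivial :=
    Set.image_nontrivial (MulAction.injective v)
  simp only [neighborhoodSet, Set.mem_ofPred_eq, h1, h3, Ne, h2, h4]

theorem neighborhoodSet_conj {Γ : Subgroup PSL(2, ℝ)} {P : Set ℍ} (v : PSL(2, ℝ)) :
    neighborhoodSet (Γ.map (MulAut.conj v).toMonoidHom) (v • P) =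
      (fun x => v * x * v⁻¹) '' neighborhoodSet Γ P := by
  ext y
  have : v * (v⁻¹ * y * v) * v⁻¹ = y := by group
  constructor
  · intro h
    rw [← this, mem_neighborhoodSet_conj] at h
    exact ⟨_, h, this⟩
  · rintro ⟨x, hx, rfl⟩
    exact mem_neighborhoodSet_conj.2 hx

theorem IsItinerary.conj {Γ : Subgroup PSL(2, ℝ)} {P : Set ℍ} {γ : ℝ → ℍ} {h : ℤ → PSL(2, ℝ)}
    {t : ℤ → ℝ} (hI : IsItinerary Γ P γ h t) (v : PSL(2, ℝ)) :
    IsItinerary (Γ.map (MulAut.conj v).toMonoidHom) (v • P) (fun s => v • γ s)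
      (fun i => v * h i * v⁻¹) t where
  mem i := ⟨h i, hI.mem i, rfl⟩
  step i := by
    rw [show (v * h i * v⁻¹)⁻¹ * (v * h (i + 1) * v⁻¹) = v * ((h i)⁻¹ * h (i + 1)) * v⁻¹ by group]
    exact mem_neighborhoodSet_conj.2 (hI.step i)
  mono := hI.mono
  top := hI.top
  bot := hI.bot
  int i s hs := by
    rw [mul_smul, mul_smul, inv_smul_smul, smul_interior]
    exact Set.smul_mem_smul_set (hI.int i s hs)

theorem IsConvexPolygon.isFormPolygon {P : Set ℍ} (hP : IsConvexPolygon P) : IsFormPolygon P := by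
  obtain ⟨⟨S, -, h⟩, -⟩ := hP
  exact ⟨S, h⟩

/-! ### Inverses in a three-letter alphabet -/

/-- Inversion is an involutive permutation of three letters, so it fixes one of them. Neither a nor
b is fixed. -/
theorem inv_eq_of_three {N : Set PSL(2, ℝ)} {a b c : PSL(2, ℝ)} (hN : N = {a, b, c})
    (hinv : ∀ x ∈ N, x⁻¹ ∈ N) (hab : a ≠ b) (hac : a ≠ c) (hbc : b ≠ c) (ha : a⁻¹ ≠ a)
    (hb : b⁻¹ ≠ b) : a⁻¹ = b ∧ c⁻¹ = c := by
  subst hN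
  have h1 := hinv a (by simp)
  have h2 := hinv b (by simp)
  have h3 := hinv c (by simp)
  simp only [Set.mem_insert_iff, Set.mem_singleton_iff] at h1 h2 h3
  rcases h3 with h3 | h3 | h3
  · exfalso
    rcases h2 with h2 | h2 | h2
    · exact hbc (inv_injective (h2.trans h3.symm))
    · exact hb h2
    · rw [inv_eq_iff_eq_inv, h3] at h2; exact hab h2.symm
  · exfalso
    rcases h1 with h1 | h1 | h1
    · exact ha h1
    · exact hac (inv_injective (h1.trans h3.symm))
    · rw [inv_eq_iff_eq_inv, h3] at h1; exact hab h1
  · refine ⟨?_, h3⟩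
    rcases h1 with h1 | h1 | h1
    · exact absurd h1 ha
    · exact h1
    · exact absurd (inv_injective (h1.trans h3.symm)) hac

theorem inv_ne_self_of_not_isOfFinOrder {a : PSL(2, ℝ)} (ha : ¬ IsOfFinOrder a) : a⁻¹ ≠ a := by
  intro h
  refine ha (isOfFinOrder_iff_pow_eq_one.2 ⟨2, by norm_num, ?_⟩)
  rw [pow_two]
  nth_rewrite 1 [← h]
  exact inv_mul_cancel a

/-- A strip tile with the bottom radius of the modular one is the modular tile. -/
theorem StripTile.eq_fd {Γ : Subgroup PSL(2, ℝ)} {P : Set ℍ} {g s : SL(2, ℝ)} {t : ℝ}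
    (h : StripTile Γ P g s 1 0 t) (ht : t ^ 2 = 1) :
    ModularGroup.fd = P ∧ modularGroup = Γ := by
  have hfd : ModularGroup.fd = P := by
    ext z; rw [mem_fd_iff, h.region]
  have hs : (QuotientGroup.mk s : PSL(2, ℝ)) = QuotientGroup.mk invSL := by
    rw [psl_mk_eq_mk_iff]
    rcases mul_self_eq_one_iff.1 ((sq t).symm.trans ht) with rfl | rfl
    · left; apply sl_ext <;> simp [h.s_00, h.s_01, h.s_10, h.s_11, invSL]
    · right; apply sl_ext <;> simp [h.s_00, h.s_01, h.s_10, h.s_11, invSL]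
  have hle : modularGroup ≤ Γ := modularGroup_le h.trans_mem (by rw [← hs]; exact h.s_mem)
  refine ⟨hfd, le_antisymm hle fun x hx => ?_⟩
  -- The smaller group already tessellates with the same tile. For x in Γ, the tile xP meets a
  -- modular tile yP in an interior point, whence x = y.
  obtain ⟨z, hz⟩ := h.interior_nonempty
  obtain ⟨y, hy, hzy⟩ := isFundamentalTile_fd.cover (x • z)
  rw [hfd] at hzy
  rw [tile_eq_of_interior h.tile h.isFormPolygon h.interior_nonempty hx (hle hy) (z := x • z)
    (by rw [smul_interior]; exact Set.smul_mem_smul_set hz) hzy]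
  exact hy

/-- A triangular tessellation whose strip is lower than the modular one has a cutting sequence
containing a word of the form `a, s, a, s`. -/
theorem TriangleTile.exists_occurs {Γ : Subgroup PSL(2, ℝ)} {P : Set ℍ} {g s : SL(2, ℝ)}
    {q₁ q₂ q₃ : ℝ × ℝ × ℝ} (h : TriangleTile Γ P g s q₁ q₂ q₃) (hvert : (vertexSet Γ P).Countable)
    (hN : neighborhoodSet Γ P = {QuotientGroup.mk g, (QuotientGroup.mk g)⁻¹, QuotientGroup.mk s})
    (hss : (QuotientGroup.mk s : PSL(2, ℝ))⁻¹ = QuotientGroup.mk s) {u : SL(2, ℝ)} {r p t : ℝ}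
    (hstrip : StripTile (Γ.map (MulAut.conj (QuotientGroup.mk u : PSL(2, ℝ))).toMonoidHom)
      ((QuotientGroup.mk u : PSL(2, ℝ)) • P) (u * g * u⁻¹) (u * s * u⁻¹) r p t)
    (hr : r ^ 2 ≤ 1 / 2) : ∃ a : PSL(2, ℝ),
      (a = QuotientGroup.mk g ∨ a = (QuotientGroup.mk g)⁻¹) ∧ ∀ w : ℕ → PSL(2, ℝ),
        w 0 = a → w 1 = QuotientGroup.mk s → w 2 = a → w 3 = QuotientGroup.mk s →
          Occurs Γ P 4 w := by
  set v : PSL(2, ℝ) := QuotientGroup.mk u with hv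
  have hgc : (QuotientGroup.mk (u * g * u⁻¹) : PSL(2, ℝ)) = v * QuotientGroup.mk g * v⁻¹ := rfl
  have hsc : (QuotientGroup.mk (u * s * u⁻¹) : PSL(2, ℝ)) = v * QuotientGroup.mk s * v⁻¹ := rfl
  have hg := hstrip.g_eq
  rw [hgc] at hg
  -- The normalisation takes g to T or to T⁻¹, so a is whichever of g and g⁻¹ becomes T.
  obtain ⟨a, ha, hav⟩ : ∃ a : PSL(2, ℝ), (a = QuotientGroup.mk g ∨ a = (QuotientGroup.mk g)⁻¹) ∧
      QuotientGroup.mk transSL = v * a * v⁻¹ := by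
    rcases hg with hg | hg
    · exact ⟨_, Or.inl rfl, hg.symm⟩
    · refine ⟨_, Or.inr rfl, ?_⟩
      rw [← inv_inj, ← hg]; group
  have hN' : neighborhoodSet (Γ.map (MulAut.conj v).toMonoidHom) (v • P) =
      {QuotientGroup.mk transSL, (QuotientGroup.mk transSL)⁻¹,
        QuotientGroup.mk (u * s * u⁻¹)} := by
    rw [neighborhoodSet_conj, hN, hsc, hav, Set.image_insert_eq, Set.image_insert_eq,
      Set.image_singleton]
    have hi : ∀ y : PSL(2, ℝ), (v * y * v⁻¹)⁻¹ = v * y⁻¹ * v⁻¹ := fun y => by group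
    rcases ha with rfl | rfl
    · rw [hi]
    · rw [hi, inv_inv, Set.insert_comm]
  obtain ⟨ε₀, hε₀, hword⟩ := hstrip.exists_word hN' (by
    rw [hsc]; nth_rewrite 2 [← hss]; group) hr
  -- The lines have slope 3/2 in the coordinates of the strip, but genericity is required for the
  -- original tile. Hence the matrix u⁻¹, which brings the lines back.
  obtain ⟨M, hM, hgen⟩ := exists_countable_exceptions h.tile h.isFormPolygon h.interior_nonempty
    hvert (fun x _ => h.countable_idealPoints_smul x) u⁻¹ (3 / 2)
  obtain ⟨m, hmM, hm⟩ := (hM.dense_compl ℝ).exists_mem_open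
    (isOpen_Ioo (a := r ^ 2 - 3 / 4) (b := r ^ 2 - 3 / 4 + ε₀))
    (Set.nonempty_Ioo.2 (by linarith))
  obtain ⟨x, hx, ⟨_, ⟨τ, rfl⟩, hint⟩, hx'⟩ := hword (m - (r ^ 2 - 3 / 4)) (by linarith [hm.1])
    (by linarith [hm.2])
  have hgeo : ∀ τ, geodesic x τ = v • geodesic (v⁻¹ * x) τ := fun τ => by
    simp only [geodesic]; rw [← mul_smul, mul_inv_cancel_left]
  obtain ⟨hgp, y, T, y0, hI⟩ := hgen m hmM (v⁻¹ * x) (fun τ => by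
      have := hx τ
      rw [hgeo] at this
      rw [inv_inv, ← psl_mk_smul, ← hv]
      convert this using 2
      ring_nf) ⟨_, ⟨τ, rfl⟩, by
      rw [hgeo, smul_interior] at hint
      exact (Set.smul_mem_smul_set_iff).1 hint⟩
  have hI' := hI.conj v
  simp only [← hgeo] at hI'
  obtain ⟨i, e0, e1, e2, e3⟩ := hx' _ _ hI'
  have hcan : ∀ z z' b : PSL(2, ℝ), v * z * v⁻¹ = v * z' * v⁻¹ * (v * b * v⁻¹) → z = z' * b := by
    intro z z' b hz
    rw [show v * z' * v⁻¹ * (v * b * v⁻¹) = v * (z' * b) * v⁻¹ by group, mul_left_inj,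
      mul_right_inj] at hz
    exact hz
  rw [hav] at e0 e2
  rw [hsc] at e1 e3
  refine ⟨a, ha, fun w w0 w1 w2 w3 => occurs_iff.2 ⟨_, hgp, y, T, y0, hI, i, fun j hj => ?_⟩⟩
  have e0 := hcan _ _ _ e0
  have e1 := hcan _ _ _ e1
  have e2 := hcan _ _ _ e2
  have e3 := hcan _ _ _ e3
  simp only [add_assoc] at e0 e1 e2 e3
  norm_num at e0 e1 e2 e3
  interval_cases j
  · simpa [w0] using e0
  · simpa [w1] using e1
  · simpa [w2] using e2
  · simpa [w3] using e3

/-! ### Assembly of the argument. -/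

theorem theorem8p1 (Γ : Subgroup PSL(2, ℝ)) (hfg : Γ.FG) (hdisc : DiscreteTopology Γ)
    (P : Set ℍ) (hP : IsConvexPolygon P) (harea : MeasureTheory.volume P < ⊤)
    (hfund : IsFundamentalTile Γ P)
    (e : neighborhoodSet Γ P ≃ neighborhoodSet modularGroup ModularGroup.fd)
    (he : (fun c : ℤ → neighborhoodSet Γ P => fun i => e (c i)) '' cuttingShift Γ P =
      cuttingShift modularGroup ModularGroup.fd) :
    ∃ g : PSL(2, ℝ), ModularGroup.fd = g • P ∧
      modularGroup = Γ.map (MulAut.conj g).toMonoidHom := by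
  have hF := hP.isFormPolygon
  have hne := hP.2
  have hNm := neighborhoodSet_fd
  let T : neighborhoodSet modularGroup ModularGroup.fd :=
    ⟨QuotientGroup.mk transSL, by rw [hNm]; simp⟩
  let T' : neighborhoodSet modularGroup ModularGroup.fd :=
    ⟨(QuotientGroup.mk transSL)⁻¹, by rw [hNm]; simp⟩
  let S : neighborhoodSet modularGroup ModularGroup.fd :=
    ⟨QuotientGroup.mk invSL, by rw [hNm]; simp⟩
  have hall : ∀ x : neighborhoodSet modularGroup ModularGroup.fd, x = T ∨ x = T' ∨ x = S := by
    rintro ⟨x, hx⟩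
    have hx' := hx
    rw [hNm] at hx'
    rcases hx' with rfl | rfl | rfl
    exacts [Or.inl rfl, Or.inr (Or.inl rfl), Or.inr (Or.inr rfl)]
  have hTT' : T ≠ T' := fun h => mk_transSL_ne_inv (congrArg Subtype.val h)
  have hST : S ≠ T := fun h => mk_invSL_ne (congrArg Subtype.val h)
  have hST' : S ≠ T' := fun h => mk_invSL_ne_inv (congrArg Subtype.val h)
  -- All powers of T and T⁻¹ occur in the modular shift, so all powers of the corresponding letters
  -- occur for P, and these letters cannot have finite order.
  have hinf : ∀ x : neighborhoodSet modularGroup ModularGroup.fd, x = T ∨ x = T' →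
      ¬ IsOfFinOrder (e.symm x : PSL(2, ℝ)) := by
    intro x hx
    refine not_isOfFinOrder_of_occurs hfund hF hne fun n => ?_
    refine (occurs_transfer e he n fun _ => e.symm x).2 ?_
    simp only [Equiv.apply_symm_apply]
    rcases hx with rfl | rfl
    · simpa using occurs_trans_zpow (σ := 1) (Or.inl rfl) n
    · simpa using occurs_trans_zpow (σ := -1) (Or.inr rfl) n
  obtain ⟨g, hg⟩ := psl_exists_mk (e.symm T : PSL(2, ℝ))
  obtain ⟨s, hs⟩ := psl_exists_mk (e.symm S : PSL(2, ℝ))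
  have hval : ∀ {x y}, x ≠ y → (e.symm x : PSL(2, ℝ)) ≠ e.symm y := fun hxy h =>
    hxy (e.symm.injective (Subtype.ext h))
  have hN₀ : neighborhoodSet Γ P = {(e.symm T : PSL(2, ℝ)), (e.symm T' : PSL(2, ℝ)),
      (e.symm S : PSL(2, ℝ))} := by
    ext x
    constructor
    · intro hx
      have hx' : x = e.symm (e ⟨x, hx⟩) := by rw [Equiv.symm_apply_apply]
      rcases hall (e ⟨x, hx⟩) with h | h | h <;> rw [h] at hx' <;> simp [← hx']
    · rintro (rfl | rfl | rfl) <;> exact Subtype.property _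
  -- The bijection e is not assumed to respect inverses. That it does so on these letters follows
  -- from the orders of the elements.
  obtain ⟨hTinv, hSinv⟩ := inv_eq_of_three hN₀ (fun x hx => inv_mem_neighborhoodSet hx)
    (hval hTT') (hval hST.symm) (hval hST'.symm)
    (inv_ne_self_of_not_isOfFinOrder (hinf T (Or.inl rfl)))
    (inv_ne_self_of_not_isOfFinOrder (hinf T' (Or.inr rfl)))
  have hgT := hinf T (Or.inl rfl)
  have hsg := hval hST
  have hsg' := hval hST'
  rw [← hTinv] at hN₀ hsg'
  rw [← hg] at hN₀ hsg hsg' hgT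
  rw [← hs] at hN₀ hsg hsg' hSinv
  obtain ⟨hvert, q₁, q₂, q₃, htri⟩ := exists_triangleTile hfund hF hne harea hN₀
    (inv_ne_self_of_not_isOfFinOrder hgT).symm hsg hsg' hSinv hgT
  obtain ⟨u, r, p, t, hstrip⟩ := htri.exists_stripTile
  rcases hstrip.eq_one_or_le with ⟨rfl, rfl, ht⟩ | hr
  · exact ⟨QuotientGroup.mk u, hstrip.eq_fd ht⟩
  · exfalso
    obtain ⟨a, ha, hocc⟩ := htri.exists_occurs hvert hN₀ hSinv hstrip hr
    -- The letter a corresponds to T or to T⁻¹. In both cases the word a, s, a, s would carry over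
    -- to a forbidden modular word, with σ = 1 or σ = −1.
    have key : ∀ x : neighborhoodSet modularGroup ModularGroup.fd, (e.symm x : PSL(2, ℝ)) = a →
        ∀ (G : SL(2, ℝ)) (σ : ℝ), (x : PSL(2, ℝ)) = QuotientGroup.mk G → (σ = 1 ∨ σ = -1) →
          G 0 0 = 1 → G 0 1 = σ → G 1 0 = 0 → G 1 1 = 1 → False := by
      intro x hx G σ hG hσ h00 h01 h10 h11
      let w : ℕ → neighborhoodSet Γ P := fun j => if j % 2 = 0 then e.symm x else e.symm S
      have := (occurs_transfer e he 4 w).1 (hocc _ hx hs.symm hx hs.symm)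
      refine not_occurs_fd hσ h00 h01 h10 h11 ?_ ?_ ?_ ?_ this
      · exact (congrArg Subtype.val (e.apply_symm_apply x)).trans hG
      · exact congrArg Subtype.val (e.apply_symm_apply S)
      · exact (congrArg Subtype.val (e.apply_symm_apply x)).trans hG
      · exact congrArg Subtype.val (e.apply_symm_apply S)
    rcases ha with rfl | rfl
    · refine key T hg.symm transSL 1 rfl (Or.inl rfl) ?_ ?_ ?_ ?_ <;> simp [transSL]
    · refine key T' (by rw [← hTinv, hg]) transSL⁻¹ (-1) rfl (Or.inr rfl) ?_ ?_ ?_ ?_ <;>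
        simp [transSL, sl_inv_00, sl_inv_01, sl_inv_10, sl_inv_11]

end
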